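/- Let $G$ be a finite undirected multigraph (parallel edges allowed, loops not) with $n$ nodes and $m$ edges, and let $s_1,t_1,s_2,t_2,s_3,t_3$ be nodes of $G$, not necessarily distinct. Let $H$ be the demand graph on the nodes of $G$ with the three edges $s_1t_1$, $s_2t_2$, $s_3t_3$ (an edge with $s_i=t_i$ is a loop and counts twice in the degree). The instance $(G,H)$ is called *Eulerian* if every node has even degree in $G+H$ (the multigraph whose edges are those of $G$ and those of $H$), and *feasible* if there are three pairwise edge-disjoint paths $P_1,P_2,P_3$ in $G$ such that $P_i$ goes from $s_i$ to $t_i$ for $i=1,2,3$. As usual, it is assumed that $n=O(m)$. **Theorem.** Feasibility of an Eulerian instance $(G,H)$ can be decided in $O(m)$ time, and if the instance is feasible, paths $P_1,P_2,P_3$ as above can be constructed in $O(m)$ time. Precisely: there is one program for a unit-cost random access machine (assignments, addition, truncated subtraction, comparisons, indirect loads and stores) such that for every $K$ there is a constant $C$ with the following property. For every Eulerian instance with $n\le Km$, given by the list of the edges of $G$ and the list of terminals, the program halts after at most $Cm$ steps, every number it computes is less than $Cm$, it reports correctly whether the instance is feasible, and if so it outputs the edge sequences of three paths $P_1,P_2,P_3$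 as above. -/

import Mathlib

namespace ThreePaths

/-! ### Graphs and the edge-disjoint paths problem -/

/-- A finite multigraph with node set `Fin n` and edge set `Fin m`, given by its edge list: the edge
`e` has the endpoints `fst e` and `snd e`. Their order is immaterial (the graph is undirected).
Parallel edges are allowed; loops are excluded separately, by `Loopless`. -/
structure Multigraph (n m : ℕ) where
  fst : Fin m → Fin n
  snd : Fin m → Fin n

namespace Multigraph

variable {n m k : ℕ}

def Loopless (G : Multigraph n m) : Prop := ∀ e, G.fst e ≠ G.snd e

/-- The degree of a node; a loop counts twice. -/
def degree (G : Multigraph n m) (v : Fin n) : ℕ :=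
  (Finset.univ.filter fun e => G.fst e = v).card + (Finset.univ.filter fun e => G.snd e = v).card

/-- `G + H`: same nodes, disjoint union of the edges. -/
def sum (G : Multigraph n m) (H : Multigraph n k) : Multigraph n (m + k) where
  fst := Fin.append G.fst H.fst
  snd := Fin.append G.snd H.snd

/-- The edge `e` joins the nodes `u` and `v`. -/
def Joins (G : Multigraph n m) (e : Fin m) (u v : Fin n) : Prop :=
  (G.fst e = u ∧ G.snd e = v) ∨ (G.fst e = v ∧ G.snd e = u)

/-- `G.IsWalk vs es`: the edges `es`, in this order, form a walk that visits the nodes `vs`. -/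
inductive IsWalk (G : Multigraph n m) : List (Fin n) → List (Fin m) → Prop
  | single (v : Fin n) : IsWalk G [v] []
  | cons {e : Fin m} {u v : Fin n} {vs : List (Fin n)} {es : List (Fin m)} :
      G.Joins e u v → IsWalk G (v :: vs) es → IsWalk G (u :: v :: vs) (e :: es)

/-- The edges `es` form a path from `u` to `v` (no node, hence no edge, is repeated).
For `u = v` this is the empty path. -/
def IsPath (G : Multigraph n m) (u v : Fin n) (es : List (Fin m)) : Prop :=
  ∃ vs : List (Fin n), G.IsWalk vs es ∧ vs.head? = some u ∧ vs.getLast? = some v ∧ vs.Nodup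

/-- `P` assigns to every edge `i` of the demand graph `H` a path in `G` between the ends of `i`,
and these paths are pairwise edge-disjoint. -/
def IsSolution (G : Multigraph n m) (H : Multigraph n k) (P : Fin k → List (Fin m)) : Prop :=
  (∀ i, G.IsPath (H.fst i) (H.snd i) (P i)) ∧ ∀ i j, i ≠ j → List.Disjoint (P i) (P j)

def Feasible (G : Multigraph n m) (H : Multigraph n k) : Prop := ∃ P, G.IsSolution H P

def Eulerian (G : Multigraph n m) (H : Multigraph n k) : Prop := ∀ v, Even ((G.sum H).degree v)

end Multigraph

/-! ### The machine model

Structured programs for a random access machine with unit cost and bounded word length. A program is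
a fixed finite syntax tree; it names finitely many registers and finitely many arrays of memory
cells. Registers and cells hold natural numbers. Every elementary instruction and every evaluation
of a test takes one step. -/

/-- The contents of the registers, and of the cells of each array. -/
structure State where
  reg : ℕ → ℕ
  mem : ℕ → ℕ → ℕ

def State.setReg (σ : State) (r x : ℕ) : State :=
  { σ with reg := Function.update σ.reg r x }

def State.setMem (σ : State) (a i x : ℕ) : State :=
  { σ with mem := Function.update σ.mem a (Function.update (σ.mem a) i x) }

/-- Tests compare two registers. -/
inductive Test
  | lt (p q : ℕ)
  | eq (p q : ℕ)

def Test.Holds : Test → State → Prop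
  | .lt p q, σ => σ.reg p < σ.reg q
  | .eq p q, σ => σ.reg p = σ.reg q

/-- Programs. Here `r`, `p`, `q` are names of registers, `a` is the name of an array. -/
inductive Program
  /-- Do nothing. -/
  | skip
  /-- `r := c` -/
  | const (r c : ℕ)
  /-- `r := p` -/
  | copy (r p : ℕ)
  /-- `r := p + q` -/
  | add (r p q : ℕ)
  /-- `r := max (p - q) 0` -/
  | sub (r p q : ℕ)
  /-- `r := a[p]` -/
  | load (r a p : ℕ)
  /-- `a[p] := q` -/
  | store (a p q : ℕ)
  | seq (c d : Program)
  | ite (b : Test) (c d : Program)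
  | while (b : Test) (c : Program)

/-- `Runs B c σ T τ`: started in the state `σ`, the program `c` halts after exactly `T` steps in the
state `τ`, and every number that it computes on the way is less than `B` (that is, words of
`⌈log₂ B⌉` bits suffice; an instruction whose result is too large has no successor state). -/
inductive Runs (B : ℕ) : Program → State → ℕ → State → Prop
  | skip (σ : State) : Runs B .skip σ 1 σ
  | const (σ : State) (r c : ℕ) (h : c < B) : Runs B (.const r c) σ 1 (σ.setReg r c)
  | copy (σ : State) (r p : ℕ) : Runs B (.copy r p) σ 1 (σ.setReg r (σ.reg p))
  | add (σ : State) (r p q : ℕ) (h : σ.reg p + σ.reg q < B) :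
      Runs B (.add r p q) σ 1 (σ.setReg r (σ.reg p + σ.reg q))
  | sub (σ : State) (r p q : ℕ) : Runs B (.sub r p q) σ 1 (σ.setReg r (σ.reg p - σ.reg q))
  | load (σ : State) (r a p : ℕ) : Runs B (.load r a p) σ 1 (σ.setReg r (σ.mem a (σ.reg p)))
  | store (σ : State) (a p q : ℕ) :
      Runs B (.store a p q) σ 1 (σ.setMem a (σ.reg p) (σ.reg q))
  | seq {c d : Program} {σ σ₁ σ₂ : State} {T₁ T₂ : ℕ} :
      Runs B c σ T₁ σ₁ → Runs B d σ₁ T₂ σ₂ → Runs B (.seq c d) σ (T₁ + T₂) σ₂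
  | ite_true {b : Test} {c d : Program} {σ σ₁ : State} {T : ℕ} :
      b.Holds σ → Runs B c σ T σ₁ → Runs B (.ite b c d) σ (1 + T) σ₁
  | ite_false {b : Test} {c d : Program} {σ σ₁ : State} {T : ℕ} :
      ¬ b.Holds σ → Runs B d σ T σ₁ → Runs B (.ite b c d) σ (1 + T) σ₁
  | while_true {b : Test} {c : Program} {σ σ₁ σ₂ : State} {T₁ T₂ : ℕ} :
      b.Holds σ → Runs B c σ T₁ σ₁ → Runs B (.while b c) σ₁ T₂ σ₂ →
      Runs B (.while b c) σ (1 + T₁ + T₂) σ₂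
  | while_false {b : Test} {c : Program} {σ : State} :
      ¬ b.Holds σ → Runs B (.while b c) σ 1 σ

/-! ### Input and output -/

/-- The array that holds `f 0, f 1, …`, followed by zeros. -/
def toArray {k n : ℕ} (f : Fin k → Fin n) (j : ℕ) : ℕ :=
  if h : j < k then (f ⟨j, h⟩ : ℕ) else 0

/-- The initial state for the instance `(G, H)`: registers `0` and `1` hold the numbers of nodes and
of edges of `G`; arrays `0` and `1` hold the endpoints of the edges of `G`; arrays `2` and `3` hold
the terminals `s_i` and `t_i`. Everything else is zero. -/
def initState {n m k : ℕ} (G : Multigraph n m) (H : Multigraph n k) : State where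
  reg r := match r with
    | 0 => n
    | 1 => m
    | _ => 0
  mem a := match a with
    | 0 => toArray G.fst
    | 1 => toArray G.snd
    | 2 => toArray H.fst
    | 3 => toArray H.snd
    | _ => fun _ => 0

/-- The state `σ` displays the lists of edges `P i`: cell `i` of array `4` holds the length of `P i`,
and array `5 + i` starts with the edges of `P i`, in order. -/
def Displays {m k : ℕ} (σ : State) (P : Fin k → List (Fin m)) : Prop :=
  ∀ i : Fin k, σ.mem 4 i = (P i).length ∧
    ∀ (j : ℕ) (h : j < (P i).length), σ.mem (5 + i) j = ((P i)[j] : ℕ)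

end ThreePaths

/-! Degrees are counted modulo 2, with multiplicity where terminals coincide. If edge-disjoint paths
for the second and third pairs are removed, only $s_1$ and $t_1$ remain odd, so they are connected
(`reach_last`). It therefore suffices to find a set `E` of edges that connects the third pair while
its complement connects the second (`Prepared`).

Let $P$ be any path from $s_3$ to $t_3$. If $G-P$ connects $s_2$ with $t_2$, take $E=P$. Otherwise
$s_2$ and $t_2$ lie in different components of $G-P$, and by parity each of these contains exactly
one end of the first pair (`ends_in_component`). In a feasible instance $P$ meets both components.
Follow $P$ from $s_3$: let $A$ be the one that it meets first, $B$ the other one, and $j$ its first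
node in $B$. Let $y_1,y_2$ be the ends of the second and first pair in $A$, and $z_1,z_2$ those in
$B$. The set `outside` of the edges of $P$ and all edges not in $B$ has the odd nodes
$s_3,t_3,y_1,y_2$. Suppose that it contains edge-disjoint paths from $j$ to $y_1$ and to $y_2$.
Without them, only $s_3$ and $t_3$ are odd in `outside`, so they are connected there
(`reach_third`); the second pair is connected through $B$, $j$ and the removed edges (`reach_rest`).
So `outside` minus these edges is the required `E`.

In a feasible instance the two paths exist. The first does because $P$ has met $A$ before $j$
(`reach_first`). If the second did not (`reach_second`), a set $K$ containing $j$ but neither $y_1$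
nor $y_2$ would be left by a single edge $f$ of `outside`. Parity puts $f$ on $P$, and the choice of
$j$ puts it on the part before $j$. Then $f$ is the only edge that leaves $K\cup B$, which separates
both the first and the second pair; two disjoint paths cannot share $f$.

The two paths are found by two augmentations, so a bounded number of breadth-first searches and
walks along paths suffices. The program performs them blindly, also on infeasible instances. It
answers yes only when it has found three disjoint paths, and a no is possible only if `Prepared`
fails (`finish_spec`), which does not happen in feasible Eulerian instances (`prepare_spec`). -/

namespace ThreePaths

/-! ### Reasoning about programs -/

/-- Started in `σ`, the program `c` halts after at most `t` steps in a state with property `Q`. -/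
def Meets (B : ℕ) (c : Program) (σ : State) (t : ℕ) (Q : State → Prop) : Prop :=
  ∃ T τ, Runs B c σ T τ ∧ T ≤ t ∧ Q τ

/-- The registers that a program may write. -/
def Program.regs : Program → List ℕ
  | .skip => []
  | .const r _ => [r]
  | .copy r _ => [r]
  | .add r _ _ => [r]
  | .sub r _ _ => [r]
  | .load r _ _ => [r]
  | .store _ _ _ => []
  | .seq c d => c.regs ++ d.regs
  | .ite _ c d => c.regs ++ d.regs
  | .while _ c => c.regs

/-- The arrays that a program may write. -/
def Program.arrays : Program → List ℕ
  | .store a _ _ => [a]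
  | .seq c d => c.arrays ++ d.arrays
  | .ite _ c d => c.arrays ++ d.arrays
  | .while _ c => c.arrays
  | _ => []

/-- `τ` differs from `σ` only in what `c` may write. -/
structure Frame (c : Program) (σ τ : State) : Prop where
  reg : ∀ r, r ∉ c.regs → τ.reg r = σ.reg r
  mem : ∀ a, a ∉ c.arrays → τ.mem a = σ.mem a

theorem Frame.refl (c : Program) (σ : State) : Frame c σ σ := ⟨fun _ _ => rfl, fun _ _ => rfl⟩

theorem Frame.trans {c : Program} {σ τ ρ : State} (h : Frame c σ τ) (h' : Frame c τ ρ) :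
    Frame c σ ρ :=
  ⟨fun r hr => (h'.reg r hr).trans (h.reg r hr), fun a ha => (h'.mem a ha).trans (h.mem a ha)⟩

theorem Runs.frame {B T : ℕ} {c : Program} {σ τ : State} (h : Runs B c σ T τ) :
    Frame c σ τ := by
  induction h with
  | skip => exact Frame.refl _ _
  | store σ a p q =>
    refine ⟨fun r _ => rfl, fun b hb => ?_⟩
    simp only [Program.arrays, List.mem_singleton] at hb
    simp [State.setMem, Function.update_of_ne hb]
  | seq _ _ ih₁ ih₂ =>
    refine ⟨fun r hr => ?_, fun a ha => ?_⟩
    · simp only [Program.regs, List.mem_append, not_or] at hr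
      rw [ih₂.reg r hr.2, ih₁.reg r hr.1]
    · simp only [Program.arrays, List.mem_append, not_or] at ha
      rw [ih₂.mem a ha.2, ih₁.mem a ha.1]
  | ite_true _ _ ih =>
    refine ⟨fun r hr => ?_, fun a ha => ?_⟩
    · simp only [Program.regs, List.mem_append, not_or] at hr
      rw [ih.reg r hr.1]
    · simp only [Program.arrays, List.mem_append, not_or] at ha
      rw [ih.mem a ha.1]
  | ite_false _ _ ih =>
    refine ⟨fun r hr => ?_, fun a ha => ?_⟩
    · simp only [Program.regs, List.mem_append, not_or] at hr
      rw [ih.reg r hr.2]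
    · simp only [Program.arrays, List.mem_append, not_or] at ha
      rw [ih.mem a ha.2]
  | while_true _ _ _ ih₁ ih₂ =>
    exact ⟨fun r hr => (ih₂.reg r hr).trans (ih₁.reg r hr),
      fun a ha => (ih₂.mem a ha).trans (ih₁.mem a ha)⟩
  | while_false => exact Frame.refl _ _
  | _ =>
    refine ⟨fun r hr => ?_, fun a _ => rfl⟩
    simp only [Program.regs, List.mem_singleton] at hr
    simp [State.setReg, Function.update_of_ne hr]

namespace Meets

variable {B t t' : ℕ} {c d : Program} {σ : State} {Q Q' : State → Prop}

theorem mono (h : Meets B c σ t Q) (ht : t ≤ t') (hQ : ∀ τ, Q τ → Q' τ) : Meets B c σ t' Q' := by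
  obtain ⟨T, τ, h₁, h₂, h₃⟩ := h
  exact ⟨T, τ, h₁, h₂.trans ht, hQ τ h₃⟩

theorem frame (h : Meets B c σ t Q) : Meets B c σ t fun τ => Q τ ∧ Frame c σ τ := by
  obtain ⟨T, τ, h₁, h₂, h₃⟩ := h
  exact ⟨T, τ, h₁, h₂, h₃, h₁.frame⟩

theorem seq (h : Meets B c σ t fun τ => Meets B d τ t' Q) : Meets B (.seq c d) σ (t + t') Q := by
  obtain ⟨T, τ, h₁, h₂, T', ρ, h₃, h₄, h₅⟩ := h
  exact ⟨T + T', ρ, .seq h₁ h₃, by omega, h₅⟩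

theorem ite {b : Test} (h : b.Holds σ → Meets B c σ t Q) (h' : ¬ b.Holds σ → Meets B d σ t Q) :
    Meets B (.ite b c d) σ (1 + t) Q := by
  by_cases hb : b.Holds σ
  · obtain ⟨T, τ, h₁, h₂, h₃⟩ := h hb
    exact ⟨1 + T, τ, .ite_true hb h₁, by omega, h₃⟩
  · obtain ⟨T, τ, h₁, h₂, h₃⟩ := h' hb
    exact ⟨1 + T, τ, .ite_false hb h₁, by omega, h₃⟩

/-- A loop whose body takes at most `t` steps and decreases the measure `μ`. -/
theorem loop {b : Test} (I : State → Prop) (μ : State → ℕ)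
    (hbody : ∀ ρ, Frame c σ ρ → I ρ → b.Holds ρ →
      Meets B c ρ t fun τ => I τ ∧ μ τ < μ ρ)
    (hI : I σ) : Meets B (.while b c) σ ((t + 1) * μ σ + 1) fun τ => I τ ∧ ¬ b.Holds τ := by
  -- The induction is on a bound `k` for the measure, which may drop by more than one. The frame
  -- relative to the initial state spares invariants everything that the body does not write.
  suffices H : ∀ k ρ, Frame c σ ρ → I ρ → μ ρ ≤ k →
      Meets B (.while b c) ρ ((t + 1) * k + 1) fun τ => I τ ∧ ¬ b.Holds τ from
    H _ σ (Frame.refl _ _) hI le_rfl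
  intro k
  induction k with
  | zero =>
    intro ρ hf hρ hk
    by_cases hb : b.Holds ρ
    · obtain ⟨_, τ, _, _, _, h⟩ := hbody ρ hf hρ hb
      omega
    · exact ⟨1, ρ, .while_false hb, by omega, hρ, hb⟩
  | succ k ih =>
    intro ρ hf hρ hk
    by_cases hb : b.Holds ρ
    · obtain ⟨T, τ, h₁, h₂, h₃, h₄⟩ := hbody ρ hf hρ hb
      obtain ⟨T', τ', h₅, h₆, h₇⟩ := ih τ (hf.trans h₁.frame) h₃ (by omega)
      exact ⟨1 + T + T', τ', .while_true hb h₁ h₅, by rw [mul_add]; omega, h₇⟩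
    · exact ⟨1, ρ, .while_false hb, by omega, hρ, hb⟩

end Meets

/-- The weakest precondition of a program without loops. -/
def Program.pre (B : ℕ) : Program → (State → Prop) → State → Prop
  | .skip, Q, σ => Q σ
  | .const r c, Q, σ => c < B ∧ Q (σ.setReg r c)
  | .copy r p, Q, σ => Q (σ.setReg r (σ.reg p))
  | .add r p q, Q, σ => σ.reg p + σ.reg q < B ∧ Q (σ.setReg r (σ.reg p + σ.reg q))
  | .sub r p q, Q, σ => Q (σ.setReg r (σ.reg p - σ.reg q))
  | .load r a p, Q, σ => Q (σ.setReg r (σ.mem a (σ.reg p)))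
  | .store a p q, Q, σ => Q (σ.setMem a (σ.reg p) (σ.reg q))
  | .seq c d, Q, σ => c.pre B (d.pre B Q) σ
  | .ite b c d, Q, σ => (b.Holds σ → c.pre B Q σ) ∧ (¬ b.Holds σ → d.pre B Q σ)
  | .while _ _, _, _ => False

/-- The number of steps of a program without loops. -/
def Program.cost : Program → ℕ
  | .seq c d => c.cost + d.cost
  | .ite _ c d => 1 + (c.cost + d.cost)
  | _ => 1

/-- Unfolding `pre` by `simp` executes a loop-free program symbolically. As `cost` adds up both
branches of a conditional, it is only an upper bound. -/
theorem Meets.of_pre {B : ℕ} {c : Program} {σ : State} {Q : State → Prop} (h : c.pre B Q σ) :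
    Meets B c σ c.cost Q := by
  induction c generalizing σ Q with
  | skip => exact ⟨1, _, .skip σ, le_rfl, h⟩
  | const r c => exact ⟨1, _, .const σ r c h.1, le_rfl, h.2⟩
  | copy r p => exact ⟨1, _, .copy σ r p, le_rfl, h⟩
  | add r p q => exact ⟨1, _, .add σ r p q h.1, le_rfl, h.2⟩
  | sub r p q => exact ⟨1, _, .sub σ r p q, le_rfl, h⟩
  | load r a p => exact ⟨1, _, .load σ r a p, le_rfl, h⟩
  | store a p q => exact ⟨1, _, .store σ a p q, le_rfl, h⟩
  | seq c d ihc ihd => exact Meets.seq ((ihc h).mono le_rfl fun τ hτ => ihd hτ)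
  | ite b c d ihc ihd =>
    exact Meets.ite (fun hb => (ihc (h.1 hb)).mono (Nat.le_add_right _ _) fun _ => id)
      (fun hb => (ihd (h.2 hb)).mono (Nat.le_add_left _ _) fun _ => id)
  | _ => exact h.elim

theorem State.setReg_reg (σ : State) (r x p : ℕ) :
    (σ.setReg r x).reg p = if p = r then x else σ.reg p := by
  simp [State.setReg, Function.update_apply]

theorem State.setReg_mem (σ : State) (r x : ℕ) : (σ.setReg r x).mem = σ.mem := rfl

theorem State.setMem_reg (σ : State) (a i x : ℕ) : (σ.setMem a i x).reg = σ.reg := rfl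

theorem State.setMem_mem (σ : State) (a i x b : ℕ) :
    (σ.setMem a i x).mem b = if b = a then Function.update (σ.mem a) i x else σ.mem b := by
  simp only [State.setMem, Function.update_apply]

/-! ### Darts, reachability and boundaries -/

/-- An edge with a direction: `(e, false)` runs from `fst e` to `snd e`, and `(e, true)` back. -/
abbrev Dart (m : ℕ) := Fin m × Bool

def rev {m : ℕ} (d : Dart m) : Dart m := (d.1, !d.2)

namespace Multigraph

section

open scoped Classical

variable {n m k : ℕ} (G : Multigraph n m)

def tail (d : Dart m) : Fin n := if d.2 then G.snd d.1 else G.fst d.1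

def head (d : Dart m) : Fin n := if d.2 then G.fst d.1 else G.snd d.1

@[simp] theorem tail_rev (d : Dart m) : G.tail (rev d) = G.head d := by
  rcases d with ⟨e, _ | _⟩ <;> rfl

@[simp] theorem head_rev (d : Dart m) : G.head (rev d) = G.tail d := by
  rcases d with ⟨e, _ | _⟩ <;> rfl

theorem joins_dart (d : Dart m) : G.Joins d.1 (G.head d) (G.tail d) := by
  rcases d with ⟨e, _ | _⟩
  · exact Or.inr ⟨rfl, rfl⟩
  · exact Or.inl ⟨rfl, rfl⟩

/-- `v` can be reached from `u` along darts in `S`. -/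
def Reach (S : Set (Dart m)) (u v : Fin n) : Prop :=
  Relation.ReflTransGen (fun a b => ∃ d ∈ S, G.tail d = a ∧ G.head d = b) u v

/-- The darts of the edges in `F`. -/
def along (F : Finset (Fin m)) : Set (Dart m) := {d | d.1 ∈ F}

variable {G}

theorem Reach.closed {S : Set (Dart m)} {u v : Fin n} (h : G.Reach S u v) {K : Set (Fin n)}
    (hK : ∀ d ∈ S, G.tail d ∈ K → G.head d ∈ K) (hu : u ∈ K) : v ∈ K := by
  induction h with
  | refl => exact hu
  | tail _ hd ih =>
    obtain ⟨d, hd, rfl, rfl⟩ := hd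
    exact hK d hd ih

theorem Reach.exists_crossing {S : Set (Dart m)} {u v : Fin n} (h : G.Reach S u v)
    {K : Set (Fin n)} (hu : u ∈ K) (hv : v ∉ K) : ∃ d ∈ S, G.tail d ∈ K ∧ G.head d ∉ K := by
  by_contra! hK
  exact hv (h.closed hK hu)

theorem Reach.step {S : Set (Dart m)} {u : Fin n} {d : Dart m} (h : G.Reach S u (G.tail d))
    (hd : d ∈ S) : G.Reach S u (G.head d) :=
  Relation.ReflTransGen.tail h ⟨d, hd, rfl, rfl⟩

theorem Reach.mono {S S' : Set (Dart m)} {u v : Fin n} (h : G.Reach S u v) (hS : S ⊆ S') :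
    G.Reach S' u v :=
  Relation.ReflTransGen.mono (fun _ _ ⟨d, hd, h⟩ => ⟨d, hS hd, h⟩) _ _ h

theorem Reach.symm {S : Set (Dart m)} (hS : ∀ d ∈ S, rev d ∈ S) {u v : Fin n}
    (h : G.Reach S u v) : G.Reach S v u := by
  induction h with
  | refl => exact .refl
  | tail _ hd ih =>
    obtain ⟨d, hd, rfl, rfl⟩ := hd
    exact Relation.ReflTransGen.head ⟨rev d, hS d hd, by simp, by simp⟩ ih

theorem Reach.symm_along {F : Finset (Fin m)} {u v : Fin n} (h : G.Reach (along F) u v) :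
    G.Reach (along F) v u :=
  h.symm fun _ hd => hd

/-! ### Boundaries of chains, and parity of degrees -/

variable (G)

/-- The boundary of a chain of edges. -/
noncomputable def bd {R : Type*} [CommRing R] (c : Fin m → R) (v : Fin n) : R :=
  ∑ e, c e * ((if G.fst e = v then 1 else 0) - (if G.snd e = v then 1 else 0))

/-- The indicator chain of a set of edges. -/
noncomputable def ind (F : Finset (Fin m)) (e : Fin m) : ZMod 2 := if e ∈ F then 1 else 0

/-- The indicator function of a node. -/
noncomputable def pt {R : Type*} [CommRing R] (u v : Fin n) : R := if u = v then 1 else 0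

/-- The two ends of an edge inside `K` cancel, so only edges across the border of `K` count. Over
`ZMod 2` this drives the parity arguments, over `ℤ` the flow argument. -/
theorem sum_bd {R : Type*} [CommRing R] (c : Fin m → R) (K : Set (Fin n)) :
    ∑ v with v ∈ K, G.bd c v =
      ∑ e, c e * ((if G.fst e ∈ K then 1 else 0) - (if G.snd e ∈ K then 1 else 0)) := by
  unfold bd
  rw [Finset.sum_comm]
  refine Finset.sum_congr rfl fun e _ => ?_
  rw [← Finset.mul_sum, Finset.sum_sub_distrib, Finset.sum_ite_eq, Finset.sum_ite_eq]
  simp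

theorem sum_bd_eq_zero {R : Type*} [CommRing R] {c : Fin m → R} {K : Set (Fin n)}
    (h : ∀ e, c e ≠ 0 → (G.fst e ∈ K ↔ G.snd e ∈ K)) : ∑ v with v ∈ K, G.bd c v = 0 := by
  rw [sum_bd]
  refine Finset.sum_eq_zero fun e _ => ?_
  by_cases hc : c e = 0
  · simp [hc]
  · simp [h e hc]

theorem sum_pt {R : Type*} [CommRing R] (u : Fin n) (K : Set (Fin n)) :
    ∑ v with v ∈ K, (pt u v : R) = if u ∈ K then 1 else 0 := by
  unfold pt
  rw [Finset.sum_ite_eq]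
  simp

variable {G}

theorem iff_of_closed {F : Finset (Fin m)} {K : Set (Fin n)}
    (hK : ∀ d ∈ along F, G.tail d ∈ K → G.head d ∈ K) {e : Fin m} (he : e ∈ F) :
    G.fst e ∈ K ↔ G.snd e ∈ K :=
  ⟨hK (e, false) he, hK (e, true) he⟩

/-- Two nodes that are the only ones of odd degree are connected. -/
theorem reach_of_bd {F : Finset (Fin m)} {u v : Fin n}
    (h : ∀ w, G.bd (ind F) w = pt u w + pt v w) : G.Reach (along F) u v := by
  -- No edge of `F` leaves the set reached from `u`, so its total boundary is zero; if it contained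
  -- `u` but not `v`, the total would be one.
  have h0 : ∑ w with w ∈ {w | G.Reach (along F) u w}, G.bd (ind F) w = 0 := by
    refine G.sum_bd_eq_zero fun e he => iff_of_closed (F := F) (fun d hd h => Reach.step h hd) ?_
    by_contra hF
    simp [ind, hF] at he
  rw [Finset.sum_congr rfl fun w _ => h w, Finset.sum_add_distrib, sum_pt, sum_pt] at h0
  by_contra hv
  have hu : G.Reach (along F) u u := Relation.ReflTransGen.refl
  simp [hv, hu] at h0

theorem bd_add {R : Type*} [CommRing R] (c c' : Fin m → R) (v : Fin n) :
    G.bd (fun e => c e + c' e) v = G.bd c v + G.bd c' v := by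
  simp [bd, add_mul, Finset.sum_add_distrib]

/-! ### Paths traced back to their root -/

variable (G)

/-- The darts `l` form a walk from the root `r` to `v`, listed from `v` backwards. -/
def BackPath (r : Fin n) : Fin n → List (Dart m) → Prop
  | v, [] => v = r
  | v, d :: l => G.head d = v ∧ BackPath r (G.tail d) l

/-- A walk from `r` to `v`, listed backwards, without repeated nodes. -/
def SimplePath (r v : Fin n) (l : List (Dart m)) : Prop :=
  G.BackPath r v l ∧ (v :: l.map G.tail).Nodup

/-- The edges of a list of darts. -/
def edges (l : List (Dart m)) : Finset (Fin m) := (l.map Prod.fst).toFinset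

theorem mem_edges {l : List (Dart m)} {e : Fin m} : e ∈ edges l ↔ ∃ d ∈ l, d.1 = e := by
  simp [edges]

theorem fst_mem_edges {l : List (Dart m)} {d : Dart m} (h : d ∈ l) : d.1 ∈ edges l :=
  mem_edges.2 ⟨d, h, rfl⟩

variable {G}

theorem BackPath.reach {r v : Fin n} {l : List (Dart m)} (h : G.BackPath r v l)
    {S : Set (Dart m)} (hS : ∀ d ∈ l, d ∈ S) : G.Reach S r v := by
  induction l generalizing v with
  | nil => cases h; exact .refl
  | cons d l ih =>
    obtain ⟨rfl, h⟩ := h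
    exact (ih h fun d hd => hS d (by simp [hd])).step (hS d (by simp))

theorem BackPath.mem_nodes {r v : Fin n} {l : List (Dart m)} (h : G.BackPath r v l) {d : Dart m}
    (hd : d ∈ l) : G.head d ∈ v :: l.map G.tail ∧ G.tail d ∈ v :: l.map G.tail := by
  induction l generalizing v with
  | nil => simp at hd
  | cons d' l ih =>
    obtain ⟨rfl, h⟩ := h
    rcases List.mem_cons.1 hd with rfl | hd
    · simp
    · have := ih h hd
      simp only [List.map_cons, List.mem_cons] at this ⊢
      tauto

/-- If a later dart had the same edge as `d`, the head of `d` would be visited again. -/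
theorem SimplePath.nodup_edges {r v : Fin n} {l : List (Dart m)} (h : G.SimplePath r v l) :
    (l.map Prod.fst).Nodup := by
  obtain ⟨h, h'⟩ := h
  induction l generalizing v with
  | nil => simp
  | cons d l ih =>
    obtain ⟨rfl, h⟩ := h
    rw [List.map_cons, List.nodup_cons] at h'
    rw [List.map_cons, List.nodup_cons]
    refine ⟨fun hd => h'.1 ?_, ih h h'.2⟩
    obtain ⟨d', hd', he⟩ := List.mem_map.1 hd
    have := h.mem_nodes hd'
    rcases d with ⟨e, b⟩
    rcases d' with ⟨e', b'⟩
    obtain rfl : e' = e := he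
    cases b <;> cases b' <;> simp_all [head, tail]

theorem SimplePath.length_le {r v : Fin n} {l : List (Dart m)} (h : G.SimplePath r v l) :
    l.length + 1 ≤ n := by
  have := h.2.length_le_card
  simpa using this

theorem BackPath.isWalk {r v : Fin n} {l : List (Dart m)} (h : G.BackPath r v l) :
    G.IsWalk (v :: l.map G.tail) (l.map Prod.fst) ∧
      (v :: l.map G.tail).getLast? = some r := by
  induction l generalizing v with
  | nil => cases h; exact ⟨.single _, rfl⟩
  | cons d l ih =>
    obtain ⟨rfl, h⟩ := h
    exact ⟨.cons (G.joins_dart d) (ih h).1, (ih h).2⟩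

theorem SimplePath.isPath {r v : Fin n} {l : List (Dart m)} (h : G.SimplePath r v l) :
    G.IsPath v r (l.map Prod.fst) :=
  ⟨_, h.1.isWalk.1, rfl, h.1.isWalk.2, h.2⟩

/-- The number of darts that leave `K` minus the number of those that enter `K`. -/
theorem BackPath.sum_crossing {r v : Fin n} {l : List (Dart m)} (h : G.BackPath r v l)
    (K : Set (Fin n)) :
    (l.map fun d => (if G.tail d ∈ K then 1 else 0) - (if G.head d ∈ K then 1 else 0 : ℤ)).sum =
      (if r ∈ K then 1 else 0) - (if v ∈ K then 1 else 0) := by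
  induction l generalizing v with
  | nil => cases h; simp
  | cons d l ih =>
    obtain ⟨rfl, h⟩ := h
    rw [List.map_cons, List.sum_cons, ih h]
    ring

/-- The signed chain of a list of darts. -/
def chain {R : Type*} [CommRing R] (l : List (Dart m)) (e : Fin m) : R :=
  (l.map fun d => if d.1 = e then (if d.2 then -1 else 1) else 0).sum

/-- The boundaries of the single darts telescope. -/
theorem BackPath.bd_chain {R : Type*} [CommRing R] {r v : Fin n} {l : List (Dart m)}
    (h : G.BackPath r v l) (w : Fin n) : G.bd (chain l : Fin m → R) w = pt r w - pt v w := by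
  induction l generalizing v with
  | nil => cases h; simp [bd, chain]
  | cons d l ih =>
    obtain ⟨rfl, h⟩ := h
    have : (chain (d :: l) : Fin m → R) =
        fun e => (if d.1 = e then (if d.2 then -1 else 1) else 0) + chain l e := by
      funext e; simp [chain]
    rw [this, bd_add, ih h]
    have : G.bd (fun e => if d.1 = e then (if d.2 then -1 else 1 : R) else 0) w =
        pt (G.tail d) w - pt (G.head d) w := by
      unfold bd
      rw [Finset.sum_eq_single d.1]
      · rcases d with ⟨e, _ | _⟩ <;> simp [tail, head, pt]
      · intro e _ he
        simp [he.symm]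
      · simp
    rw [this]
    ring

theorem chain_of_notMem {R : Type*} [CommRing R] {l : List (Dart m)} {e : Fin m}
    (h : e ∉ edges l) : (chain l e : R) = 0 := by
  refine List.sum_eq_zero fun x hx => ?_
  obtain ⟨d, hd, rfl⟩ := List.mem_map.1 hx
  rw [if_neg]
  rintro rfl
  exact h (fst_mem_edges hd)

theorem chain_of_mem {R : Type*} [CommRing R] {l : List (Dart m)} (hl : (l.map Prod.fst).Nodup)
    {d : Dart m} (h : d ∈ l) : (chain l d.1 : R) = if d.2 then -1 else 1 := by
  induction l with
  | nil => simp at h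
  | cons d' l ih =>
    rw [List.map_cons, List.nodup_cons] at hl
    have hcons : (chain (d' :: l) d.1 : R) =
        (if d'.1 = d.1 then (if d'.2 then -1 else 1) else 0) + chain l d.1 := by
      simp [chain]
    rw [hcons]
    rcases List.mem_cons.1 h with rfl | h
    · rw [if_pos rfl, chain_of_notMem, add_zero]
      simpa [edges] using hl.1
    · rw [if_neg, ih hl.2 h, zero_add]
      intro he
      exact hl.1 (he ▸ List.mem_map_of_mem h)

/-- Signs disappear modulo 2; the edges must be distinct because an edge used twice would cancel. -/
theorem chain_eq_ind {l : List (Dart m)} (hl : (l.map Prod.fst).Nodup) (e : Fin m) :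
    (chain l e : ZMod 2) = ind (edges l) e := by
  by_cases he : e ∈ edges l
  · obtain ⟨d, hd, rfl⟩ := mem_edges.1 he
    rw [chain_of_mem hl hd, ind, if_pos he]
    rcases d.2 <;> decide
  · rw [chain_of_notMem he, ind, if_neg he]

theorem SimplePath.bd_ind {r v : Fin n} {l : List (Dart m)} (h : G.SimplePath r v l) (w : Fin n) :
    G.bd (ind (edges l)) w = pt r w + pt v w := by
  have := h.1.bd_chain (R := ZMod 2) w
  rw [funext (chain_eq_ind h.nodup_edges), CharTwo.sub_eq_add] at this
  exact this

theorem bd_ind_sdiff {F F' : Finset (Fin m)} (h : F' ⊆ F) (w : Fin n) :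
    G.bd (ind (F \ F')) w = G.bd (ind F) w + G.bd (ind F') w := by
  rw [← bd_add]
  congr 1
  funext e
  unfold ind
  by_cases h1 : e ∈ F <;> by_cases h2 : e ∈ F'
  · simp [h1, h2, CharTwo.add_self_eq_zero]
  · simp [h1, h2]
  · exact absurd (h h2) h1
  · simp [h1, h2]

/-! ### Consequences of the Eulerian condition and of feasibility -/

/-- Since the degree in `G + H` is even, the degrees in `G` and in `H` have the same parity. -/
theorem Eulerian.bd_univ {H : Multigraph n k} (h : G.Eulerian H) (w : Fin n) :
    G.bd (ind Finset.univ) w = ∑ i, (pt (H.fst i) w + pt (H.snd i) w) := by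
  have hd : ((((G.sum H).degree w : ℕ) : ZMod 2)) = 0 := by
    rw [ZMod.natCast_eq_zero_iff_even]; exact h w
  have he : (((G.sum H).degree w : ℕ) : ZMod 2) =
      ∑ e, (pt (G.fst e) w + pt (G.snd e) w) + ∑ i, (pt (H.fst i) w + pt (H.snd i) w) := by
    rw [degree, Nat.cast_add, Finset.natCast_card_filter, Finset.natCast_card_filter]
    simp only [Multigraph.sum, Fin.sum_univ_add, Fin.append_left, Fin.append_right, Finset.sum_add_distrib, pt]
    ring
  rw [he] at hd
  have hb : G.bd (ind Finset.univ) w = ∑ e, (pt (G.fst e) w + pt (G.snd e) w) := by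
    simp [bd, ind, pt, CharTwo.sub_eq_add]
  rw [hb]
  exact CharTwo.add_eq_zero.1 hd

/-- The walk may enter `K` instead of leaving it; the reverse of its dart is then taken. -/
theorem IsWalk.exists_crossing {vs : List (Fin n)} {es : List (Fin m)} (h : G.IsWalk vs es)
    {u v : Fin n} (hu : vs.head? = some u) (hv : vs.getLast? = some v) {K : Set (Fin n)}
    (hK : ¬ (u ∈ K ↔ v ∈ K)) : ∃ d : Dart m, d.1 ∈ es ∧ G.tail d ∈ K ∧ G.head d ∉ K := by
  induction h generalizing u with
  | single w =>
    simp only [List.head?_cons, List.getLast?_singleton, Option.some.injEq] at hu hv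
    subst hu hv
    exact absurd Iff.rfl hK
  | @cons e a b vs es hj hw ih =>
    simp only [List.head?_cons, Option.some.injEq] at hu
    subst hu
    by_cases hab : a ∈ K ↔ b ∈ K
    · obtain ⟨d, hd, h⟩ := ih rfl (by simpa using hv) (by rwa [← hab])
      exact ⟨d, List.mem_cons_of_mem _ hd, h⟩
    · obtain ⟨x, hx⟩ : ∃ x : Bool, G.tail (e, x) = a ∧ G.head (e, x) = b := by
        rcases hj with ⟨rfl, rfl⟩ | ⟨rfl, rfl⟩
        · exact ⟨false, rfl, rfl⟩
        · exact ⟨true, rfl, rfl⟩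
      by_cases ha : a ∈ K
      · exact ⟨(e, x), by simp, by rw [hx.1]; exact ha, by rw [hx.2]; tauto⟩
      · refine ⟨rev (e, x), by simp [rev], ?_, ?_⟩
        · rw [tail_rev, hx.2]; tauto
        · rw [head_rev, hx.1]; exact ha

theorem Feasible.reach {H : Multigraph n k} (h : G.Feasible H) (i : Fin k) :
    G.Reach Set.univ (H.fst i) (H.snd i) := by
  obtain ⟨P, hP, -⟩ := h
  obtain ⟨vs, hw, hu, hv, -⟩ := hP i
  by_contra hr
  obtain ⟨d, -, h₁, h₂⟩ := hw.exists_crossing hu hv (K := {w | G.Reach Set.univ (H.fst i) w})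
    (fun h => hr (h.1 .refl))
  exact h₂ (Reach.step h₁ trivial)

/-- Two pairs cannot both have to use one and the same edge. -/
theorem Feasible.not_single_crossing {H : Multigraph n k} (h : G.Feasible H) {i j : Fin k}
    (hij : i ≠ j) {K : Set (Fin n)} (hi : ¬ (H.fst i ∈ K ↔ H.snd i ∈ K))
    (hj : ¬ (H.fst j ∈ K ↔ H.snd j ∈ K)) (f : Fin m)
    (hf : ∀ d, G.tail d ∈ K → G.head d ∉ K → d.1 = f) : False := by
  obtain ⟨P, hP, hdisj⟩ := h
  obtain ⟨vs, hw, hu, hv, -⟩ := hP i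
  obtain ⟨vs', hw', hu', hv', -⟩ := hP j
  obtain ⟨d, hd, h₁, h₂⟩ := hw.exists_crossing hu hv hi
  obtain ⟨d', hd', h₁', h₂'⟩ := hw'.exists_crossing hu' hv' hj
  rw [hf d h₁ h₂] at hd
  rw [hf d' h₁' h₂'] at hd'
  exact hdisj i j hij hd hd'

end

end Multigraph

namespace Multigraph

/-! ### Rerouting the third path -/

section

open scoped Classical

variable {n m : ℕ} {G : Multigraph n m} {H : Multigraph n 3}

/-- The walk `l ++ l'` is a path for the third pair whose removal leaves the other two pairs
disconnected: `A` and `B` are the two components that hold their ends, and `j` is the first node of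
the path in `B`, preceded by a node in `A`. -/
structure Blocked (G : Multigraph n m) (H : Multigraph n 3) (A B : Set (Fin n))
    (y₁ y₂ z₁ z₂ j : Fin n) (l l' : List (Dart m)) : Prop where
  path : G.SimplePath (H.snd 2) (H.fst 2) (l ++ l')
  front : G.BackPath j (H.fst 2) l
  back : G.BackPath (H.snd 2) j l'
  closedA : ∀ d : Dart m, d.1 ∉ edges (l ++ l') → G.tail d ∈ A → G.head d ∈ A
  closedB : ∀ d : Dart m, d.1 ∉ edges (l ++ l') → G.tail d ∈ B → G.head d ∈ B
  disj : ∀ v ∈ A, v ∉ B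
  connA : ∀ v ∈ A, G.Reach (along (edges (l ++ l'))ᶜ) y₁ v
  connB : ∀ v ∈ B, G.Reach (along (edges (l ++ l'))ᶜ) z₁ v
  y₁A : y₁ ∈ A
  y₂A : y₂ ∈ A
  z₁B : z₁ ∈ B
  z₂B : z₂ ∈ B
  jB : j ∈ B
  pair₁ : (y₁ = H.fst 1 ∧ z₁ = H.snd 1) ∨ (y₁ = H.snd 1 ∧ z₁ = H.fst 1)
  pair₂ : (y₂ = H.fst 0 ∧ z₂ = H.snd 0) ∨ (y₂ = H.snd 0 ∧ z₂ = H.fst 0)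
  touchA : ∃ d ∈ l, G.head d ∈ A
  frontB : ∀ d ∈ l, G.head d ∉ B

/-- The edges of the path `p`, and all edges that do not lie in the component `B` of the rest. -/
noncomputable def outside (G : Multigraph n m) (B : Set (Fin n)) (p : List (Dart m)) :
    Finset (Fin m) :=
  Finset.univ.filter fun e => e ∈ edges p ∨ G.fst e ∉ B

theorem pt_of_ne {R : Type*} [CommRing R] {u v : Fin n} (h : u ≠ v) : (pt u v : R) = 0 := if_neg h

/-- The net number of crossings telescopes, and here no crossing counts negatively. -/
theorem BackPath.countP_crossing {r v : Fin n} {p : List (Dart m)} (h : G.BackPath r v p)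
    {K : Set (Fin n)} (hin : ∀ d ∈ p, G.head d ∈ K → G.tail d ∈ K) :
    (p.countP (fun d => G.tail d ∈ K ∧ G.head d ∉ K) : ℤ) =
      (if r ∈ K then 1 else 0) - (if v ∈ K then 1 else 0) := by
  rw [← h.sum_crossing K]
  clear h
  induction p with
  | nil => simp
  | cons d p ih =>
    rw [List.countP_cons, List.map_cons, List.sum_cons, ← ih fun d hd => hin d (by simp [hd])]
    have := hin d (by simp)
    by_cases h₁ : G.head d ∈ K
    · simp [h₁, this h₁]
    · by_cases h₂ : G.tail d ∈ K
      · simp [h₁, h₂, add_comm]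
      · simp [h₁, h₂]

theorem BackPath.tail_eq {r v : Fin n} {p : List (Dart m)} (h : G.BackPath r v p) {d : Dart m}
    (hd : d ∈ p) : G.tail d = r ∨ ∃ d' ∈ p, G.head d' = G.tail d := by
  induction p generalizing v with
  | nil => simp at hd
  | cons d₀ p ih =>
    obtain ⟨rfl, h⟩ := h
    rcases List.mem_cons.1 hd with rfl | hd
    · cases p with
      | nil => exact Or.inl h
      | cons d₁ p => exact Or.inr ⟨d₁, by simp, h.1⟩
    · rcases ih h hd with h₁ | ⟨d', hd', h₁⟩
      · exact Or.inl h₁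
      · exact Or.inr ⟨d', by simp [hd'], h₁⟩

theorem BackPath.forall_mem {r v : Fin n} {p : List (Dart m)} (h : G.BackPath r v p)
    {K : Set (Fin n)} (hv : v ∈ K) (hK : ∀ d ∈ p, G.head d ∈ K → G.tail d ∈ K) :
    ∀ d ∈ p, G.head d ∈ K ∧ G.tail d ∈ K := by
  induction p generalizing v with
  | nil => simp
  | cons d p ih =>
    obtain ⟨rfl, h⟩ := h
    have := hK d (by simp) hv
    intro d' hd'
    rcases List.mem_cons.1 hd' with rfl | hd'
    · exact ⟨hv, this⟩
    · exact ih h this (fun d hd => hK d (by simp [hd])) d' hd'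

namespace Blocked

variable {A B : Set (Fin n)} {y₁ y₂ z₁ z₂ j : Fin n} {l l' : List (Dart m)}

/-- The definition of `outside` tests `fst` only. Since `B` is closed under the edges off the path,
such an edge has both ends in `B` or neither, so either end may be tested. -/
theorem mem_outside (h : Blocked G H A B y₁ y₂ z₁ z₂ j l l') (d : Dart m) :
    d.1 ∈ G.outside B (l ++ l') ↔ d.1 ∈ edges (l ++ l') ∨ G.tail d ∉ B := by
  rcases d with ⟨e, _ | _⟩
  · simp [outside, tail]
  · by_cases he : e ∈ edges (l ++ l')
    · simp [outside, he]
    · have h₁ := h.closedB (e, true) he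
      have h₂ := h.closedB (e, false) he
      simp only [tail, head, if_true, Bool.false_eq_true, if_false] at h₁ h₂
      simp only [outside, Finset.mem_filter, Finset.mem_univ, he, true_and, false_or, tail,
        if_true]
      tauto

/-- At a node of `B` only the edges of the path are left. At any other node no edge is missing, so
the Eulerian condition applies, and the terms of `z₁` and `z₂` vanish. -/
theorem bd_outside (h : Blocked G H A B y₁ y₂ z₁ z₂ j l l') (hE : G.Eulerian H) (w : Fin n) :
    G.bd (ind (G.outside B (l ++ l'))) w =
      pt (H.snd 2) w + pt (H.fst 2) w + (pt y₁ w + pt y₂ w) := by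
  by_cases hw : w ∈ B
  · have hy₁ : pt y₁ w = (0 : ZMod 2) := pt_of_ne fun e => h.disj _ h.y₁A (e ▸ hw)
    have hy₂ : pt y₂ w = (0 : ZMod 2) := pt_of_ne fun e => h.disj _ h.y₂A (e ▸ hw)
    rw [hy₁, hy₂, add_zero, add_zero, ← h.path.bd_ind]
    refine Finset.sum_congr rfl fun e _ => ?_
    by_cases he : e ∈ edges (l ++ l')
    · have : e ∈ G.outside B (l ++ l') := by simp [outside, he]
      simp [ind, he, this]
    · have hf := h.mem_outside (e, false)
      have ht := h.mem_outside (e, true)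
      simp only [he, false_or, tail, if_true, Bool.false_eq_true, if_false] at hf ht
      by_cases ho : e ∈ G.outside B (l ++ l')
      · have h₁ : G.fst e ≠ w := fun e' => (hf.1 ho) (e' ▸ hw)
        have h₂ : G.snd e ≠ w := fun e' => (ht.1 ho) (e' ▸ hw)
        simp [h₁, h₂]
      · simp [ind, he, ho]
  · have hz₁ : pt z₁ w = (0 : ZMod 2) := pt_of_ne fun e => hw (e ▸ h.z₁B)
    have hz₂ : pt z₂ w = (0 : ZMod 2) := pt_of_ne fun e => hw (e ▸ h.z₂B)
    have hu : G.bd (ind (G.outside B (l ++ l'))) w = G.bd (ind Finset.univ) w := by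
      refine Finset.sum_congr rfl fun e _ => ?_
      have hf := h.mem_outside (e, false)
      have ht := h.mem_outside (e, true)
      simp only [tail, if_true, Bool.false_eq_true, if_false] at hf ht
      by_cases ho : e ∈ G.outside B (l ++ l')
      · simp [ind, ho]
      · have h₁ : G.fst e ≠ w := fun e' => by
          rw [hf, e'] at ho; tauto
        have h₂ : G.snd e ≠ w := fun e' => by
          rw [ht, e'] at ho; tauto
        simp [h₁, h₂]
    rw [hu, hE.bd_univ, Fin.sum_univ_three]
    have h₁ : pt (H.fst 1) w + pt (H.snd 1) w = (pt y₁ w : ZMod 2) := by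
      rcases h.pair₁ with ⟨h₁, h₂⟩ | ⟨h₁, h₂⟩ <;> rw [← h₁, ← h₂, hz₁] <;> ring
    have h₂ : pt (H.fst 0) w + pt (H.snd 0) w = (pt y₂ w : ZMod 2) := by
      rcases h.pair₂ with ⟨h₁, h₂⟩ | ⟨h₁, h₂⟩ <;> rw [← h₁, ← h₂, hz₂] <;> ring
    rw [h₁, h₂]
    ring

theorem path_subset (h : Blocked G H A B y₁ y₂ z₁ z₂ j l l') {d : Dart m} (hd : d ∈ l ++ l') :
    d ∈ along (G.outside B (l ++ l')) :=
  (h.mem_outside d).2 (Or.inl (fst_mem_edges hd))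

theorem connA_outside (h : Blocked G H A B y₁ y₂ z₁ z₂ j l l') {v : Fin n} (hv : v ∈ A) :
    G.Reach (along (G.outside B (l ++ l'))) y₁ v := by
  have := (h.connA v hv).closed
    (K := {v | v ∈ A ∧ G.Reach (along (G.outside B (l ++ l'))) y₁ v}) ?_ ⟨h.y₁A, .refl⟩
  · exact this.2
  · rintro d hd ⟨h₁, h₂⟩
    have hd' : d.1 ∉ edges (l ++ l') := by simpa [along] using hd
    exact ⟨h.closedA d hd' h₁, h₂.step ((h.mem_outside d).2 (Or.inr (h.disj _ h₁)))⟩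

/-- The path has met `A` before `j`. The set `S` is arbitrary because two choices are needed: the
darts of `outside`, and those of `l` alone, which locates the cut edge in `reach_second`. -/
theorem exists_front (h : Blocked G H A B y₁ y₂ z₁ z₂ j l l') :
    ∃ v ∈ A, ∀ S : Set (Dart m), (∀ d ∈ l, d ∈ S) → G.Reach S j v := by
  obtain ⟨d, hd, hA⟩ := h.touchA
  obtain ⟨p, q, rfl⟩ := List.append_of_mem hd
  refine ⟨_, hA, fun S hS => ?_⟩
  have hfront := h.front
  clear h hd hA
  generalize H.fst 2 = s at hfront
  induction p generalizing s with
  | nil =>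
    obtain ⟨rfl, hq⟩ := hfront
    exact (hq.reach fun d hd => hS d (by simp [hd])).step (hS _ (by simp))
  | cons d' p ih => exact ih (fun d hd => hS d (by simp at hd ⊢; tauto)) _ hfront.2

/-- The first of two edge-disjoint paths from `j` to `y₁` and `y₂`. -/
theorem reach_first (h : Blocked G H A B y₁ y₂ z₁ z₂ j l l') :
    G.Reach (along (G.outside B (l ++ l'))) j y₁ := by
  obtain ⟨v, hv, hr⟩ := h.exists_front
  exact (hr _ fun d hd => h.path_subset (by simp [hd])).trans (h.connA_outside hv).symm_along

theorem pairs_separated (h : Blocked G H A B y₁ y₂ z₁ z₂ j l l') {K : Set (Fin n)}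
    (hy₁ : y₁ ∉ K) (hy₂ : y₂ ∉ K) (hz₁ : z₁ ∈ K) (hz₂ : z₂ ∈ K) :
    ¬ (H.fst 0 ∈ K ↔ H.snd 0 ∈ K) ∧ ¬ (H.fst 1 ∈ K ↔ H.snd 1 ∈ K) := by
  have h₁ := h.pair₁
  have h₂ := h.pair₂
  constructor
  · rcases h₂ with ⟨e, e'⟩ | ⟨e, e'⟩ <;> rw [← e, ← e'] <;> tauto
  · rcases h₁ with ⟨e, e'⟩ | ⟨e, e'⟩ <;> rw [← e, ← e'] <;> tauto

/-- The second of two edge-disjoint paths from `j` to `y₁` and `y₂` exists in the residual graph of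
the first. -/
theorem reach_second (h : Blocked G H A B y₁ y₂ z₁ z₂ j l l') (hE : G.Eulerian H)
    (hF : G.Feasible H) {p : List (Dart m)} (hp : G.SimplePath j y₁ p)
    (hpS : ∀ d ∈ p, d ∈ along (G.outside B (l ++ l'))) :
    G.Reach {d | d ∈ along (G.outside B (l ++ l')) ∧ d ∉ p} j y₂ := by
  by_contra hy₂
  set S := along (G.outside B (l ++ l')) with hS
  -- `K` is the near side of a cut in the residual graph: all darts of `S` that leave it are used by
  -- `p`.
  set K : Set (Fin n) := {v | G.Reach {d | d ∈ S ∧ d ∉ p} j v} with hK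
  have hjK : j ∈ K := Relation.ReflTransGen.refl
  have hout : ∀ d ∈ S, G.tail d ∈ K → G.head d ∉ K → d ∈ p := by
    intro d hd h₁ h₂
    by_contra hdp
    exact h₂ (Reach.step h₁ ⟨hd, hdp⟩)
  -- The reverse of a dart of `p` that enters `K` would leave `K` and hence lie on `p`, which would
  -- use one edge twice.
  have hin : ∀ d ∈ p, G.head d ∈ K → G.tail d ∈ K := by
    intro d hd h₁
    by_contra h₂
    have hr : rev d ∈ p := hout (rev d) (hpS d hd) (by simpa using h₁) (by simpa using h₂)
    have := List.inj_on_of_nodup_map hp.nodup_edges hr hd rfl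
    simp [rev, Prod.ext_iff] at this
  have hcount := hp.1.countP_crossing hin
  rw [if_pos hjK, List.countP_eq_length_filter] at hcount
  have hmem : ∀ d ∈ S, G.tail d ∈ K → G.head d ∉ K →
      d ∈ p.filter fun d => G.tail d ∈ K ∧ G.head d ∉ K := fun d hd h₁ h₂ =>
    List.mem_filter.2 ⟨hout d hd h₁ h₂, by simp [h₁, h₂]⟩
  -- If `y₁` is in `K`, then `p` never leaves `K`, so no dart of `S` does; but `y₁` and `y₂` are
  -- connected through `A`.
  by_cases hy₁ : y₁ ∈ K
  · rw [if_pos hy₁, sub_self, Nat.cast_eq_zero, List.length_eq_zero_iff] at hcount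
    obtain ⟨d, hd, h₁, h₂⟩ := (h.connA_outside h.y₂A).exists_crossing hy₁ hy₂
    have := hmem d hd h₁ h₂
    rw [hcount] at this
    simp at this
  -- Otherwise `p` leaves `K` exactly once, by a dart `f`, and no other dart of `S` leaves `K`.
  rw [if_neg hy₁, sub_zero, Nat.cast_eq_one, List.length_eq_one_iff] at hcount
  obtain ⟨f, hf⟩ := hcount
  simp only [hf, List.mem_singleton] at hmem
  have hf' : f ∈ p.filter fun d => G.tail d ∈ K ∧ G.head d ∉ K := by
    rw [hf]; exact List.mem_singleton_self f
  simp only [List.mem_filter, decide_eq_true_eq] at hf'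
  obtain ⟨hfp, hft, hfh⟩ := hf'
  -- The edge of `f` alone crosses the border of `K`, and `y₁`, `y₂` are not in `K`; so exactly one
  -- end of the third pair is.
  have hpar : ((if H.snd 2 ∈ K then 1 else 0) + (if H.fst 2 ∈ K then 1 else 0) : ZMod 2) = 1 := by
    have h₁ := G.sum_bd (ind (G.outside B (l ++ l'))) K
    simp only [h.bd_outside hE, Finset.sum_add_distrib, sum_pt, if_neg hy₁] at h₁
    rw [if_neg (show y₂ ∉ K from hy₂), add_zero, add_zero] at h₁
    rw [h₁, Finset.sum_eq_single f.1]
    · rw [ind, if_pos (show f.1 ∈ G.outside B (l ++ l') from hpS f hfp), one_mul]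
      rcases f with ⟨e, _ | _⟩
      · simp only [tail, head, Bool.false_eq_true, if_false] at hft hfh
        simp [hft, hfh]
      · simp only [tail, head, if_true] at hft hfh
        simp only [hft, hfh, if_true, if_false]
        decide
    · intro e _ he
      by_cases heo : e ∈ G.outside B (l ++ l')
      · have : G.fst e ∈ K ↔ G.snd e ∈ K := by
          constructor
          · intro h₁
            by_contra h₂
            exact he (congrArg Prod.fst (hmem (e, false) heo h₁ h₂))
          · intro h₁
            by_contra h₂
            exact he (congrArg Prod.fst (hmem (e, true) heo h₁ h₂))
        simp [this]
      · simp [ind, heo]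
    · simp
  have hedge : ∀ d : Dart m, d.1 ∈ edges (l ++ l') → d ∈ S := fun d hd =>
    (h.mem_outside d).2 (Or.inl hd)
  -- The path of the third pair therefore crosses the border of `K`, where there is only `f`.
  have hfedge : f.1 ∈ edges (l ++ l') := by
    have hr : G.Reach (along (edges (l ++ l'))) (H.snd 2) (H.fst 2) :=
      h.path.1.reach fun d hd => fst_mem_edges hd
    by_cases h₁ : H.snd 2 ∈ K
    · have h₂ : H.fst 2 ∉ K := by
        intro h₂
        rw [if_pos h₁, if_pos h₂] at hpar
        exact absurd hpar (by decide)
      obtain ⟨d, hd, ht, hh⟩ := hr.exists_crossing h₁ h₂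
      rw [← hmem d (hedge d hd) ht hh]
      exact hd
    · have h₂ : H.fst 2 ∈ K := by
        by_contra h₂
        rw [if_neg h₁, if_neg h₂] at hpar
        exact absurd hpar (by decide)
      obtain ⟨d, hd, ht, hh⟩ := hr.symm_along.exists_crossing h₂ h₁
      rw [← hmem d (hedge d hd) ht hh]
      exact hd
  -- `A` is connected by edges of `S` off the path, none of which is `f`; so with `y₁` all of `A`
  -- lies outside `K`.
  have hAK : ∀ v ∈ A, v ∉ K := by
    intro v hvA hvK
    obtain ⟨d, hd, ⟨h₁, h₂⟩, h₃⟩ := (h.connA v hvA).symm_along.exists_crossing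
      (K := {v | v ∈ A ∧ v ∈ K}) ⟨hvA, hvK⟩ (fun h => hy₁ h.2)
    have hd' : d.1 ∉ edges (l ++ l') := by simpa [along] using hd
    have := hmem d ((h.mem_outside d).2 (Or.inr (h.disj _ h₁))) h₂
      (fun h₄ => h₃ ⟨h.closedA d hd' h₁, h₄⟩)
    exact hd' (this ▸ hfedge)
  -- Already the front part leads from `j` in `K` to `A`.
  have hfl : f ∈ l := by
    obtain ⟨v, hv, hr⟩ := h.exists_front
    obtain ⟨d, hd, h₁, h₂⟩ := (hr {d | d ∈ l} fun d hd => hd).exists_crossing hjK (hAK v hv)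
    rw [← hmem d (h.path_subset (List.mem_append_left _ hd)) h₁ h₂]
    exact hd
  -- The back part starts at `j` in `K` and cannot use the edge of `f` a second time, so it stays in
  -- `K`.
  have hback : ∀ d ∈ l', (G.head d ∈ K ∧ G.tail d ∈ K) := by
    have hne : ∀ d ∈ l', d.1 ≠ f.1 := by
      intro d hd he
      have := h.path.nodup_edges
      rw [List.map_append] at this
      exact List.disjoint_of_nodup_append this (List.mem_map_of_mem hfl)
        (he ▸ List.mem_map_of_mem hd)
    have hS' : ∀ d ∈ l', d ∈ S := fun d hd => h.path_subset (List.mem_append_right _ hd)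
    refine h.back.forall_mem hjK fun d hd h₁ => ?_
    by_contra h₂
    have := hmem (rev d) (hS' d hd) (by simpa using h₁) (by simpa using h₂)
    exact hne d hd (this ▸ rfl)
  -- No node before `j` is in `B`; so an end in `B` of an edge of the path is `j` or lies on the
  -- back part.
  have hBK : ∀ d : Dart m, d.1 ∈ edges (l ++ l') → G.tail d ∈ B → G.tail d ∈ K := by
    intro d hd hB
    obtain ⟨d₀, hd₀, he⟩ := mem_edges.1 hd
    have hends : G.tail d = G.tail d₀ ∨ G.tail d = G.head d₀ := by
      rcases d with ⟨e, b⟩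
      rcases d₀ with ⟨e', b'⟩
      obtain rfl : e' = e := he
      cases b <;> cases b' <;> simp [tail, head]
    rcases List.mem_append.1 hd₀ with h₁ | h₁
    · rcases hends with h₂ | h₂
      · rcases h.front.tail_eq h₁ with h₃ | ⟨d', hd', h₃⟩
        · rw [h₂, h₃]; exact hjK
        · exact absurd hB (by rw [h₂, ← h₃]; exact h.frontB d' hd')
      · exact absurd hB (by rw [h₂]; exact h.frontB d₀ h₁)
    · rcases hends with h₂ | h₂ <;> rw [h₂]
      · exact (hback d₀ h₁).2
      · exact (hback d₀ h₁).1
  -- `K ∪ B` separates the first two pairs and is left by the edge of `f` only: path edges start in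
  -- `K`, other edges cannot leave `B`.
  have hsep := h.pairs_separated (K := K ∪ B)
    (fun h₁ => h₁.elim hy₁ (h.disj _ h.y₁A)) (fun h₁ => h₁.elim hy₂ (h.disj _ h.y₂A))
    (Or.inr h.z₁B) (Or.inr h.z₂B)
  refine hF.not_single_crossing (i := 0) (j := 1) (by decide) hsep.1 hsep.2 f.1 fun d h₁ h₂ => ?_
  rw [Set.mem_union, not_or] at h₂
  by_cases hd : d.1 ∈ edges (l ++ l')
  · have : G.tail d ∈ K := h₁.elim id (hBK d hd)
    rw [hmem d (hedge d hd) this h₂.1]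
  · by_cases hB : G.tail d ∈ B
    · exact absurd (h.closedB d hd hB) h₂.2
    · rw [hmem d ((h.mem_outside d).2 (Or.inr hB)) (h₁.resolve_right hB) h₂.1]

/-- The edges that lie on exactly one of two walks. -/
noncomputable def xorEdges (p q : List (Dart m)) : Finset (Fin m) :=
  symmDiff (edges p) (edges q)

theorem xorEdges_subset {p q : List (Dart m)}
    (hpS : ∀ d ∈ p, d ∈ along (G.outside B (l ++ l')))
    (hqS : ∀ d ∈ q, d ∈ along (G.outside B (l ++ l'))) :
    xorEdges p q ⊆ G.outside B (l ++ l') := by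
  intro e he
  rcases Finset.mem_symmDiff.1 he with ⟨he, -⟩ | ⟨he, -⟩
  · obtain ⟨d, hd, rfl⟩ := mem_edges.1 he
    exact hpS d hd
  · obtain ⟨d, hd, rfl⟩ := mem_edges.1 he
    exact hqS d hd

/-- After removal of the two paths the ends of the third pair are connected, by parity. -/
theorem reach_third (h : Blocked G H A B y₁ y₂ z₁ z₂ j l l') (hE : G.Eulerian H)
    {p q : List (Dart m)} (hp : G.SimplePath j y₁ p) (hq : G.SimplePath j y₂ q)
    (hpS : ∀ d ∈ p, d ∈ along (G.outside B (l ++ l')))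
    (hqS : ∀ d ∈ q, d ∈ along (G.outside B (l ++ l'))) :
    G.Reach (along (G.outside B (l ++ l') \ xorEdges p q)) (H.snd 2) (H.fst 2) := by
  refine reach_of_bd fun w => ?_
  rw [bd_ind_sdiff (xorEdges_subset hpS hqS), h.bd_outside hE]
  -- An edge on both walks counts twice, that is, not at all. The walks contribute `y₁`, `y₂` and
  -- twice `j`, which leaves the ends of the third pair.
  have hx : (ind (xorEdges p q) : Fin m → ZMod 2) =
      fun e => ind (edges p) e + ind (edges q) e := by
    funext e
    by_cases h₁ : e ∈ edges p <;> by_cases h₂ : e ∈ edges q <;>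
      simp [ind, xorEdges, Finset.mem_symmDiff, h₁, h₂, CharTwo.add_self_eq_zero]
  rw [hx, bd_add, hp.bd_ind, hq.bd_ind]
  linear_combination (pt y₁ w + pt y₂ w + pt j w) * CharTwo.two_eq_zero (R := ZMod 2)

/-- The two paths connect `j` with `y₁`. -/
theorem reach_xor {p q : List (Dart m)} (hp : G.SimplePath j y₁ p) (hq : G.SimplePath j y₂ q)
    (hpq : ∀ d ∈ q, d ∉ p) : G.Reach (along (xorEdges p q)) j y₁ := by
  set K : Set (Fin n) := {v | G.Reach (along (xorEdges p q)) j v}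
  have hjK : j ∈ K := Relation.ReflTransGen.refl
  -- Since `q` has no dart of `p`, a common edge is passed in opposite directions and cancels, so
  -- the sum of the chains lives on `xorEdges p q`. Integer coefficients are essential: modulo 2 the
  -- two units at `j` would vanish.
  have h0 : ∑ v with v ∈ K, G.bd (fun e => (chain p e + chain q e : ℤ)) v = 0 := by
    refine G.sum_bd_eq_zero fun e he =>
      iff_of_closed (F := xorEdges p q) (fun d hd h => Reach.step h hd) ?_
    by_contra hx
    rw [xorEdges, Finset.mem_symmDiff] at hx
    apply he
    by_cases h₁ : e ∈ edges p
    · have h₂ : e ∈ edges q := by tauto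
      obtain ⟨d, hd, rfl⟩ := mem_edges.1 h₁
      obtain ⟨d', hd', he'⟩ := mem_edges.1 h₂
      have hne : d'.2 ≠ d.2 := fun h => hpq d' hd' ((Prod.ext he' h : d' = d) ▸ hd)
      have h₃ := chain_of_mem (R := ℤ) hq.nodup_edges hd'
      rw [he'] at h₃
      rw [chain_of_mem hp.nodup_edges hd, h₃]
      revert hne
      cases d.2 <;> cases d'.2 <;> simp
    · have h₂ : e ∉ edges q := by tauto
      rw [chain_of_notMem h₁, chain_of_notMem h₂, add_zero]
  simp only [bd_add, hp.1.bd_chain, hq.1.bd_chain, Finset.sum_add_distrib,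
    Finset.sum_sub_distrib, sum_pt, if_pos hjK] at h0
  -- The boundary in `K` is 2 minus one for each of `y₁`, `y₂` in `K`; being zero, it requires both.
  by_contra hy
  rw [if_neg (show y₁ ∉ K from hy)] at h0
  split_ifs at h0 <;> omega

/-- The component `B` together with the two paths connects the ends of the second pair. -/
theorem reach_rest (h : Blocked G H A B y₁ y₂ z₁ z₂ j l l') {p q : List (Dart m)}
    (hp : G.SimplePath j y₁ p) (hq : G.SimplePath j y₂ q) (hpq : ∀ d ∈ q, d ∉ p) :
    G.Reach (along (G.outside B (l ++ l') \ xorEdges p q)ᶜ) (H.snd 1) (H.fst 1) := by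
  have hr : G.Reach (along (G.outside B (l ++ l') \ xorEdges p q)ᶜ) z₁ y₁ := by
    -- From `z₁` to `j` inside `B`, whose edges off the path do not belong to `outside`; then along
    -- the two walks.
    refine Relation.ReflTransGen.trans (b := j) ?_ ((reach_xor hp hq hpq).mono ?_)
    · refine ((h.connB j h.jB).closed
        (K := {v | v ∈ B ∧ G.Reach (along (G.outside B (l ++ l') \ xorEdges p q)ᶜ) z₁ v}) ?_
        ⟨h.z₁B, .refl⟩).2
      rintro d hd ⟨h₁, h₂⟩
      have hd' : d.1 ∉ edges (l ++ l') := by simpa [along] using hd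
      refine ⟨h.closedB d hd' h₁, h₂.step ?_⟩
      have := h.mem_outside d
      simp only [along, Set.mem_ofPred_eq, Finset.mem_compl, Finset.mem_sdiff]
      tauto
    · intro d hd
      simp only [along, Set.mem_ofPred_eq, Finset.mem_compl, Finset.mem_sdiff] at hd ⊢
      tauto
  rcases h.pair₁ with ⟨h₁, h₂⟩ | ⟨h₁, h₂⟩
  · rwa [h₁, h₂] at hr
  · rw [h₁, h₂] at hr
    exact hr.symm_along

end Blocked

end

end Multigraph

/-! ### Adjacency lists -/

section

open scoped Classical

variable {n m : ℕ} {G : Multigraph n m} {B : ℕ} {σ : State}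

/-- Programs in sequence. -/
def Program.block : List Program → Program
  | [] => .skip
  | c :: cs => .seq c (block cs)

/-- The number that represents a dart; `0` represents no dart. -/
def code {m : ℕ} (d : Dart m) : ℕ := if d.2 then d.1 + 1 + m else d.1 + 1

theorem code_pos (d : Dart m) : 0 < code d := by
  unfold code; split_ifs <;> omega

theorem code_ne_zero (d : Dart m) : code d ≠ 0 := (code_pos d).ne'

theorem code_le (d : Dart m) : code d ≤ 2 * m := by
  have := d.1.2
  unfold code; split_ifs <;> omega

theorem code_injective : Function.Injective (code : Dart m → ℕ) := by
  rintro ⟨⟨e, he⟩, b⟩ ⟨⟨e', he'⟩, b'⟩ h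
  cases b <;> cases b' <;> simp [code] at h ⊢ <;> omega

theorem exists_code {h : ℕ} (h₁ : 0 < h) (h₂ : h ≤ 2 * m) : ∃ d : Dart m, code d = h := by
  by_cases hm : h ≤ m
  · exact ⟨(⟨h - 1, by omega⟩, false), by simp [code]; omega⟩
  · exact ⟨(⟨h - 1 - m, by omega⟩, true), by simp [code]; omega⟩

/-- The last of the first `k` darts that leaves `v`, or `0` if there is none. -/
noncomputable def lastDart (G : Multigraph n m) (v : Fin n) (k : ℕ) : ℕ :=
  Nat.findGreatest (fun h => ∃ d : Dart m, code d = h ∧ G.tail d = v) k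

theorem lastDart_zero (v : Fin n) : lastDart G v 0 = 0 := rfl

/-- This is the effect of `linkDart`, which puts dart `k + 1` in front of the list of its tail. The
lists run through decreasing codes. -/
theorem lastDart_succ (v : Fin n) (d : Dart m) {k : ℕ} (hd : code d = k + 1) :
    lastDart G v (k + 1) = if G.tail d = v then k + 1 else lastDart G v k := by
  unfold lastDart
  rw [Nat.findGreatest_succ]
  have : (∃ d' : Dart m, code d' = k + 1 ∧ G.tail d' = v) ↔ G.tail d = v := by
    constructor
    · rintro ⟨d', h, h'⟩
      rwa [code_injective (hd.trans h.symm)]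
    · exact fun h => ⟨d, hd, h⟩
  simp only [this]

theorem lastDart_spec (G : Multigraph n m) (v : Fin n) (k : ℕ) :
    lastDart G v k = 0 ∨ ∃ d : Dart m, code d = lastDart G v k ∧ G.tail d = v := by
  by_cases h : lastDart G v k = 0
  · exact Or.inl h
  · exact Or.inr (Nat.findGreatest_of_ne_zero (m := lastDart G v k) rfl h)

theorem code_le_lastDart {v : Fin n} {k : ℕ} {d : Dart m} (hd : G.tail d = v) (hk : code d ≤ k) :
    code d ≤ lastDart G v k :=
  Nat.le_findGreatest hk ⟨d, rfl, hd⟩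

/-- Constants are in registers `1` to `5`, and the graph is in arrays `8` to `13`: the tail, the
head, the reverse, and the edge of each dart, the next dart with the same tail, and the first dart
of each node. -/
structure Loaded (G : Multigraph n m) (σ : State) : Prop where
  reg1 : σ.reg 1 = m
  reg2 : σ.reg 2 = 0
  reg3 : σ.reg 3 = 1
  reg4 : σ.reg 4 = 2 * m
  reg5 : σ.reg 5 = 2 * m + 1
  tail : ∀ d : Dart m, σ.mem 8 (code d) = G.tail d
  head : ∀ d : Dart m, σ.mem 9 (code d) = G.head d
  rev : ∀ d : Dart m, σ.mem 10 (code d) = code (rev d)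
  edge : ∀ d : Dart m, σ.mem 11 (code d) = d.1
  next : ∀ d : Dart m, σ.mem 12 (code d) = lastDart G (G.tail d) (code d - 1)
  first : ∀ v : Fin n, σ.mem 13 v = lastDart G v (2 * m)

theorem Loaded.congr {τ : State} (h : Loaded G σ)
    (hr : ∀ r, 1 ≤ r → r ≤ 5 → τ.reg r = σ.reg r)
    (hm : ∀ a, 8 ≤ a → a ≤ 13 → τ.mem a = σ.mem a) : Loaded G τ where
  reg1 := by rw [hr 1 (by norm_num) (by norm_num), h.reg1]
  reg2 := by rw [hr 2 (by norm_num) (by norm_num), h.reg2]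
  reg3 := by rw [hr 3 (by norm_num) (by norm_num), h.reg3]
  reg4 := by rw [hr 4 (by norm_num) (by norm_num), h.reg4]
  reg5 := by rw [hr 5 (by norm_num) (by norm_num), h.reg5]
  tail := by rw [hm 8 (by norm_num) (by norm_num)]; exact h.tail
  head := by rw [hm 9 (by norm_num) (by norm_num)]; exact h.head
  rev := by rw [hm 10 (by norm_num) (by norm_num)]; exact h.rev
  edge := by rw [hm 11 (by norm_num) (by norm_num)]; exact h.edge
  next := by rw [hm 12 (by norm_num) (by norm_num)]; exact h.next
  first := by rw [hm 13 (by norm_num) (by norm_num)]; exact h.first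

/-- The terminals are in registers `6` to `11`. -/
structure Terminals (H : Multigraph n 3) (σ : State) : Prop where
  s₁ : σ.reg 6 = H.fst 0
  s₂ : σ.reg 7 = H.fst 1
  s₃ : σ.reg 8 = H.fst 2
  t₁ : σ.reg 9 = H.snd 0
  t₂ : σ.reg 10 = H.snd 1
  t₃ : σ.reg 11 = H.snd 2

theorem Terminals.congr {H : Multigraph n 3} {τ : State} (h : Terminals H σ)
    (hr : ∀ r, 6 ≤ r → r ≤ 11 → τ.reg r = σ.reg r) : Terminals H τ where
  s₁ := by rw [hr 6 (by norm_num) (by norm_num), h.s₁]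
  s₂ := by rw [hr 7 (by norm_num) (by norm_num), h.s₂]
  s₃ := by rw [hr 8 (by norm_num) (by norm_num), h.s₃]
  t₁ := by rw [hr 9 (by norm_num) (by norm_num), h.t₁]
  t₂ := by rw [hr 10 (by norm_num) (by norm_num), h.t₂]
  t₃ := by rw [hr 11 (by norm_num) (by norm_num), h.t₃]

namespace Program

def loadConstants : Program := block
  [const 3 1, add 4 1 1, add 5 4 3, const 20 2, load 6 2 2, load 7 2 3, load 8 2 20, load 9 3 2,
    load 10 3 3, load 11 3 20]

def makeDart : Program := block
  [load 22 0 21, load 23 1 21, add 24 21 3, add 25 24 1, store 8 24 22, store 9 24 23,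
    store 10 24 25, store 11 24 21, store 8 25 23, store 9 25 22, store 10 25 24, store 11 25 21,
    copy 21 24]

def linkDart : Program := block
  [add 26 26 3, load 22 8 26, load 23 13 22, store 12 26 23, store 13 22 26]

def loadGraph : Program := block
  [loadConstants, .while (.lt 21 1) makeDart, .while (.lt 26 4) linkDart]

end Program

open Program

theorem Meets.seq_of {B t t' T : ℕ} {c d : Program} {σ : State} {Q R : State → Prop}
    (h : Meets B c σ t Q) (h' : ∀ τ, Q τ → Frame c σ τ → Meets B d τ t' R) (hT : t + t' ≤ T) :
    Meets B (.seq c d) σ T R :=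
  (Meets.seq (h.frame.mono le_rfl fun τ hτ => h' τ hτ.1 hτ.2)).mono hT fun _ => id

theorem makeDart_spec (hB : 2 * m + 2 ≤ B) {e : ℕ} (he : e < m) (h1 : σ.reg 1 = m)
    (h3 : σ.reg 3 = 1) (h21 : σ.reg 21 = e) :
    Meets B makeDart σ makeDart.cost fun τ =>
      τ.reg 21 = e + 1 ∧
      τ.mem 8 = Function.update (Function.update (σ.mem 8) (e + 1) (σ.mem 0 e)) (e + 1 + m)
        (σ.mem 1 e) ∧
      τ.mem 9 = Function.update (Function.update (σ.mem 9) (e + 1) (σ.mem 1 e)) (e + 1 + m)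
        (σ.mem 0 e) ∧
      τ.mem 10 = Function.update (Function.update (σ.mem 10) (e + 1) (e + 1 + m)) (e + 1 + m)
        (e + 1) ∧
      τ.mem 11 = Function.update (Function.update (σ.mem 11) (e + 1) e) (e + 1 + m) e := by
  apply Meets.of_pre
  simp [makeDart, block, pre, State.setReg_reg, State.setReg_mem, State.setMem_reg,
    State.setMem_mem, h1, h3, h21]
  omega

/-- The invariant step shared by the four arrays of `makeDart`: the cells `e + 1` and `e + 1 + m`
are the codes of the two darts of `e` and of no earlier edge. -/
theorem update_update_code {f : ℕ → ℕ} {g : Dart m → ℕ} {e x y : ℕ} (he : e < m)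
    (hf : ∀ d : Dart m, (d.1 : ℕ) < e → f (code d) = g d)
    (hx : g (⟨e, he⟩, false) = x) (hy : g (⟨e, he⟩, true) = y) (d : Dart m)
    (hd : (d.1 : ℕ) < e + 1) :
    Function.update (Function.update f (e + 1) x) (e + 1 + m) y (code d) = g d := by
  rcases Nat.lt_succ_iff_lt_or_eq.1 hd with hd | hd
  · have := d.1.2
    rw [Function.update_of_ne, Function.update_of_ne, hf d hd]
    · unfold code; split_ifs <;> omega
    · unfold code; split_ifs <;> omega
  · rcases d with ⟨⟨i, hi⟩, b⟩
    obtain rfl : i = e := hd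
    cases b
    · rw [Function.update_of_ne, ← hx]
      · exact Function.update_self _ _ _
      · simp only [code, Bool.false_eq_true, if_false]; omega
    · rw [← hy]
      exact Function.update_self _ _ _

theorem linkDart_spec (hB : 2 * m + 2 ≤ B) {k : ℕ} (hk : k < 2 * m)
    (h3 : σ.reg 3 = 1) (h26 : σ.reg 26 = k) :
    Meets B linkDart σ linkDart.cost fun τ =>
      τ.reg 26 = k + 1 ∧
      τ.mem 12 = Function.update (σ.mem 12) (k + 1) (σ.mem 13 (σ.mem 8 (k + 1))) ∧
      τ.mem 13 = Function.update (σ.mem 13) (σ.mem 8 (k + 1)) (k + 1) := by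
  apply Meets.of_pre
  simp [linkDart, block, pre, State.setReg_reg, State.setReg_mem, State.setMem_reg,
    State.setMem_mem, h3, h26]
  omega

theorem loadGraph_spec (G : Multigraph n m) (H : Multigraph n 3) (hB : 2 * m + 3 ≤ B) :
    Meets B loadGraph (initState G H) (50 * m + 30) fun τ => Loaded G τ ∧ Terminals H τ := by
  have h1 : Meets B loadConstants (initState G H) loadConstants.cost fun τ =>
      τ.reg 3 = 1 ∧ τ.reg 4 = 2 * m ∧ τ.reg 5 = 2 * m + 1 ∧ Terminals H τ := by
    apply Meets.of_pre
    simp [loadConstants, block, pre, State.setReg_reg, State.setReg_mem, initState]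
    refine ⟨by omega, by omega, by omega, by omega, by omega, ?_⟩
    constructor <;> simp [State.setReg_reg, toArray]
  refine h1.seq_of (t' := 50 * m + 10) (fun σ₁ ⟨hr3, hr4, hr5, hT⟩ hf₁ => ?_)
    (by simp [loadConstants, cost, block]; omega)
  have hr1 : σ₁.reg 1 = m := hf₁.reg 1 (by decide)
  have hr2 : σ₁.reg 2 = 0 := hf₁.reg 2 (by decide)
  have hr21 : σ₁.reg 21 = 0 := hf₁.reg 21 (by decide)
  have hr26 : σ₁.reg 26 = 0 := hf₁.reg 26 (by decide)
  have hm0 : σ₁.mem 0 = toArray G.fst := hf₁.mem 0 (by decide)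
  have hm1 : σ₁.mem 1 = toArray G.snd := hf₁.mem 1 (by decide)
  have hm13 : σ₁.mem 13 = fun _ => 0 := hf₁.mem 13 (by decide)
  have h2 := Meets.loop (B := B) (c := makeDart) (σ := σ₁) (t := makeDart.cost) (b := .lt 21 1)
    (fun ρ => ρ.reg 21 ≤ m ∧ ∀ d : Dart m, (d.1 : ℕ) < ρ.reg 21 →
      ρ.mem 8 (code d) = G.tail d ∧ ρ.mem 9 (code d) = G.head d ∧
      ρ.mem 10 (code d) = code (rev d) ∧ ρ.mem 11 (code d) = d.1)
    (fun ρ => m - ρ.reg 21) (by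
      rintro ρ hf ⟨hle, hI⟩ hb
      have hlt : ρ.reg 21 < m := by
        have : ρ.reg 1 = m := (hf.reg 1 (by decide)).trans hr1
        have hb' : ρ.reg 21 < ρ.reg 1 := hb
        omega
      refine (makeDart_spec (by omega) hlt ((hf.reg 1 (by decide)).trans hr1)
        ((hf.reg 3 (by decide)).trans hr3) rfl).mono le_rfl ?_
      rintro τ ⟨h21, h8, h9, h10, h11⟩
      have e0 : ρ.mem 0 (ρ.reg 21) = G.fst ⟨_, hlt⟩ := by
        rw [hf.mem 0 (by decide), hm0]; simp [toArray, hlt]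
      have e1 : ρ.mem 1 (ρ.reg 21) = G.snd ⟨_, hlt⟩ := by
        rw [hf.mem 1 (by decide), hm1]; simp [toArray, hlt]
      rw [h21, h8, h9, h10, h11]
      refine ⟨⟨by omega, fun d hd => ⟨?_, ?_, ?_, ?_⟩⟩, by omega⟩
      · exact update_update_code hlt (g := fun d => (G.tail d : ℕ)) (fun d hd => (hI d hd).1)
          e0.symm e1.symm d hd
      · exact update_update_code hlt (g := fun d => (G.head d : ℕ)) (fun d hd => (hI d hd).2.1)
          e1.symm e0.symm d hd
      · exact update_update_code hlt (g := fun d => code (rev d)) (fun d hd => (hI d hd).2.2.1)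
          rfl rfl d hd
      · exact update_update_code hlt (g := fun d => (d.1 : ℕ)) (fun d hd => (hI d hd).2.2.2)
          rfl rfl d hd)
    ⟨by omega, fun d hd => absurd hd (by omega)⟩
  refine h2.seq_of (t' := 20 * m + 5) (fun σ₂ ⟨⟨hle, hI⟩, hb⟩ hf₂ => ?_)
    (by simp [makeDart, cost, block]; omega)
  have hend : σ₂.reg 21 = m := by
    have h : ¬ σ₂.reg 21 < σ₂.reg 1 := hb
    have : σ₂.reg 1 = m := (hf₂.reg 1 (by decide)).trans hr1
    omega
  have hI' := fun d : Dart m => hI d (by rw [hend]; exact d.1.2)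
  have hr4' : σ₂.reg 4 = 2 * m := (hf₂.reg 4 (by decide)).trans hr4
  have hm13' : σ₂.mem 13 = fun _ => 0 := (hf₂.mem 13 (by decide)).trans hm13
  have h3 := Meets.loop (B := B) (c := linkDart) (σ := σ₂) (t := linkDart.cost) (b := .lt 26 4)
    (fun ρ => ρ.reg 26 ≤ 2 * m ∧
      (∀ d : Dart m, code d ≤ ρ.reg 26 →
        ρ.mem 12 (code d) = lastDart G (G.tail d) (code d - 1)) ∧
      ∀ v : Fin n, ρ.mem 13 v = lastDart G v (ρ.reg 26))
    (fun ρ => 2 * m - ρ.reg 26) (by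
      rintro ρ hf ⟨hle, hI₁, hI₂⟩ hb
      have hlt : ρ.reg 26 < 2 * m := by
        have : ρ.reg 4 = 2 * m := (hf.reg 4 (by decide)).trans hr4'
        have hb' : ρ.reg 26 < ρ.reg 4 := hb
        omega
      obtain ⟨d₀, hd₀⟩ := exists_code (m := m) (h := ρ.reg 26 + 1) (by omega) (by omega)
      have h8 : ρ.mem 8 (ρ.reg 26 + 1) = G.tail d₀ := by
        rw [← hd₀, hf.mem 8 (by decide)]; exact (hI' d₀).1
      refine (linkDart_spec (by omega) hlt
        ((hf.reg 3 (by decide)).trans ((hf₂.reg 3 (by decide)).trans hr3)) rfl).mono le_rfl ?_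
      rintro τ ⟨h26, h12, h13⟩
      rw [h26, h12, h13, h8]
      refine ⟨⟨by omega, fun d hd => ?_, fun v => ?_⟩, by omega⟩
      · rcases Nat.lt_succ_iff_lt_or_eq.1 (Nat.lt_succ_of_le hd) with hd | hd
        · rw [Function.update_of_ne (by omega), hI₁ d (by omega)]
        · obtain rfl := code_injective (hd.trans hd₀.symm)
          rw [hd, Function.update_self, hI₂]
          rfl
      · rw [lastDart_succ v d₀ hd₀]
        by_cases hv : G.tail d₀ = v
        · rw [if_pos hv, hv, Function.update_self]
        · rw [if_neg hv, Function.update_of_ne, hI₂]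
          exact fun h => hv (Fin.ext h.symm))
    ⟨by rw [hf₂.reg 26 (by decide)]; omega,
      fun d hd => absurd hd (by
        rw [hf₂.reg 26 (by decide), hr26]; exact (code_pos d).not_ge),
      fun v => by rw [hf₂.reg 26 (by decide), hr26, hm13', lastDart_zero]⟩
  -- The last step is the `skip` that ends every `block`.
  refine h3.seq_of (t' := 1) (fun σ₃ ⟨⟨hle₃, hI₁, hI₂⟩, hb₃⟩ hf₃ => ⟨1, σ₃, .skip _, le_rfl, ?_⟩)
    (by simp [linkDart, cost, block]; omega)
  have hend₃ : σ₃.reg 26 = 2 * m := by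
    have h : ¬ σ₃.reg 26 < σ₃.reg 4 := hb₃
    have : σ₃.reg 4 = 2 * m := (hf₃.reg 4 (by decide)).trans hr4'
    omega
  refine ⟨?_, hT.congr fun r h₁ h₂ => ?_⟩
  · rw [hend₃] at hI₁ hI₂
    constructor
    · rw [hf₃.reg 1 (by decide), hf₂.reg 1 (by decide), hr1]
    · rw [hf₃.reg 2 (by decide), hf₂.reg 2 (by decide), hr2]
    · rw [hf₃.reg 3 (by decide), hf₂.reg 3 (by decide), hr3]
    · rw [hf₃.reg 4 (by decide), hf₂.reg 4 (by decide), hr4]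
    · rw [hf₃.reg 5 (by decide), hf₂.reg 5 (by decide), hr5]
    · rw [hf₃.mem 8 (by decide)]; exact fun d => (hI' d).1
    · rw [hf₃.mem 9 (by decide)]; exact fun d => (hI' d).2.1
    · rw [hf₃.mem 10 (by decide)]; exact fun d => (hI' d).2.2.1
    · rw [hf₃.mem 11 (by decide)]; exact fun d => (hI' d).2.2.2
    · exact fun d => hI₁ d (code_le d)
    · exact hI₂
  · interval_cases r <;>
      rw [hf₃.reg _ (by decide), hf₂.reg _ (by decide)]

end

/-! ### Graph search -/

section

open scoped Classical
open Program

variable {n m : ℕ} {G : Multigraph n m} {B : ℕ} {σ : State}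

/-- The array `par` represents a search tree for the darts in `S`: it holds the last dart of a path
from `r` to each node that can be reached, `2 m + 1` for the root and `0` for all other nodes. -/
structure Searched (G : Multigraph n m) (S : Set (Dart m)) (r : Fin n) (par : ℕ → ℕ) : Prop where
  root : par r = 2 * m + 1
  reach : ∀ v : Fin n, par v ≠ 0 ↔ G.Reach S r v
  path : ∀ v : Fin n, G.Reach S r v →
    ∃ l, G.SimplePath r v l ∧ ∀ d ∈ l, d ∈ S ∧ par (G.head d) = code d

/-- The invariant of breadth-first search: `vs` are the nodes found so far, `Q` is the array that
holds them, `i` of them are finished, and `h` is the next dart of the following one. -/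
structure SearchInv (G : Multigraph n m) (S : Set (Dart m)) (r : Fin n) (par Q : ℕ → ℕ)
    (i k h : ℕ) (vs : List (Fin n)) : Prop where
  len : k = vs.length
  le : i ≤ k
  nodup : vs.Nodup
  queue : ∀ (a : ℕ) (ha : a < vs.length), Q a = vs[a]
  root : par r = 2 * m + 1
  visited : ∀ v : Fin n, par v ≠ 0 ↔ v ∈ vs
  path : ∀ v ∈ vs, ∃ l, G.SimplePath r v l ∧ (∀ u ∈ l.map G.tail, u ∈ vs) ∧
    ∀ d ∈ l, d ∈ S ∧ par (G.head d) = code d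
  finished : ∀ (a : ℕ) (ha : a < vs.length), a < i → ∀ d ∈ S, G.tail d = vs[a] → G.head d ∈ vs
  cur : ∀ hi : i < vs.length, (h = 0 ∨ ∃ d : Dart m, code d = h ∧ G.tail d = vs[i]) ∧
    ∀ d ∈ S, G.tail d = vs[i] → h < code d → G.head d ∈ vs

namespace SearchInv

variable {S : Set (Dart m)} {r : Fin n} {par Q : ℕ → ℕ} {i k h : ℕ} {vs : List (Fin n)}

theorem of_root (hroot : par r = 2 * m + 1) (hpar : ∀ v : Fin n, v ≠ r → par v = 0) (hQ : Q 0 = r) :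
    SearchInv G S r par Q 0 1 (lastDart G r (2 * m)) [r] where
  len := rfl
  le := by omega
  nodup := by simp
  queue a ha := by
    simp only [List.length_singleton, Nat.lt_one_iff] at ha
    subst ha
    simpa using hQ
  root := hroot
  visited v := by
    rw [List.mem_singleton]
    by_cases hv : v = r
    · subst hv; simp [hroot]
    · simp [hv, hpar v hv]
  path v hv := by
    rw [List.mem_singleton] at hv
    subst hv
    exact ⟨[], ⟨rfl, by simp⟩, by simp, by simp⟩
  finished a _ ha := absurd ha (by omega)
  cur _ := by
    refine ⟨lastDart_spec G r (2 * m), fun d _ ht hd => ?_⟩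
    exact absurd (code_le_lastDart (v := r) ht (code_le d)) (by omega)

theorem le_card (h : SearchInv G S r par Q i k h vs) : k ≤ n := by
  rw [h.len]
  simpa using h.nodup.length_le_card

/-- The pointer `0` means that the list of the current node is exhausted, so this node is finished.
-/
theorem advance (hI : SearchInv G S r par Q i k 0 vs) (hi : i < k) {h' : ℕ}
    (hh' : ∀ hi : i + 1 < vs.length, h' = lastDart G vs[i + 1] (2 * m)) :
    SearchInv G S r par Q (i + 1) k h' vs where
  len := hI.len
  le := hi
  nodup := hI.nodup
  queue := hI.queue
  root := hI.root
  visited := hI.visited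
  path := hI.path
  finished a ha hai := by
    intro d hd ht
    rcases Nat.lt_succ_iff_lt_or_eq.1 hai with h | rfl
    · exact hI.finished a ha h d hd ht
    · exact (hI.cur ha).2 d hd ht (code_pos d)
  cur hi' := by
    rw [hh' hi']
    refine ⟨lastDart_spec G _ (2 * m), fun d _ ht hd => ?_⟩
    exact absurd (code_le_lastDart ht (code_le d)) (by omega)

/-- No dart of the same tail has a code strictly between the new pointer and `code d`, so only `d`
itself has to be settled. -/
theorem next {d : Dart m} (hI : SearchInv G S r par Q i k (code d) vs)
    (hd : d ∈ S → G.head d ∈ vs) :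
    SearchInv G S r par Q i k (lastDart G (G.tail d) (code d - 1)) vs where
  len := hI.len
  le := hI.le
  nodup := hI.nodup
  queue := hI.queue
  root := hI.root
  visited := hI.visited
  path := hI.path
  finished := hI.finished
  cur hi' := by
    have hcur := hI.cur hi'
    have ht : G.tail d = vs[i] := by
      rcases hcur.1 with h | ⟨d', hd', h⟩
      · exact absurd h (code_ne_zero d)
      · rwa [code_injective hd'] at h
    rw [ht]
    refine ⟨lastDart_spec G _ _, fun d' hd' ht' hlt => ?_⟩
    rcases lt_trichotomy (code d') (code d) with h | h | h
    · exact absurd (code_le_lastDart ht' (by omega : code d' ≤ code d - 1)) (by omega)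
    · rw [code_injective h] at hd' ⊢; exact hd hd'
    · exact hcur.2 d' hd' ht' h

/-- The path to the tail of `d` extends to the new node. Stored paths remain valid, because only the
entry of an unvisited node changes. The pointer stays at `d`, so that `next` applies afterwards. -/
theorem visit {d : Dart m} (hI : SearchInv G S r par Q i k (code d) vs) (hi : i < k)
    (hd : d ∈ S) (hnew : par (G.head d) = 0) :
    SearchInv G S r (Function.update par (G.head d) (code d)) (Function.update Q k (G.head d))
      i (k + 1) (code d) (vs ++ [G.head d]) := by
  have hnot : G.head d ∉ vs := fun h => (hI.visited _).2 h hnew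
  have hk := hI.len
  have ht : ∀ hi' : i < vs.length, G.tail d = vs[i] := fun hi' => by
    rcases (hI.cur hi').1 with h | ⟨d', hd', h⟩
    · exact absurd h (code_ne_zero d)
    · rwa [code_injective hd'] at h
  have hget : ∀ (a : ℕ) (ha : a < vs.length) (ha' : a < (vs ++ [G.head d]).length),
      (vs ++ [G.head d])[a] = vs[a] := fun a ha _ => List.getElem_append_left ha
  have hpar : ∀ u : Fin n, u ∈ vs → Function.update par (G.head d) (code d) u = par u := by
    intro u hu
    rw [Function.update_of_ne]
    intro h
    exact hnot (Fin.ext h ▸ hu)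
  have hroot : r ∈ vs := (hI.visited r).1 (by rw [hI.root]; omega)
  have hkeep : ∀ l : List (Dart m), (∀ d' ∈ l, d' ∈ S ∧ par (G.head d') = code d') →
      ∀ d' ∈ l, d' ∈ S ∧ Function.update par (G.head d) (code d) (G.head d') = code d' := by
    intro l hl d' hd'
    refine ⟨(hl d' hd').1, ?_⟩
    rw [hpar _ ((hI.visited _).1 (by rw [(hl d' hd').2]; exact code_ne_zero d')), (hl d' hd').2]
  constructor
  · simp [hk]
  · have := hI.le; omega
  · rw [List.nodup_append]
    refine ⟨hI.nodup, by simp, ?_⟩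
    intro a ha b hb
    rw [List.mem_singleton] at hb
    rintro rfl
    exact hnot (hb ▸ ha)
  · intro a ha
    by_cases hak : a = k
    · subst hak
      rw [Function.update_self]
      simp [hk]
    · have ha' : a < vs.length := by simp at ha; omega
      rw [Function.update_of_ne hak, hget a ha', hI.queue a ha']
  · rw [hpar r hroot, hI.root]
  · intro v
    rw [List.mem_append, List.mem_singleton]
    by_cases hv : v = G.head d
    · subst hv
      simp [code_ne_zero]
    · rw [Function.update_of_ne (fun h => hv (Fin.ext h)), hI.visited]
      simp [hv]
  · intro v hv
    rw [List.mem_append, List.mem_singleton] at hv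
    rcases hv with hv | rfl
    · obtain ⟨l, h₁, h₂, h₃⟩ := hI.path v hv
      exact ⟨l, h₁, fun u hu => List.mem_append_left _ (h₂ u hu), hkeep l h₃⟩
    · have hi' : i < vs.length := by omega
      have htv : G.tail d ∈ vs := by rw [ht hi']; exact List.getElem_mem hi'
      obtain ⟨l, h₁, h₂, h₃⟩ := hI.path _ htv
      have hmem : ∀ u ∈ G.tail d :: l.map G.tail, u ∈ vs := by
        intro u hu
        rcases List.mem_cons.1 hu with rfl | hu
        · exact htv
        · exact h₂ u hu
      refine ⟨d :: l, ⟨⟨rfl, h₁.1⟩, ?_⟩, ?_, ?_⟩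
      · rw [List.map_cons, List.nodup_cons]
        exact ⟨fun h => hnot (hmem _ h), h₁.2⟩
      · rw [List.map_cons]
        exact fun u hu => List.mem_append_left _ (hmem u hu)
      · intro d' hd'
        rcases List.mem_cons.1 hd' with rfl | hd'
        · exact ⟨hd, by rw [Function.update_self]⟩
        · exact hkeep l h₃ d' hd'
  · intro a ha hai d' hd' ht'
    have ha' : a < vs.length := by omega
    rw [hget a ha'] at ht'
    exact List.mem_append_left _ (hI.finished a ha' hai d' hd' ht')
  · intro hi'
    have hi'' : i < vs.length := by omega
    rw [hget i hi'']
    refine ⟨Or.inr ⟨d, rfl, ht hi''⟩, fun d' hd' ht' hlt => ?_⟩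
    exact List.mem_append_left _ ((hI.cur hi'').2 d' hd' ht' hlt)

/-- With the queue used up, all nodes found are finished, so they form a closed set. -/
theorem searched (hI : SearchInv G S r par Q i k h vs) (hi : ¬ i < k) : Searched G S r par := by
  have hroot : r ∈ vs := (hI.visited r).1 (by rw [hI.root]; omega)
  have hreach : ∀ v : Fin n, par v ≠ 0 ↔ G.Reach S r v := by
    intro v
    rw [hI.visited]
    constructor
    · intro hv
      obtain ⟨l, h₁, -, h₃⟩ := hI.path v hv
      exact h₁.1.reach fun d hd => (h₃ d hd).1
    · intro hv
      refine hv.closed (K := {v | v ∈ vs}) (fun d hd ht => ?_) hroot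
      obtain ⟨a, ha, hat⟩ := List.getElem_of_mem ht
      have := hI.len
      exact hI.finished a ha (by omega) d hd hat.symm
  refine ⟨hI.root, hreach, fun v hv => ?_⟩
  obtain ⟨l, h₁, -, h₃⟩ := hI.path v ((hI.visited v).1 ((hreach v).2 hv))
  exact ⟨l, h₁, h₃⟩

end SearchInv

/-- The darts that breadth-first search has not yet passed. -/
noncomputable def unscanned (G : Multigraph n m) (Q : ℕ → ℕ) (i h : ℕ) : Finset (Dart m) :=
  Finset.univ.filter fun d => (∀ a < i, Q a ≠ G.tail d) ∧ ¬ (Q i = G.tail d ∧ h < code d)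

theorem unscanned_advance (Q : ℕ → ℕ) (i h : ℕ) :
    (unscanned G Q (i + 1) h).card ≤ (unscanned G Q i 0).card := by
  refine Finset.card_le_card fun d hd => ?_
  simp only [unscanned, Finset.mem_filter, Finset.mem_univ, true_and] at hd ⊢
  exact ⟨fun a ha => hd.1 a (by omega), fun h => hd.1 i (by omega) h.1⟩

theorem unscanned_next {Q Q' : ℕ → ℕ} {i h' : ℕ} {d : Dart m} (hQ : ∀ a ≤ i, Q' a = Q a)
    (ht : Q i = G.tail d) (hd : ∀ a < i, Q a ≠ G.tail d) (hh : h' < code d) :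
    (unscanned G Q' i h').card < (unscanned G Q i (code d)).card := by
  refine Finset.card_lt_card ⟨fun d' hd' => ?_, fun hsub => ?_⟩
  · simp only [unscanned, Finset.mem_filter, Finset.mem_univ, true_and, hQ i le_rfl] at hd' ⊢
    exact ⟨fun a ha => hQ a ha.le ▸ hd'.1 a ha, fun h => hd'.2 ⟨h.1, by omega⟩⟩
  · have : d ∈ unscanned G Q i (code d) := by
      simp only [unscanned, Finset.mem_filter, Finset.mem_univ, true_and]
      exact ⟨hd, fun h => absurd h.2 (by omega)⟩
    have := hsub this
    simp only [unscanned, Finset.mem_filter, Finset.mem_univ, true_and, hQ i le_rfl] at this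
    exact this.2 ⟨ht, hh⟩

theorem lastDart_lt (v : Fin n) (d : Dart m) : lastDart G v (code d - 1) < code d := by
  have : lastDart G v (code d - 1) ≤ code d - 1 := Nat.findGreatest_le _
  have := code_pos d
  omega

namespace Program

/-- The root entry `2 * m + 1` is nonzero, like that of every visited node, but exceeds all codes;
this stops `trace`. -/
def searchInit (p q r : ℕ) : Program := block
  [store p r 5, store q 2 r, copy 33 2, copy 34 3, copy 30 r, load 31 13 30]

def searchAdvance (q : ℕ) : Program := block [add 33 33 3, load 30 q 33, load 31 13 30]

def searchScan (b p q : ℕ) : Program := block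
  [load 35 b 31,
    ite (.eq 35 2) (block
      [load 32 9 31, load 35 p 32,
        ite (.eq 35 2) (block [store p 32 31, store q 34 32, add 34 34 3]) skip]) skip,
    load 31 12 31]

/-- Breadth-first search from the node in register `r` along the darts whose entry in the array `b`
is zero. The search tree is stored in the array `p`, the queue in the array `q`. -/
def search (b p q r : ℕ) : Program :=
  .seq (searchInit p q r)
    (.while (.lt 33 34) (.ite (.eq 31 2) (searchAdvance q) (searchScan b p q)))

end Program

theorem search_spec {b p q rr : ℕ} {r : Fin n} (hL : Loaded G σ) (hB : 2 * m + n + 3 ≤ B)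
    (hr : σ.reg rr = r) (hp0 : σ.mem p = fun _ => 0) (hp : 20 ≤ p) (hq : 20 ≤ q) (hpq : p ≠ q)
    (hbp : b ≠ p) (hbq : b ≠ q) (hrr : rr < 20) :
    Meets B (search b p q rr) σ (30 * (2 * m + n) + 10) fun τ =>
      Searched G {d | σ.mem b (code d) = 0} r (τ.mem p) := by
  set S : Set (Dart m) := {d | σ.mem b (code d) = 0} with hS
  have h1 : Meets B (searchInit p q rr) σ (searchInit p q rr).cost fun τ =>
      τ.reg 33 = 0 ∧ τ.reg 34 = 1 ∧ τ.reg 31 = lastDart G r (2 * m) ∧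
      τ.mem p = Function.update (fun _ => 0) (r : ℕ) (2 * m + 1) ∧ τ.mem q 0 = r := by
    apply Meets.of_pre
    simp [searchInit, block, pre, State.setReg_reg, State.setReg_mem, State.setMem_reg,
      State.setMem_mem, hL.reg2, hL.reg3, hL.reg5, hL.first, hr, hp0, hpq, hpq.symm,
      show rr ≠ 33 by omega, show rr ≠ 34 by omega, show (13 : ℕ) ≠ p by omega,
      show (13 : ℕ) ≠ q by omega]
  have hregs : ∀ x, x < 20 → x ∉ (searchInit p q rr).regs := by
    intro x hx; simp [searchInit, block, regs]; omega
  have harr : ∀ a, a ≠ p → a ≠ q → a ∉ (searchInit p q rr).arrays := by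
    intro a h h'; simp [searchInit, block, arrays, h, h']
  refine h1.seq_of (t' := 30 * (2 * m + n) + 1) (fun σ₁ ⟨h33, h34, h31, hpar, hQ⟩ hf₁ => ?_)
    (by simp [searchInit, cost, block]; omega)
  have hL₁ : Loaded G σ₁ := hL.congr (fun r _ h => hf₁.reg r (hregs r (by omega)))
    (fun a _ h => hf₁.mem a (harr a (by omega) (by omega)))
  have hb₁ : σ₁.mem b = σ.mem b := hf₁.mem b (harr b hbp hbq)
  have hregs' : ∀ x, x < 20 → x ∉
      (Program.ite (.eq 31 2) (searchAdvance q) (searchScan b p q)).regs := by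
    intro x hx; simp [searchAdvance, searchScan, block, regs]; omega
  have harr' : ∀ a, a ≠ p → a ≠ q → a ∉
      (Program.ite (.eq 31 2) (searchAdvance q) (searchScan b p q)).arrays := by
    intro a h h'; simp [searchAdvance, searchScan, block, arrays, h, h']
  have hcost : (Program.ite (.eq 31 2) (searchAdvance q) (searchScan b p q)).cost ≤ 28 := by
    simp [searchAdvance, searchScan, block, cost]
  have h2 := Meets.loop (B := B) (σ := σ₁) (t := 28) (b := .lt 33 34)
    (c := .ite (.eq 31 2) (searchAdvance q) (searchScan b p q))
    (fun ρ => ∃ vs, SearchInv G S r (ρ.mem p) (ρ.mem q) (ρ.reg 33) (ρ.reg 34) (ρ.reg 31) vs)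
    -- Advancing lowers the first term and does not raise the second; scanning a dart lowers the
    -- second and keeps the first. Hence the linear time.
    (fun ρ => (n - ρ.reg 33) + (unscanned G (ρ.mem q) (ρ.reg 33) (ρ.reg 31)).card) (by
      rintro ρ hf ⟨vs, hI⟩ hb
      have hlt : ρ.reg 33 < ρ.reg 34 := hb
      have hLρ : Loaded G ρ := hL₁.congr (fun r _ h => hf.reg r (hregs' r (by omega)))
        (fun a _ h => hf.mem a (harr' a (by omega) (by omega)))
      have hbρ : ρ.mem b = σ.mem b := (hf.mem b (harr' b hbp hbq)).trans hb₁
      have hn := hI.le_card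
      have hvs : ρ.reg 33 < vs.length := hI.len ▸ hlt
      refine (Meets.ite (b := .eq 31 2) (t := 27) (fun h0 => ?_) (fun h0 => ?_)).mono
        (by omega) fun _ => id
      · have h0' : ρ.reg 31 = 0 := h0.trans hLρ.reg2
        refine Meets.mono (Q := fun τ => τ.reg 33 = ρ.reg 33 + 1 ∧ τ.reg 34 = ρ.reg 34 ∧
          τ.reg 31 = ρ.mem 13 (ρ.mem q (ρ.reg 33 + 1)) ∧ τ.mem = ρ.mem)
          (Meets.of_pre (c := searchAdvance q) ?_) (by simp [searchAdvance, block, cost]) ?_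
        · simp [searchAdvance, block, pre, State.setReg_reg, State.setReg_mem, hLρ.reg3]
          omega
        · rintro τ ⟨e33, e34, e31, em⟩
          rw [e33, e34, e31, em]
          rw [h0'] at hI ⊢
          refine ⟨⟨vs, hI.advance hlt fun hi => ?_⟩, ?_⟩
          · rw [hI.queue _ hi, hLρ.first]
          · have := unscanned_advance (G := G) (ρ.mem q) (ρ.reg 33)
              (ρ.mem 13 (ρ.mem q (ρ.reg 33 + 1)))
            omega
      · have h0' : ρ.reg 31 ≠ 0 := fun h => h0 (h.trans hLρ.reg2.symm)
        obtain ⟨d, hd, ht⟩ := (hI.cur hvs).1.resolve_left h0'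
        rw [← hd] at hI
        have hmeas : ∀ Q' : ℕ → ℕ, (∀ a ≤ ρ.reg 33, Q' a = ρ.mem q a) →
            (unscanned G Q' (ρ.reg 33) (lastDart G (G.tail d) (code d - 1))).card <
              (unscanned G (ρ.mem q) (ρ.reg 33) (code d)).card := by
          intro Q' hQ'
          refine unscanned_next hQ' ?_ ?_ (lastDart_lt _ d)
          · rw [hI.queue _ hvs, ht]
          · intro a ha h
            rw [hI.queue a (by omega), ht] at h
            have := (hI.nodup.getElem_inj_iff).1 (Fin.ext h)
            omega
        refine Meets.mono (Q := fun τ => τ.reg 33 = ρ.reg 33 ∧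
          τ.reg 31 = lastDart G (G.tail d) (code d - 1) ∧
          (d ∈ S ∧ ρ.mem p (G.head d) = 0 ∧ τ.reg 34 = ρ.reg 34 + 1 ∧
            τ.mem p = Function.update (ρ.mem p) (G.head d) (code d) ∧
            τ.mem q = Function.update (ρ.mem q) (ρ.reg 34) (G.head d) ∨
          ¬ (d ∈ S ∧ ρ.mem p (G.head d) = 0) ∧ τ.reg 34 = ρ.reg 34 ∧
            τ.mem p = ρ.mem p ∧ τ.mem q = ρ.mem q))
          (Meets.of_pre (c := searchScan b p q) ?_) (by simp [searchScan, block, cost]) ?_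
        · by_cases hdS : σ.mem b (code d) = 0
          · by_cases hnew : ρ.mem p (G.head d) = 0
            · simp [searchScan, block, pre, State.setReg_reg, State.setReg_mem, State.setMem_reg,
                State.setMem_mem, hLρ.reg2, hLρ.reg3, ← hd, hLρ.head, hLρ.next, hbρ, hdS, hnew,
                Test.Holds, hpq, hpq.symm, show (12 : ℕ) ≠ p by omega, show (12 : ℕ) ≠ q by omega,
                hS]
              omega
            · simp [searchScan, block, pre, State.setReg_reg, State.setReg_mem, State.setMem_reg,
                State.setMem_mem, hLρ.reg2, hLρ.reg3, ← hd, hLρ.head, hLρ.next, hbρ, hdS, hnew,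
                Test.Holds]
          · simp [searchScan, block, pre, State.setReg_reg, State.setReg_mem,
              hLρ.reg2, ← hd, hLρ.next, hbρ, hdS, Test.Holds, hS]
        · rintro τ ⟨e33, e31, ⟨hdS, hnew, e34, ep, eq⟩ | ⟨hno, e34, ep, eq⟩⟩
          · rw [e33, e34, e31, ep, eq, ← hd]
            refine ⟨⟨_, (hI.visit hlt hdS hnew).next fun _ => by simp⟩, ?_⟩
            -- The new node is stored behind position `i`, where the measure does not look.
            have := hmeas (Function.update (ρ.mem q) (ρ.reg 34) (G.head d))
              (fun a ha => Function.update_of_ne (by omega) _ _)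
            omega
          · rw [e33, e34, e31, ep, eq, ← hd]
            refine ⟨⟨_, hI.next fun hdS => (hI.visited _).1 fun h => hno ⟨hdS, h⟩⟩, ?_⟩
            have := hmeas _ (fun a _ => rfl)
            omega)
    ⟨[r], by
      rw [h33, h34, h31, hpar]
      refine SearchInv.of_root (by simp) (fun v hv => ?_) hQ
      rw [Function.update_of_ne fun h => hv (Fin.ext h)]⟩
  refine h2.mono ?_ ?_
  · have : (unscanned G (σ₁.mem q) (σ₁.reg 33) (σ₁.reg 31)).card ≤ 2 * m := by
      refine (Finset.card_le_univ _).trans ?_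
      simp [Fintype.card_prod, mul_comm]
    have : (28 + 1) * (n - σ₁.reg 33 + (unscanned G (σ₁.mem q) (σ₁.reg 33) (σ₁.reg 31)).card) ≤
        (28 + 1) * (n + 2 * m) := Nat.mul_le_mul_left _ (by omega)
    omega
  · rintro τ ⟨⟨vs, hI⟩, hb⟩
    exact hI.searched hb

end

/-! ### Walking along a path of the search tree -/

section

open scoped Classical
open Program

variable {n m : ℕ} {G : Multigraph n m} {B : ℕ} {σ : State}

theorem Meets.while_true {b : Test} {c : Program} {t t' : ℕ} {Q : State → Prop} (hb : b.Holds σ)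
    (h : Meets B c σ t fun τ => Meets B (.while b c) τ t' Q) :
    Meets B (.while b c) σ (1 + t + t') Q := by
  obtain ⟨T, τ, h₁, h₂, T', ρ, h₃, h₄, h₅⟩ := h
  exact ⟨1 + T + T', ρ, .while_true hb h₁ h₃, by omega, h₅⟩

theorem Frame.weaken {c c' : Program} {σ τ : State} (h : Frame c σ τ)
    (hr : ∀ r, r ∈ c.regs → r ∈ c'.regs) (ha : ∀ a, a ∈ c.arrays → a ∈ c'.arrays) :
    Frame c' σ τ :=
  ⟨fun r h' => h.reg r fun h'' => h' (hr r h''), fun a h' => h.mem a fun h'' => h' (ha a h'')⟩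

namespace Program

def traceStep (p : ℕ) (body : Program) : Program :=
  .seq body (.seq (load 20 8 21) (load 21 p 20))

/-- Walk from the node in register `s` to the root of the search tree in the array `p`, and execute
`body` for each dart on the way; the dart is in register `21`, and its head in register `20`. -/
def trace (p s : ℕ) (body : Program) : Program :=
  .seq (.seq (copy 20 s) (load 21 p 20))
    (.ite (.eq 21 2) skip (.while (.lt 21 5) (traceStep p body)))

end Program

/-- The body of `trace` does not interfere with the walk. -/
structure Harmless (p : ℕ) (body : Program) : Prop where
  reg : ∀ r ∈ body.regs, 5 < r ∧ r ≠ 20 ∧ r ≠ 21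
  mem : ∀ a ∈ body.arrays, a ≠ p ∧ (a < 8 ∨ 13 < a)

/-- `J` is indexed by the part of the path already walked. The quantifier over `τ'` makes it survive
the updates of registers `20` and `21` by the walk itself. -/
theorem trace_of_reach {p s t : ℕ} {body : Program} {r v : Fin n} {l : List (Dart m)}
    (hL : Loaded G σ) (hl : G.BackPath r v l)
    (hpar : ∀ d ∈ l, σ.mem p (G.head d) = code d) (hroot : σ.mem p r = 2 * m + 1)
    (hv : σ.reg s = v) (hb : Harmless p body) (J : List (Dart m) → State → Prop)
    (hJ : ∀ τ, (∀ r, r ≠ 20 → r ≠ 21 → τ.reg r = σ.reg r) → τ.mem = σ.mem → J [] τ)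
    (hbody : ∀ pre d post ρ, l = pre ++ d :: post → Loaded G ρ → Frame (trace p s body) σ ρ →
      J pre ρ → ρ.reg 20 = G.head d → ρ.reg 21 = code d →
      Meets B body ρ t fun τ => ∀ τ', (∀ r, r ≠ 20 → r ≠ 21 → τ'.reg r = τ.reg r) →
        τ'.mem = τ.mem → J (pre ++ [d]) τ') :
    Meets B (trace p s body) σ ((t + 3) * l.length + 4) fun τ => J l τ ∧ τ.reg 20 = r := by
  have hloop : ∀ post pre ρ w, l = pre ++ post → Loaded G ρ → Frame (trace p s body) σ ρ →
      J pre ρ → G.BackPath r w post → ρ.reg 20 = w → ρ.reg 21 = σ.mem p w →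
      Meets B (.while (.lt 21 5) (traceStep p body)) ρ ((t + 3) * post.length + 1)
        fun τ => J l τ ∧ τ.reg 20 = r := by
    intro post
    induction post with
    | nil =>
      intro pre ρ w hpre hLρ hf hJρ hw h20 h21
      cases hw
      refine ⟨1, ρ, .while_false ?_, by simp, by simpa [hpre] using hJρ, h20⟩
      intro h
      have : ρ.reg 21 < ρ.reg 5 := h
      rw [hLρ.reg5, h21, hroot] at this
      omega
    | cons d post ih =>
      intro pre ρ w hpre hLρ hf hJρ hw h20 h21
      obtain ⟨rfl, hw⟩ := hw
      have hdl : d ∈ l := by simp [hpre]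
      rw [hpar d hdl] at h21
      have hb' : (Test.lt 21 5).Holds ρ := by
        have := code_le d
        change ρ.reg 21 < ρ.reg 5
        rw [hLρ.reg5, h21]
        omega
      refine (Meets.while_true hb' (t := t + 2) (t' := (t + 3) * post.length + 1)
        ?_).mono (by simp only [List.length_cons]; rw [mul_add]; omega) fun _ => id
      have hp_not : p ∉ (trace p s body).arrays := by
        intro h
        simp [trace, traceStep, arrays] at h
        exact (hb.mem p h).1 rfl
      refine (hbody pre d post ρ hpre hLρ hf hJρ h20 h21).seq_of (t' := 2)
        (fun τ hτ hfτ => ?_) le_rfl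
      have hf' : Frame (trace p s body) ρ τ := hfτ.weaken
        (fun r hr => by simp [trace, traceStep, regs, hr])
        (fun a ha => by simp [trace, traceStep, arrays, ha])
      have h21' : τ.reg 21 = code d := by
        rw [hfτ.reg 21 fun h => (hb.reg 21 h).2.2 rfl, h21]
      have h8 : τ.mem 8 = ρ.mem 8 := hfτ.mem 8 fun h => by have := (hb.mem 8 h).2; omega
      have hp : τ.mem p = σ.mem p := (hf.trans hf').mem p hp_not
      have hstep : Meets B (.seq (load 20 8 21) (load 21 p 20)) τ 2 fun τ' =>
          (∀ r, r ≠ 20 → r ≠ 21 → τ'.reg r = τ.reg r) ∧ τ'.mem = τ.mem ∧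
          τ'.reg 20 = G.tail d ∧ τ'.reg 21 = σ.mem p (G.tail d) := by
        refine Meets.of_pre (c := .seq (load 20 8 21) (load 21 p 20)) ?_
        simp only [Program.pre, State.setReg_reg, State.setReg_mem, h21', h8, hLρ.tail, hp]
        refine ⟨fun r h₁ h₂ => by simp [h₁, h₂], trivial, by simp, by simp⟩
      refine hstep.frame.mono le_rfl ?_
      rintro τ' ⟨⟨e₁, e₂, e20, e21⟩, hfτ'⟩
      have hf'' : Frame (trace p s body) τ τ' := hfτ'.weaken
        (fun r hr => by
          simp only [regs, List.mem_append, List.mem_singleton] at hr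
          simp [trace, traceStep, regs]; tauto)
        (fun a ha => by simp [arrays] at ha)
      have hfull := (hf.trans hf').trans hf''
      refine ih (pre ++ [d]) τ' _ (by simp [hpre]) ?_ hfull (hτ τ' e₁ e₂) hw e20 e21
      refine hLρ.congr (fun r h₁ h₂ => ?_) (fun a h₁ h₂ => ?_)
      · rw [e₁ r (by omega) (by omega), hfτ.reg r fun h => by have := (hb.reg r h).1; omega]
      · rw [e₂, hfτ.mem a fun h => by have := (hb.mem a h).2; omega]
  have hinit : Meets B (.seq (copy 20 s) (load 21 p 20)) σ 2 fun τ =>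
      (∀ r, r ≠ 20 → r ≠ 21 → τ.reg r = σ.reg r) ∧ τ.mem = σ.mem ∧
      τ.reg 20 = v ∧ τ.reg 21 = σ.mem p v := by
    refine Meets.of_pre (c := .seq (copy 20 s) (load 21 p 20)) ?_
    simp only [pre, State.setReg_reg, State.setReg_mem, hv]
    refine ⟨fun r h₁ h₂ => by simp [h₁, h₂], trivial, by simp, by simp⟩
  refine hinit.seq_of (t' := 1 + ((t + 3) * l.length + 1)) (fun τ ⟨e₁, e₂, e20, e21⟩ hf => ?_)
    (by omega)
  have hLτ : Loaded G τ := hL.congr (fun r _ _ => e₁ r (by omega) (by omega))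
    (fun a _ _ => by rw [e₂])
  have hne : τ.reg 21 ≠ 0 := by
    rw [e21]
    cases l with
    | nil => cases hl; rw [hroot]; omega
    | cons d l =>
      obtain ⟨rfl, -⟩ := hl
      rw [hpar d (by simp)]
      exact code_ne_zero d
  refine Meets.ite (fun h => absurd (h.trans hLτ.reg2) hne) fun _ => ?_
  refine hloop l [] τ v rfl hLτ (hf.weaken (fun r hr => ?_) (fun a ha => ?_)) (hJ τ e₁ e₂) hl
    e20 e21
  · simp only [regs, List.mem_append, List.mem_singleton] at hr
    simp [trace, traceStep, regs]; tauto
  · simp [arrays] at ha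

/-- An unvisited start has entry `0`, so the walk does not begin. This case bounds the time on
infeasible instances. -/
theorem trace_of_not_reach {p s t : ℕ} {body : Program} (h2 : σ.reg 2 = 0)
    (hv : σ.mem p (σ.reg s) = 0) (ht : 4 ≤ t) :
    Meets B (trace p s body) σ t fun τ =>
      (∀ r, r ≠ 20 → r ≠ 21 → τ.reg r = σ.reg r) ∧ τ.mem = σ.mem ∧ τ.reg 20 = σ.reg s := by
  have hinit : Meets B (.seq (copy 20 s) (load 21 p 20)) σ 2 fun τ =>
      (∀ r, r ≠ 20 → r ≠ 21 → τ.reg r = σ.reg r) ∧ τ.mem = σ.mem ∧ τ.reg 20 = σ.reg s ∧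
        τ.reg 21 = 0 := by
    refine Meets.of_pre (c := .seq (copy 20 s) (load 21 p 20)) ?_
    simp only [pre, State.setReg_reg, State.setReg_mem]
    refine ⟨fun r h₁ h₂ => by simp [h₁, h₂], trivial, by simp, by simp [hv]⟩
  refine hinit.seq_of (t' := 2) (fun τ ⟨e₁, e₂, e20, e21⟩ _ => ?_) (by omega)
  refine Meets.ite (t := 1) (fun _ => ⟨1, τ, .skip _, le_rfl, e₁, e₂, e20⟩) fun h => absurd ?_ h
  exact e21.trans ((e₁ 2 (by decide) (by decide)).trans h2).symm

end

/-! ### Routing the three pairs one after another -/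

section

open scoped Classical
open Program Multigraph

variable {n m : ℕ} {G : Multigraph n m} {B : ℕ} {σ : State}

/-- The array `f` is the indicator function of the darts of the edges in `F`. -/
def Marks (f : ℕ → ℕ) (F : Finset (Fin m)) : Prop :=
  ∀ d : Dart m, f (code d) = if d.1 ∈ F then 1 else 0

theorem eq_or_eq_rev {d d' : Dart m} (h : d'.1 = d.1) : d' = d ∨ d' = rev d := by
  rcases d with ⟨e, b⟩
  rcases d' with ⟨e', b'⟩
  obtain rfl : e' = e := h
  cases b <;> cases b' <;> simp [rev]

theorem rev_ne (d : Dart m) : rev d ≠ d := by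
  rcases d with ⟨e, b⟩
  simp [rev]

theorem Marks.insert {f : ℕ → ℕ} {F : Finset (Fin m)} (h : Marks f F) (d : Dart m) :
    Marks (Function.update (Function.update f (code d) 1) (code (rev d)) 1) (insert d.1 F) := by
  intro d'
  by_cases hd : d'.1 = d.1
  · rw [if_pos (by simp [hd])]
    rcases eq_or_eq_rev hd with rfl | rfl
    · rw [Function.update_of_ne fun h => rev_ne _ (code_injective h.symm), Function.update_self]
    · rw [Function.update_self]
  · rw [Function.update_of_ne, Function.update_of_ne, h d']
    · simp [hd]
    · exact fun h => hd (congrArg Prod.fst (code_injective h))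
    · intro h
      rw [code_injective h] at hd
      exact hd rfl

theorem edges_append_singleton (l : List (Dart m)) (d : Dart m) :
    edges (l ++ [d]) = insert d.1 (edges l) := by
  ext e
  simp [edges, eq_comm]

theorem Marks.setOf {f : ℕ → ℕ} {F : Finset (Fin m)} (h : Marks f F) :
    {d : Dart m | f (code d) = 0} = along Fᶜ := by
  ext d
  simp [along, h d]

namespace Program

/-- Mark the edge of the current dart in the array `b`, and append it to the output array `i`. -/
def emit (b i : ℕ) : Program := block
  [store b 21 3, load 22 10 21, store b 22 3, load 23 11 21, store (5 + i) 24 23, add 24 24 3]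

/-- Search for a path from the node in register `s` to the node in register `r` along the darts not
marked in the array `b`, output it as path number `i`, and mark its edges in the array `b'`. -/
def route (b b' p q s r i : ℕ) : Program := block
  [search b p q r, copy 24 2, trace p s (emit b' i), const 25 i, store 4 25 24]

end Program

theorem emit_spec {b i : ℕ} {d : Dart m} (hL : Loaded G σ) (hb : 20 ≤ b) (hi : i < 3)
    (hd : σ.reg 21 = code d) (hB : σ.reg 24 + 1 < B) :
    Meets B (emit b i) σ 7 fun τ => τ.reg 24 = σ.reg 24 + 1 ∧
      τ.mem b = Function.update (Function.update (σ.mem b) (code d) 1) (code (rev d)) 1 ∧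
      τ.mem (5 + i) = Function.update (σ.mem (5 + i)) (σ.reg 24) d.1 := by
  refine Meets.of_pre (c := emit b i) ?_
  simp [emit, block, Program.pre, State.setReg_reg, State.setReg_mem, State.setMem_reg,
    State.setMem_mem, hL.reg3, hd, hL.rev, hL.edge, show (10 : ℕ) ≠ b by omega,
    show (11 : ℕ) ≠ b by omega, show b ≠ 5 + i by omega, show 5 + i ≠ b by omega, hB]

theorem mem_regs_search {b p q r x : ℕ} (h : x ∈ (search b p q r).regs) : 30 ≤ x := by
  simp [search, searchInit, searchAdvance, searchScan, block, regs] at h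
  omega

theorem mem_arrays_search {b p q r a : ℕ} (h : a ∈ (search b p q r).arrays) : a = p ∨ a = q := by
  simp [search, searchInit, searchAdvance, searchScan, block, arrays] at h
  tauto

theorem mem_regs_trace {p s x : ℕ} {c : Program} (h : x ∈ (trace p s c).regs) :
    x = 20 ∨ x = 21 ∨ x ∈ c.regs := by
  simp [trace, traceStep, regs] at h
  tauto

theorem mem_arrays_trace {p s a : ℕ} {c : Program} (h : a ∈ (trace p s c).arrays) :
    a ∈ c.arrays := by
  simpa [trace, traceStep, arrays] using h

theorem mem_arrays_emit {b i a : ℕ} (h : a ∈ (emit b i).arrays) : a = b ∨ a = 5 + i := by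
  simp [emit, block, arrays] at h
  tauto

theorem mem_regs_emit {b i x : ℕ} (h : x ∈ (emit b i).regs) : 22 ≤ x ∧ x ≤ 24 := by
  simp [emit, block, regs] at h
  omega

theorem mem_regs_route {b b' p q s r i x : ℕ} (h : x ∈ (route b b' p q s r i).regs) : 20 ≤ x := by
  simp only [route, block, regs, List.mem_append, List.mem_singleton, List.not_mem_nil,
    or_false] at h
  rcases h with h | h | h | h
  · have := mem_regs_search h; omega
  · omega
  · rcases mem_regs_trace h with h | h | h
    · omega
    · omega
    · have := mem_regs_emit h; omega
  · omega

theorem mem_arrays_route {b b' p q s r i a : ℕ} (h : a ∈ (route b b' p q s r i).arrays) :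
    a = p ∨ a = q ∨ a = b' ∨ a = 5 + i ∨ a = 4 := by
  simp only [route, block, arrays, List.mem_append, List.mem_singleton, List.not_mem_nil,
    or_false, false_or] at h
  rcases h with h | h | h
  · have := mem_arrays_search h; tauto
  · have := mem_arrays_emit (mem_arrays_trace h); tauto
  · tauto

/-- The arrays `5 + i` and `4` display the edges of `l` as path number `i`. -/
def Shows (σ : State) (i : ℕ) (l : List (Dart m)) : Prop :=
  σ.mem 4 i = l.length ∧ ∀ (j : ℕ) (hj : j < l.length), σ.mem (5 + i) j = (l[j].1 : ℕ)

/-- The arrays `b` and `b'` may coincide, since the search is over before anything is marked. The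
first clause is what `answer` tests. -/
theorem route_spec {b b' p q s rr i : ℕ} {u r : Fin n} {F : Finset (Fin m)} (hL : Loaded G σ)
    (hB : 2 * m + n + 3 ≤ B) (hr : σ.reg rr = r) (hu : σ.reg s = u) (hp0 : σ.mem p = fun _ => 0)
    (hF : Marks (σ.mem b') F)
    (hp : 20 ≤ p) (hq : 20 ≤ q) (hpq : p ≠ q) (hbp : b ≠ p) (hbq : b ≠ q) (hb : 20 ≤ b')
    (hbp' : b' ≠ p) (hbq' : b' ≠ q) (hrr : rr < 20) (hs : s < 20) (hi : i < 3) :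
    Meets B (route b b' p q s rr i) σ (60 * m + 40 * n + 20) fun τ =>
      (τ.mem p u ≠ 0 ↔ G.Reach {d | σ.mem b (code d) = 0} r u) ∧
      (∀ x, x ≠ i → τ.mem 4 x = σ.mem 4 x) ∧
      (G.Reach {d | σ.mem b (code d) = 0} r u → ∃ l, G.SimplePath r u l ∧
        (∀ d ∈ l, σ.mem b (code d) = 0) ∧ Shows τ i l ∧ Marks (τ.mem b') (F ∪ edges l)) ∧
      (¬ G.Reach {d | σ.mem b (code d) = 0} r u → Marks (τ.mem b') F) := by
  refine (search_spec (b := b) (q := q) hL hB hr hp0 hp hq hpq hbp hbq hrr).seq_of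
    (t' := 10 * n + 9) (fun σ₁ hS hf₁ => ?_) (by omega)
  refine Meets.seq_of (t := 1) (t' := 10 * n + 8)
    (Q := fun τ => τ.reg 24 = 0 ∧ (∀ r, r ≠ 24 → τ.reg r = σ₁.reg r) ∧ τ.mem = σ₁.mem) ?_
    (fun σ₂ ⟨e24, er, em⟩ hf₂ => ?_) (by omega)
  · refine Meets.of_pre (c := copy 24 2) ?_
    have : σ₁.reg 2 = 0 := (hf₁.reg 2 fun h => by have := mem_regs_search h; omega).trans hL.reg2
    simp only [Program.pre, State.setReg_reg, State.setReg_mem, this]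
    exact ⟨by simp, fun r h => by simp [h], trivial⟩
  have hL₂ : Loaded G σ₂ := hL.congr
    (fun r _ h => (er r (by omega)).trans
      (hf₁.reg r fun h => by have := mem_regs_search h; omega))
    (fun a _ h => by
      rw [em]
      exact hf₁.mem a fun h => by have := mem_arrays_search h; omega)
  have hu₂ : σ₂.reg s = u := by
    rw [er s (by omega), hf₁.reg s fun h => by have := mem_regs_search h; omega, hu]
  have hb₂ : σ₂.mem b' = σ.mem b' := by
    rw [em, hf₁.mem b' fun h => by have := mem_arrays_search h; tauto]
  have h4 : σ₂.mem 4 = σ.mem 4 := by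
    rw [em, hf₁.mem 4 fun h => by have := mem_arrays_search h; omega]
  have hend : ∀ ρ : State, Meets B (block [const 25 i, store 4 25 24]) ρ 3 fun τ =>
      (∀ a, a ≠ 4 → τ.mem a = ρ.mem a) ∧ τ.mem 4 = Function.update (ρ.mem 4) i (ρ.reg 24) := by
    intro ρ
    refine Meets.of_pre (c := block [const 25 i, store 4 25 24]) ?_
    simp [block, Program.pre, State.setReg_reg, State.setReg_mem, State.setMem_mem]
    exact ⟨by omega, fun a ha => by simp [ha]⟩
  have hcell : ∀ τ ρ : State, τ.mem 4 = Function.update (ρ.mem 4) i (ρ.reg 24) →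
      ρ.mem 4 = σ.mem 4 → ∀ x, x ≠ i → τ.mem 4 x = σ.mem 4 x := by
    intro τ ρ h h' x hx
    rw [h, Function.update_of_ne hx, h']
  by_cases hreach : G.Reach {d | σ.mem b (code d) = 0} r u
  · obtain ⟨l, hl, hlS⟩ := hS.path u hreach
    have hlen := hl.length_le
    have hharm : Harmless p (emit b' i) :=
      ⟨fun r h => by have := mem_regs_emit h; omega,
        fun a h => by rcases mem_arrays_emit h with rfl | rfl <;> omega⟩
    have htr := trace_of_reach (B := B) (t := 7) (s := s) (body := emit b' i) hL₂ hl.1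
      (fun d hd => by rw [em]; exact (hlS d hd).2) (by rw [em]; exact hS.root) hu₂ hharm
      (fun done ρ => Marks (ρ.mem b') (F ∪ edges done) ∧ ρ.reg 24 = done.length ∧
        ∀ (j : ℕ) (hj : j < done.length), ρ.mem (5 + i) j = (done[j].1 : ℕ))
      (fun τ hτ hτ' => ⟨by rw [hτ', hb₂]; simpa [edges] using hF,
        by rw [hτ 24 (by decide) (by decide), e24]; rfl, fun j hj => absurd hj (by simp)⟩)
      (fun pre d post ρ hpre hLρ hfρ ⟨hJ₁, hJ₂, hJ₃⟩ _ h21 => by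
        refine (emit_spec hLρ hb hi h21 ?_).mono le_rfl ?_
        · have : pre.length < l.length := by simp [hpre]
          omega
        · rintro τ ⟨e24, eb, eo⟩ τ' hr' hm'
          refine ⟨?_, ?_, fun j hj => ?_⟩
          · rw [hm', eb, edges_append_singleton, Finset.union_insert]
            exact hJ₁.insert d
          · rw [hr' 24 (by decide) (by decide), e24, hJ₂]
            simp
          · rw [hm', eo, hJ₂]
            rw [List.length_append, List.length_singleton] at hj
            rcases Nat.lt_succ_iff_lt_or_eq.1 hj with hj | rfl
            · rw [Function.update_of_ne (by omega), hJ₃ j hj, List.getElem_append_left hj]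
            · rw [Function.update_self]
              simp)
    refine htr.seq_of (t' := 3) (fun σ₃ ⟨⟨hM, h24, ho⟩, _⟩ hf₃ => ?_) (by omega)
    have h4₃ : σ₃.mem 4 = σ.mem 4 := by
      rw [hf₃.mem 4 fun h => by have := mem_arrays_emit (mem_arrays_trace h); omega, h4]
    have hp₃ : σ₃.mem p = σ₁.mem p := by
      rw [hf₃.mem p fun h => by have := mem_arrays_emit (mem_arrays_trace h); omega, em]
    refine (hend σ₃).mono le_rfl fun τ ⟨e, e4⟩ => ⟨?_, hcell τ σ₃ e4 h4₃, fun _ => ?_,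
      fun h => absurd hreach h⟩
    · rw [e p (by omega), hp₃]
      exact hS.reach u
    · refine ⟨l, hl, fun d hd => (hlS d hd).1, ⟨?_, ?_⟩, ?_⟩
      · rw [e4, Function.update_self, h24]
      · rw [e _ (by omega)]; exact ho
      · rw [e b' (by omega)]; exact hM
  · have h0 : σ₁.mem p u = 0 := by
      by_contra h
      exact hreach ((hS.reach u).1 h)
    refine (trace_of_not_reach (t := 10 * n + 4) hL₂.reg2 (by rw [em, hu₂, h0])
      (by omega)).seq_of (t' := 3) (fun σ₃ ⟨_, hm₃, _⟩ hf₃ => ?_) (by omega)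
    refine (hend σ₃).mono le_rfl fun τ ⟨e, e4⟩ =>
      ⟨?_, hcell τ σ₃ e4 (by rw [hm₃, h4]), fun h => absurd h hreach, fun _ => ?_⟩
    · rw [e p (by omega), hm₃, em]
      exact hS.reach u
    · rw [e b' (by omega), hm₃, hb₂]
      exact hF

end

/-! ### The last pair by parity, and the answer -/

section

open scoped Classical
open Program Multigraph

variable {n m : ℕ} {G : Multigraph n m} {H : Multigraph n 3} {B : ℕ} {σ : State}

/-- Once the second and the third pair are routed, the first pair is connected, by parity. -/
theorem Multigraph.Eulerian.reach_last (hE : G.Eulerian H) {l₂ l₃ : List (Dart m)}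
    (h₃ : G.SimplePath (H.snd 2) (H.fst 2) l₃) (h₂ : G.SimplePath (H.snd 1) (H.fst 1) l₂)
    (hd : ∀ d ∈ l₂, d.1 ∉ edges l₃) :
    G.Reach (along (edges l₃ ∪ edges l₂)ᶜ) (H.snd 0) (H.fst 0) := by
  have hc : (edges l₃ ∪ edges l₂)ᶜ = (Finset.univ \ edges l₃) \ edges l₂ := by
    ext e; simp
  rw [hc]
  refine reach_of_bd fun w => ?_
  rw [bd_ind_sdiff, bd_ind_sdiff (Finset.subset_univ _), hE.bd_univ, h₂.bd_ind, h₃.bd_ind,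
    Fin.sum_univ_three]
  · linear_combination (pt (H.fst 1) w + pt (H.snd 1) w + pt (H.fst 2) w + pt (H.snd 2) w) *
      CharTwo.two_eq_zero (R := ZMod 2)
  · intro e he
    obtain ⟨d, hd', rfl⟩ := mem_edges.1 he
    simpa using hd d hd'

namespace Program

def answer : Program := block
  [load 22 40 8, load 23 42 7, load 26 44 6,
    ite (.eq 22 2) (const 0 0) (ite (.eq 23 2) (const 0 0) (ite (.eq 26 2) (const 0 0) (const 0 1)))]

/-- Route the third pair along darts not marked in the array `23`, then the second pair, then the
first, and report whether this succeeded. -/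
def finish : Program := block
  [route 23 24 40 41 8 11 2, route 24 24 42 43 7 10 1, route 24 24 44 45 6 9 0, answer]

end Program

theorem answer_spec (h2 : σ.reg 2 = 0) (hB : 2 ≤ B) :
    Meets B answer σ 20 fun τ => τ.mem = σ.mem ∧
      τ.reg 0 = if σ.mem 40 (σ.reg 8) ≠ 0 ∧ σ.mem 42 (σ.reg 7) ≠ 0 ∧ σ.mem 44 (σ.reg 6) ≠ 0
        then 1 else 0 := by
  refine (Meets.of_pre (c := answer) ?_).mono (by simp [answer, block, cost]) fun _ => id
  by_cases h₁ : σ.mem 40 (σ.reg 8) = 0 <;> by_cases h₂ : σ.mem 42 (σ.reg 7) = 0 <;>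
    by_cases h₃ : σ.mem 44 (σ.reg 6) = 0 <;>
    simp [answer, block, Program.pre, State.setReg_reg, State.setReg_mem, Test.Holds, h2, h₁, h₂,
      h₃] <;> omega

theorem Shows.congr {τ : State} {i : ℕ} {l : List (Dart m)} (h : Shows σ i l)
    (h4 : τ.mem 4 i = σ.mem 4 i) (h5 : τ.mem (5 + i) = σ.mem (5 + i)) : Shows τ i l := by
  unfold Shows
  rw [h4, h5]
  exact h

theorem isSolution_of_paths {l₁ l₂ l₃ : List (Dart m)}
    (h₁ : G.SimplePath (H.snd 0) (H.fst 0) l₁) (h₂ : G.SimplePath (H.snd 1) (H.fst 1) l₂)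
    (h₃ : G.SimplePath (H.snd 2) (H.fst 2) l₃) (h₃₂ : ∀ d ∈ l₂, d.1 ∉ edges l₃)
    (h₃₁ : ∀ d ∈ l₁, d.1 ∉ edges l₃ ∪ edges l₂) (hs₁ : Shows σ 0 l₁) (hs₂ : Shows σ 1 l₂)
    (hs₃ : Shows σ 2 l₃) : ∃ P : Fin 3 → List (Fin m), G.IsSolution H P ∧ Displays σ P := by
  refine ⟨![l₁.map Prod.fst, l₂.map Prod.fst, l₃.map Prod.fst], ⟨fun i => ?_, ?_⟩, fun i => ?_⟩
  · fin_cases i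
    · exact h₁.isPath
    · exact h₂.isPath
    · exact h₃.isPath
  · have d₁₂ : List.Disjoint (l₁.map Prod.fst) (l₂.map Prod.fst) := by
      intro e he he'
      obtain ⟨d, hd, rfl⟩ := List.mem_map.1 he
      exact h₃₁ d hd (Finset.mem_union_right _ (by simpa [edges] using he'))
    have d₁₃ : List.Disjoint (l₁.map Prod.fst) (l₃.map Prod.fst) := by
      intro e he he'
      obtain ⟨d, hd, rfl⟩ := List.mem_map.1 he
      exact h₃₁ d hd (Finset.mem_union_left _ (by simpa [edges] using he'))
    have d₂₃ : List.Disjoint (l₂.map Prod.fst) (l₃.map Prod.fst) := by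
      intro e he he'
      obtain ⟨d, hd, rfl⟩ := List.mem_map.1 he
      exact h₃₂ d hd (by simpa [edges] using he')
    intro i j hij
    fin_cases i <;> fin_cases j <;> first | exact absurd rfl hij | skip
    · exact d₁₂
    · exact d₁₃
    · exact d₁₂.symm
    · exact d₂₃
    · exact d₁₃.symm
    · exact d₂₃.symm
  · fin_cases i
    · exact ⟨by simpa using hs₁.1, fun j hj => by simpa using hs₁.2 j (by simpa using hj)⟩
    · exact ⟨by simpa using hs₂.1, fun j hj => by simpa using hs₂.2 j (by simpa using hj)⟩
    · exact ⟨by simpa using hs₃.1, fun j hj => by simpa using hs₃.2 j (by simpa using hj)⟩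

theorem finish_spec (hL : Loaded G σ) (hT : Terminals H σ) (hB : 2 * m + n + 3 ≤ B)
    (h24 : σ.mem 24 = fun _ => 0) (h40 : σ.mem 40 = fun _ => 0) (h42 : σ.mem 42 = fun _ => 0)
    (h44 : σ.mem 44 = fun _ => 0) :
    Meets B finish σ (180 * m + 120 * n + 90) fun τ =>
      (τ.reg 0 = 1 ∧ ∃ P : Fin 3 → List (Fin m), G.IsSolution H P ∧ Displays τ P) ∨
      (τ.reg 0 = 0 ∧ ∀ E : Finset (Fin m), {d : Dart m | σ.mem 23 (code d) = 0} = along E →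
        G.Eulerian H → G.Reach (along E) (H.snd 2) (H.fst 2) →
        G.Reach (along Eᶜ) (H.snd 1) (H.fst 1) → False) := by
  have hstep : ∀ {b p q s r i : ℕ} {ρ τ : State}, Frame (route b 24 p q s r i) ρ τ →
      20 ≤ p → 20 ≤ q → i < 3 → Loaded G ρ → Terminals H ρ → Loaded G τ ∧ Terminals H τ := by
    intro b p q s r i ρ τ hf hp hq hi hL hT
    refine ⟨hL.congr (fun x _ h => hf.reg x fun h' => ?_) (fun a _ h => hf.mem a fun h' => ?_),
      hT.congr fun x _ h => hf.reg x fun h' => ?_⟩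
    · have := mem_regs_route h'; omega
    · have := mem_arrays_route h'; omega
    · have := mem_regs_route h'; omega
  have hM : Marks (σ.mem 24) (∅ : Finset (Fin m)) := by
    intro d; simp [h24]
  refine (route_spec (b := 23) (b' := 24) (p := 40) (q := 41) (i := 2) hL hB hT.t₃ hT.s₃ h40 hM
    (by decide) (by decide) (by decide) (by decide) (by decide) (by decide) (by decide)
    (by decide) (by decide) (by decide) (by decide)).seq_of (t' := 120 * m + 80 * n + 65)
    (fun σ₁ ⟨p₁, c₁, y₁, n₁⟩ f₁ => ?_) (by omega)
  obtain ⟨hL₁, hT₁⟩ := hstep f₁ (by decide) (by decide) (by decide) hL hT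
  -- The next routing needs some marked set of edges, whether or not this one succeeded.
  obtain ⟨F₁, hM₁⟩ : ∃ F₁, Marks (σ₁.mem 24) (F₁ : Finset (Fin m)) := by
    by_cases h : G.Reach {d | σ.mem 23 (code d) = 0} (H.snd 2) (H.fst 2)
    · obtain ⟨l, -, -, -, h⟩ := y₁ h; exact ⟨_, h⟩
    · exact ⟨_, n₁ h⟩
  have h42₁ : σ₁.mem 42 = fun _ => 0 := by
    rw [f₁.mem 42 fun h => by have := mem_arrays_route h; omega, h42]
  refine (route_spec (b := 24) (b' := 24) (p := 42) (q := 43) (i := 1) hL₁ hB hT₁.t₂ hT₁.s₂ h42₁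
    hM₁ (by decide) (by decide) (by decide) (by decide) (by decide) (by decide) (by decide)
    (by decide) (by decide) (by decide) (by decide)).seq_of (t' := 60 * m + 40 * n + 45)
    (fun σ₂ ⟨p₂, c₂, y₂, n₂⟩ f₂ => ?_) (by omega)
  obtain ⟨hL₂, hT₂⟩ := hstep f₂ (by decide) (by decide) (by decide) hL₁ hT₁
  obtain ⟨F₂, hM₂⟩ : ∃ F₂, Marks (σ₂.mem 24) (F₂ : Finset (Fin m)) := by
    by_cases h : G.Reach {d | σ₁.mem 24 (code d) = 0} (H.snd 1) (H.fst 1)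
    · obtain ⟨l, -, -, -, h⟩ := y₂ h; exact ⟨_, h⟩
    · exact ⟨_, n₂ h⟩
  have h44₂ : σ₂.mem 44 = fun _ => 0 := by
    rw [f₂.mem 44 fun h => by have := mem_arrays_route h; omega,
      f₁.mem 44 fun h => by have := mem_arrays_route h; omega, h44]
  refine (route_spec (b := 24) (b' := 24) (p := 44) (q := 45) (i := 0) hL₂ hB hT₂.t₁ hT₂.s₁ h44₂
    hM₂ (by decide) (by decide) (by decide) (by decide) (by decide) (by decide) (by decide)
    (by decide) (by decide) (by decide) (by decide)).seq_of (t' := 21)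
    (fun σ₃ ⟨p₃, c₃, y₃, n₃⟩ f₃ => ?_) (by omega)
  obtain ⟨hL₃, hT₃⟩ := hstep f₃ (by decide) (by decide) (by decide) hL₂ hT₂
  refine (answer_spec hL₃.reg2 (by omega)).seq_of (t' := 1) (fun τ ⟨em, e0⟩ _ =>
    ⟨1, τ, .skip _, le_rfl, ?_⟩) le_rfl
  have e40 : σ₃.mem 40 = σ₁.mem 40 := by
    rw [f₃.mem 40 fun h => by have := mem_arrays_route h; omega,
      f₂.mem 40 fun h => by have := mem_arrays_route h; omega]
  have e42 : σ₃.mem 42 = σ₂.mem 42 :=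
    f₃.mem 42 fun h => by have := mem_arrays_route h; omega
  rw [hT₃.s₁, hT₃.s₂, hT₃.s₃, e40, e42] at e0
  simp only [p₁, p₂, p₃] at e0
  by_cases hr : G.Reach {d | σ.mem 23 (code d) = 0} (H.snd 2) (H.fst 2) ∧
      G.Reach {d | σ₁.mem 24 (code d) = 0} (H.snd 1) (H.fst 1) ∧
      G.Reach {d | σ₂.mem 24 (code d) = 0} (H.snd 0) (H.fst 0)
  · rw [if_pos hr] at e0
    obtain ⟨l₃, q₃, -, s₃, m₃⟩ := y₁ hr.1
    obtain ⟨l₂, q₂, a₂, s₂, m₂⟩ := y₂ hr.2.1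
    obtain ⟨l₁, q₁, a₁, s₁, -⟩ := y₃ hr.2.2
    have hF₁ : Marks (σ₁.mem 24) (edges l₃) := by simpa using m₃
    have hFF : F₁ = edges l₃ := by
      ext e
      have h := (hM₁ (e, false)).symm.trans (hF₁ (e, false))
      dsimp only at h
      by_cases h₁ : e ∈ F₁ <;> by_cases h₂ : e ∈ edges l₃ <;> simp_all
    rw [hFF] at m₂
    refine Or.inl ⟨e0, isSolution_of_paths q₁ q₂ q₃ ?_ ?_ ?_ ?_ ?_⟩
    · intro d hd he
      have := a₂ d hd
      rw [hF₁ d, if_pos he] at this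
      omega
    · intro d hd he
      have := a₁ d hd
      rw [m₂ d, if_pos he] at this
      omega
    · exact s₁.congr (by rw [em]) (by rw [em])
    · refine s₂.congr ?_ ?_
      · rw [em, c₃ 1 (by decide)]
      · rw [em]
        exact f₃.mem _ fun h => by have := mem_arrays_route h; omega
    · refine s₃.congr ?_ ?_
      · rw [em, c₃ 2 (by decide), c₂ 2 (by decide)]
      · rw [em, f₃.mem _ fun h => by have := mem_arrays_route h; omega]
        exact f₂.mem _ fun h => by have := mem_arrays_route h; omega
  · rw [if_neg hr] at e0
    refine Or.inr ⟨e0, fun E hS hE r₃ r₂ => hr ?_⟩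
    rw [← hS] at r₃
    obtain ⟨l₃, q₃, a₃, -, m₃⟩ := y₁ r₃
    have hF₁ : Marks (σ₁.mem 24) (edges l₃) := by simpa using m₃
    -- The second search uses everything off the third path, which includes `Eᶜ` because that path
    -- runs inside `E`.
    have r₂' : G.Reach {d | σ₁.mem 24 (code d) = 0} (H.snd 1) (H.fst 1) := by
      rw [hF₁.setOf]
      refine r₂.mono fun d hd => ?_
      simp only [along, Set.mem_ofPred_eq, Finset.mem_compl] at hd ⊢
      intro he
      obtain ⟨d', hd', he'⟩ := mem_edges.1 he
      have : d' ∈ along E := hS ▸ a₃ d' hd'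
      exact hd (he' ▸ this)
    obtain ⟨l₂, q₂, a₂, -, m₂⟩ := y₂ r₂'
    have hFF : F₁ = edges l₃ := by
      ext e
      have h := (hM₁ (e, false)).symm.trans (hF₁ (e, false))
      dsimp only at h
      by_cases h₁ : e ∈ F₁ <;> by_cases h₂ : e ∈ edges l₃ <;> simp_all
    rw [hFF] at m₂
    refine ⟨r₃, r₂', ?_⟩
    rw [m₂.setOf]
    refine hE.reach_last q₃ q₂ fun d hd he => ?_
    have := a₂ d hd
    rw [hF₁ d, if_pos he] at this
    omega

end

/-! ### Choosing the edges for the third pair -/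

section

open scoped Classical
open Program Multigraph

variable {n m : ℕ} {G : Multigraph n m} {H : Multigraph n 3} {B : ℕ} {σ : State}

namespace Program

/-- Mark the edge of the current dart in the array `b`. -/
def mark (b : ℕ) : Program := block [store b 21 3, load 22 10 21, store b 22 3]

/-- Execute `body` for each dart in register `27`. -/
def forDarts (body : Program) : Program :=
  .seq (copy 27 2) (.while (.lt 27 4) (.seq (add 27 27 3) body))

/-- Mark in the array `23` what is not marked in the array `21`. -/
def complement : Program := block [load 22 21 27, sub 22 3 22, store 23 27 22]

/-- Compute in register `25` the label of the node in register `20`: `1` if it occurs in the search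
tree `32`, and `2` if it only occurs in the search tree `34`. -/
def label : Program := block
  [load 25 32 20,
    ite (.eq 25 2) (block [load 25 34 20, ite (.eq 25 2) skip (const 25 2)]) (const 25 1)]

/-- Register `12` receives the label of the first labelled node, and register `13` the first node
with another label. -/
def contact : Program := block
  [label,
    ite (.eq 25 2) skip
      (ite (.eq 12 2) (copy 12 25)
        (ite (.eq 12 25) skip
          (ite (.eq 14 2) (block [copy 13 20, copy 14 3]) skip)))]

/-- Choose the ends of the first two pairs with the label in register `12`. -/
def chooseEnds : Program := block
  [ite (.eq 12 3) (block [const 17 2, copy 15 7]) (block [copy 17 3, copy 15 10]),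
    copy 20 6, label, ite (.eq 25 12) (copy 16 6) (copy 16 9)]

/-- Mark the current dart in the arrays `22` and `23` if it lies in the component with the label in
register `17`. -/
def markComponent : Program := block
  [load 22 21 27,
    ite (.eq 22 2) (block
      [load 20 8 27, label, ite (.eq 25 17) (block [store 22 27 3, store 23 27 3]) skip]) skip]

/-- Forbid the current dart in the array `22`, and invert the mark of its edge in the array `23`. -/
def toggle : Program := block
  [store 22 21 3, load 22 23 21, sub 22 3 22, store 23 21 22, load 24 10 21, load 22 23 24,
    sub 22 3 22, store 23 24 22]

/-- The body of `trace` sees the heads of the darts only, so `contact` is executed once more for the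
root. Array `22` holds the forbidden darts of the residual graph, and array `23` becomes the
complement of the edges reserved for the third pair. -/
def detour : Program := block
  [block [copy 12 2, copy 13 2, copy 14 2], trace 30 8 contact, contact, chooseEnds,
    forDarts markComponent, search 22 36 37 13, trace 36 15 toggle, search 22 38 39 13,
    trace 38 16 toggle]

def prepare : Program := block
  [search 20 30 31 11, trace 30 8 (mark 21), search 21 32 33 7, search 21 34 35 10,
    load 22 32 10, ite (.eq 22 2) detour (forDarts complement)]

end Program

/-- `J` depends on the memory only, so that the use of registers by counter and body cannot disturb
it. -/
theorem forDarts_spec {t : ℕ} {body : Program} (hL : Loaded G σ) (hB : 2 * m + 1 < B)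
    (hr : ∀ r ∈ body.regs, 5 < r ∧ r ≠ 27) (ha : ∀ a ∈ body.arrays, a < 8 ∨ 13 < a)
    (J : ℕ → (ℕ → ℕ → ℕ) → Prop) (hJ : J 0 σ.mem)
    (hbody : ∀ (d : Dart m) ρ, Loaded G ρ → Frame (forDarts body) σ ρ → J (code d - 1) ρ.mem →
      ρ.reg 27 = code d → Meets B body ρ t fun τ => J (code d) τ.mem) :
    Meets B (forDarts body) σ ((t + 2) * (2 * m) + 2) fun τ => J (2 * m) τ.mem := by
  refine Meets.seq_of (t := 1) (t' := (t + 2) * (2 * m) + 1)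
    (Q := fun τ => τ.reg 27 = 0 ∧ (∀ r, r ≠ 27 → τ.reg r = σ.reg r) ∧ τ.mem = σ.mem)
    (Meets.of_pre (c := copy 27 2) ?_) (fun σ₁ ⟨e27, er, em⟩ hf₁ => ?_) (by omega)
  · simp only [Program.pre, State.setReg_reg, State.setReg_mem, hL.reg2]
    exact ⟨by simp, fun r h => by simp [h], trivial⟩
  have hL₁ : Loaded G σ₁ := hL.congr (fun r _ _ => er r (by omega)) (fun a _ _ => by rw [em])
  have hF₁ : Frame (forDarts body) σ σ₁ := hf₁.weaken
    (fun r h => by simp only [regs, List.mem_singleton] at h; simp [forDarts, regs, h])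
    (fun a h => by simp [arrays] at h)
  have hreg : ∀ r, r ≤ 5 → r ∉ (Program.seq (add 27 27 3) body).regs := by
    intro r hr' h
    simp only [regs, List.mem_append, List.mem_singleton] at h
    rcases h with h | h
    · omega
    · have := (hr r h).1; omega
  have harr : ∀ a, 8 ≤ a → a ≤ 13 → a ∉ (Program.seq (add 27 27 3) body).arrays := by
    intro a h₁ h₂ h
    simp only [arrays, List.nil_append] at h
    have := ha a h
    omega
  have h := Meets.loop (B := B) (σ := σ₁) (t := 1 + t) (b := .lt 27 4)
    (c := .seq (add 27 27 3) body) (fun ρ => ρ.reg 27 ≤ 2 * m ∧ J (ρ.reg 27) ρ.mem)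
    (fun ρ => 2 * m - ρ.reg 27) (by
      rintro ρ hf ⟨hle, hI⟩ hb
      have hLρ : Loaded G ρ := hL₁.congr (fun r _ h => hf.reg r (hreg r h))
        (fun a h₁ h₂ => hf.mem a (harr a h₁ h₂))
      have hlt : ρ.reg 27 < 2 * m := by
        have : ρ.reg 27 < ρ.reg 4 := hb
        rwa [hLρ.reg4] at this
      obtain ⟨d, hd⟩ := exists_code (m := m) (h := ρ.reg 27 + 1) (by omega) (by omega)
      refine Meets.seq_of (t := 1) (t' := t)
        (Q := fun τ => τ.reg 27 = ρ.reg 27 + 1 ∧ (∀ r, r ≠ 27 → τ.reg r = ρ.reg r) ∧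
          τ.mem = ρ.mem)
        (Meets.of_pre (c := add 27 27 3) ?_) (fun ρ₁ ⟨e27, er, em⟩ hfρ => ?_) le_rfl
      · simp only [Program.pre, State.setReg_reg, State.setReg_mem, hLρ.reg3]
        exact ⟨by omega, by simp, fun r h => by simp [h], trivial⟩
      · have hFρ : Frame (forDarts body) σ ρ₁ := by
          refine (hF₁.trans (hf.weaken ?_ ?_)).trans (hfρ.weaken ?_ ?_)
          · intro r h; simp [forDarts, regs] at h ⊢; exact h
          · intro a h; simpa [forDarts, arrays] using h
          · intro r h; simp only [regs, List.mem_singleton] at h; simp [forDarts, regs, h]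
          · intro a h; simp [arrays] at h
        refine (hbody d ρ₁ (hLρ.congr (fun r _ _ => er r (by omega)) fun a _ _ => by rw [em])
          hFρ ?_ (by rw [e27, hd])).frame.mono le_rfl fun τ ⟨hJτ, hfτ⟩ => ?_
        · rw [hd, em]; exact hI
        · have : τ.reg 27 = ρ.reg 27 + 1 := by
            rw [hfτ.reg 27 fun h => (hr 27 h).2 rfl, e27]
          rw [this]
          refine ⟨⟨by omega, ?_⟩, by omega⟩
          rw [← hd]; exact hJτ)
    ⟨by omega, by rw [e27, em]; exact hJ⟩
  refine h.frame.mono ?_ ?_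
  · have : (1 + t + 1) * (2 * m - σ₁.reg 27) ≤ (t + 2) * (2 * m) :=
      Nat.mul_le_mul (by omega) (by omega)
    omega
  · rintro τ ⟨⟨⟨hle, hJτ⟩, hb⟩, hf⟩
    have h4 : τ.reg 4 = 2 * m := (hf.reg 4 (hreg 4 (by omega))).trans hL₁.reg4
    have : ¬ τ.reg 27 < τ.reg 4 := hb
    have : τ.reg 27 = 2 * m := by omega
    rwa [this] at hJτ

theorem mark_spec {b : ℕ} {d : Dart m} (hL : Loaded G σ) (hb : 20 ≤ b) (hd : σ.reg 21 = code d) :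
    Meets B (mark b) σ 4 fun τ =>
      τ.mem b = Function.update (Function.update (σ.mem b) (code d) 1) (code (rev d)) 1 := by
  refine Meets.of_pre (c := mark b) ?_
  simp [mark, block, Program.pre, State.setReg_reg, State.setReg_mem, State.setMem_reg,
    State.setMem_mem, hL.reg3, hd, hL.rev, show (10 : ℕ) ≠ b by omega]

/-- Mark the edges of a path of the search tree, if there is one. -/
theorem trace_mark_spec {r v : Fin n} {S : Set (Dart m)} (hL : Loaded G σ)
    (hS : Searched G S r (σ.mem 30)) (hv : σ.reg 8 = v) (h21 : σ.mem 21 = fun _ => 0) :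
    Meets B (trace 30 8 (mark 21)) σ (7 * n + 4) fun τ => ∃ F, Marks (τ.mem 21) F ∧
      (G.Reach S r v → ∃ l, F = edges l ∧ G.SimplePath r v l ∧
        ∀ d ∈ l, τ.mem 30 (G.head d) = code d) := by
  by_cases hreach : G.Reach S r v
  · obtain ⟨l, hl, hlS⟩ := hS.path v hreach
    have hlen := hl.length_le
    have hharm : Harmless 30 (mark 21) := ⟨by decide, by decide⟩
    refine (trace_of_reach (B := B) (t := 4) (s := 8) (body := mark 21) hL hl.1
      (fun d hd => (hlS d hd).2) hS.root hv hharm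
      (fun done ρ => Marks (ρ.mem 21) (edges done))
      (fun τ _ hτ' => by rw [hτ', h21]; intro d; simp [edges])
      (fun pre d post ρ hpre hLρ hfρ hJ _ h21 => by
        refine (mark_spec hLρ (by decide) h21).mono le_rfl ?_
        rintro τ eb τ' _ hm'
        rw [hm', eb, edges_append_singleton]
        exact hJ.insert d)).frame.mono (by omega) ?_
    rintro τ ⟨⟨hM, _⟩, hf⟩
    refine ⟨edges l, hM, fun _ => ⟨l, rfl, hl, ?_⟩⟩
    rw [hf.mem 30 (by decide)]
    exact fun d hd => (hlS d hd).2
  · have h0 : σ.mem 30 v = 0 := by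
      by_contra h
      exact hreach ((hS.reach v).1 h)
    refine (trace_of_not_reach (t := 7 * n + 4) hL.reg2 (by rw [hv, h0])
      (by omega)).mono le_rfl ?_
    rintro τ ⟨-, hm, -⟩
    refine ⟨∅, ?_, fun h => absurd h hreach⟩
    rw [hm, h21]
    intro d
    simp

theorem complement_spec {F : Finset (Fin m)} (hL : Loaded G σ) (hB : 2 * m + 1 < B)
    (hF : Marks (σ.mem 21) F) :
    Meets B (forDarts complement) σ (12 * m + 2) fun τ => Marks (τ.mem 23) Fᶜ := by
  refine (forDarts_spec (B := B) (t := 4) hL hB (by decide) (by decide)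
    (fun k mem => ∀ d : Dart m, code d ≤ k → mem 23 (code d) = if d.1 ∈ Fᶜ then 1 else 0)
    (fun d hd => absurd hd (by have := code_pos d; omega)) (fun d ρ hLρ hf hJ h27 => ?_)).mono
    (by omega) (fun τ h d => h d (code_le d))
  have h21 : ρ.mem 21 (code d) = if d.1 ∈ F then 1 else 0 := by
    rw [hf.mem 21 (by decide)]; exact hF d
  refine (Meets.of_pre (c := complement) (Q := fun τ =>
    τ.mem 23 = Function.update (ρ.mem 23) (code d) (1 - ρ.mem 21 (code d))) ?_).mono
    (by simp [complement, block, cost]) fun τ hτ d' hd' => ?_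
  · simp [complement, block, Program.pre, State.setReg_reg, State.setReg_mem,
      State.setMem_mem, hLρ.reg3, h27]
  · rw [hτ]
    by_cases hdd : d' = d
    · subst hdd
      rw [Function.update_self, h21]
      by_cases h : d'.1 ∈ F <;> simp [h]
    · rw [Function.update_of_ne fun h => hdd (code_injective h)]
      refine hJ d' ?_
      have : code d' ≠ code d := fun h => hdd (code_injective h)
      omega

/-- The label of a node with respect to two search trees. -/
def labelOf (f g : ℕ → ℕ) (v : ℕ) : ℕ := if f v = 0 then (if g v = 0 then 0 else 2) else 1

theorem label_spec (h2 : σ.reg 2 = 0) (hB : 2 < B) :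
    Meets B label σ 10 fun τ => τ.reg 25 = labelOf (σ.mem 32) (σ.mem 34) (σ.reg 20) ∧
      (∀ r, r ≠ 25 → τ.reg r = σ.reg r) ∧ τ.mem = σ.mem := by
  refine (Meets.of_pre (c := label) ?_).mono (by simp [label, block, cost]) fun _ => id
  have e : ∀ (ρ : State) (x : ℕ), (ρ.setReg 25 x).reg 25 = x := fun ρ x => by
    simp [State.setReg_reg]
  have e' : ∀ (ρ : State) (x r : ℕ), r ≠ 25 → (ρ.setReg 25 x).reg r = ρ.reg r := fun ρ x r h => by
    simp [State.setReg_reg, h]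
  by_cases h₁ : σ.mem 32 (σ.reg 20) = 0
  · by_cases h₂ : σ.mem 34 (σ.reg 20) = 0
    · simp [label, block, Program.pre, e, e', State.setReg_mem, Test.Holds, labelOf,
        h2, h₁, h₂]
      exact fun r h => by simp [State.setReg_reg, h]
    · simp [label, block, Program.pre, e, e', State.setReg_mem, Test.Holds, labelOf,
        h2, h₁, h₂, hB]
      exact fun r h => by simp [State.setReg_reg, h]
  · simp [label, block, Program.pre, e, e', State.setReg_mem, Test.Holds, labelOf,
      h2, h₁]
    exact ⟨by omega, fun r h => by simp [State.setReg_reg, h]⟩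

end

/-! ### Contacts of the path with the two components, and the marking of darts -/

section

open scoped Classical
open Program Multigraph

variable {n m : ℕ} {G : Multigraph n m} {H : Multigraph n 3} {B : ℕ} {σ : State}

/-- After a walk along the nodes `N` with labels `lab`, `a` is the first label, and `j` is the first
node with another label; `f` is zero as long as there is none. -/
inductive Contacts (lab : ℕ → ℕ) (N : List (Fin n)) : ℕ → ℕ → ℕ → Prop
  | none (j : Fin n) : (∀ u ∈ N, lab u = 0) → Contacts lab N 0 j 0
  | one {a : ℕ} (j : Fin n) : a ≠ 0 → (∃ u ∈ N, lab u = a) →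
      (∀ u ∈ N, lab u = 0 ∨ lab u = a) → Contacts lab N a j 0
  | two {a : ℕ} (N₁ N₂ : List (Fin n)) (j : Fin n) : a ≠ 0 → N = N₁ ++ j :: N₂ → lab j ≠ 0 →
      lab j ≠ a → (∃ u ∈ N₁, lab u = a) → (∀ u ∈ N₁, lab u = 0 ∨ lab u = a) → Contacts lab N a j 1

/-- The later searches start at this register even if there is no contact, so it must always hold a
node. -/
theorem Contacts.isNode {lab : ℕ → ℕ} {N : List (Fin n)} {a j f : ℕ} (h : Contacts lab N a j f) :
    ∃ u : Fin n, j = u := by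
  cases h <;> exact ⟨_, rfl⟩

theorem contact_spec {lab : ℕ → ℕ} {N : List (Fin n)} {v : Fin n} (h2 : σ.reg 2 = 0)
    (h3 : σ.reg 3 = 1) (hB : 2 < B) (hlab : ∀ u, lab u = labelOf (σ.mem 32) (σ.mem 34) u)
    (hv : σ.reg 20 = v) (hI : Contacts lab N (σ.reg 12) (σ.reg 13) (σ.reg 14)) :
    Meets B contact σ 24 fun τ =>
      Contacts lab (N ++ [v]) (τ.reg 12) (τ.reg 13) (τ.reg 14) ∧ τ.mem = σ.mem := by
  refine (label_spec h2 hB).seq_of (t' := 14) (fun ρ ⟨e25, er, em⟩ _ => ?_) le_rfl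
  rw [hv, ← hlab] at e25
  rw [← er 12 (by decide), ← er 13 (by decide), ← er 14 (by decide)] at hI
  rw [← er 2 (by decide)] at h2
  rw [← er 3 (by decide)] at h3
  rw [← er 20 (by decide)] at hv
  rw [← em]
  clear er em
  refine (Meets.of_pre (c := block [ite (.eq 25 2) skip
      (ite (.eq 12 2) (copy 12 25) (ite (.eq 12 25) skip
        (ite (.eq 14 2) (block [copy 13 20, copy 14 3]) skip)))]) ?_).mono
      (by simp [block, cost]) fun _ => id
  generalize ha : ρ.reg 12 = a at hI
  generalize hj : ρ.reg 13 = j at hI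
  generalize hf : ρ.reg 14 = f at hI
  have hmem : ∀ {P : Fin n → Prop}, (∀ u ∈ N, P u) → P v → ∀ u ∈ N ++ [v], P u := by
    intro P h h' u hu
    rcases List.mem_append.1 hu with hu | hu
    · exact h u hu
    · rw [List.mem_singleton.1 hu]; exact h'
  by_cases h0 : lab v = 0
  · simp [block, Program.pre, Test.Holds, e25, h2, h0, ha, hj, hf]
    cases hI with
    | none j h => exact .none j (hmem h h0)
    | one j h₁ h₂ h₃ =>
      obtain ⟨u, hu, h₂⟩ := h₂
      exact .one j h₁ ⟨u, by simp [hu], h₂⟩ (hmem h₃ (Or.inl h0))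
    | two N₁ N₂ j h₁ h₂ h₃ h₄ h₅ h₆ =>
      exact .two N₁ (N₂ ++ [v]) j h₁ (by simp [h₂]) h₃ h₄ h₅ h₆
  · by_cases ha0 : a = 0
    · simp [block, Program.pre, Test.Holds, e25, h2, h0, ha, ha0, State.setReg_reg,
        State.setReg_mem, hj, hf]
      subst ha0
      cases hI with
      | none j h => exact .one j h0 ⟨v, by simp, rfl⟩ (hmem (fun u hu => Or.inl (h u hu))
          (Or.inr rfl))
      | one j h₁ => exact absurd rfl h₁
      | two N₁ N₂ j h₁ => exact absurd rfl h₁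
    · by_cases hav : a = lab v
      · simp [block, Program.pre, Test.Holds, e25, h2, ha, ← hav, ha0, hj, hf]
        cases hI with
        | none => exact absurd rfl ha0
        | one j h₁ h₂ h₃ =>
          obtain ⟨u, hu, h₂⟩ := h₂
          exact .one j h₁ ⟨u, by simp [hu], h₂⟩ (hmem h₃ (Or.inr hav.symm))
        | two N₁ N₂ j h₁ h₂ h₃ h₄ h₅ h₆ =>
          exact .two N₁ (N₂ ++ [v]) j h₁ (by simp [h₂]) h₃ h₄ h₅ h₆
      · cases hI with
        | none => exact absurd rfl ha0
        | one j h₁ h₂ h₃ =>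
          simp [block, Program.pre, Test.Holds, e25, h2, h3, h0, ha, ha0, hav, hf,
            State.setReg_reg, State.setReg_mem, hv]
          exact .two N [] v h₁ rfl h0 (fun h => hav h.symm) h₂ h₃
        | two N₁ N₂ j h₁ h₂ h₃ h₄ h₅ h₆ =>
          simp [block, Program.pre, Test.Holds, e25, h2, h0, ha, ha0, hav, hj, hf]
          exact .two N₁ (N₂ ++ [v]) j h₁ (by simp [h₂]) h₃ h₄ h₅ h₆

/-- The nodes of the path are inspected one after another. -/
theorem trace_contact_spec {s r : Fin n} {l : List (Dart m)} {lab : ℕ → ℕ} (hL : Loaded G σ)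
    (hB : 2 < B) (hlab : ∀ u, lab u = labelOf (σ.mem 32) (σ.mem 34) u)
    (hs : σ.reg 8 = s) (h12 : σ.reg 12 = 0) (h13 : ∃ u : Fin n, σ.reg 13 = u)
    (h14 : σ.reg 14 = 0) (hl : G.SimplePath r s l)
    (hpar : ∀ d ∈ l, σ.mem 30 (G.head d) = code d) (hroot : σ.mem 30 r = 2 * m + 1) :
    Meets B (trace 30 8 contact) σ (27 * n + 4) fun τ => τ.reg 20 = r ∧
      Contacts lab (l.map G.head) (τ.reg 12) (τ.reg 13) (τ.reg 14) := by
  have hlen := hl.length_le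
  obtain ⟨u, hu⟩ := h13
  refine (trace_of_reach (B := B) (t := 24) (s := 8) (body := contact) hL hl.1 hpar hroot hs
    ⟨by decide, by decide⟩
    (fun done ρ => Contacts lab (done.map G.head) (ρ.reg 12) (ρ.reg 13) (ρ.reg 14))
    (fun τ hτ _ => ?_) (fun pre d post ρ hpre hLρ hfρ hJ h20 h21 => ?_)).mono (by omega)
    fun τ h => ⟨h.2, h.1⟩
  · rw [hτ 12 (by decide) (by decide), hτ 13 (by decide) (by decide),
      hτ 14 (by decide) (by decide), h12, h14, hu]
    exact .none u (by simp)
  · refine (contact_spec hLρ.reg2 hLρ.reg3 hB (fun u => ?_) h20 hJ).mono le_rfl ?_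
    · rw [hlab, hfρ.mem 32 (by decide), hfρ.mem 34 (by decide)]
    · rintro τ ⟨h, -⟩ τ' hr _
      rw [hr 12 (by decide) (by decide), hr 13 (by decide) (by decide),
        hr 14 (by decide) (by decide), List.map_append]
      exact h

theorem chooseEnds_spec (h2 : σ.reg 2 = 0) (h3 : σ.reg 3 = 1) (hB : 2 < B) :
    Meets B chooseEnds σ 30 fun τ =>
      τ.reg 17 = (if σ.reg 12 = 1 then 2 else 1) ∧
      τ.reg 15 = (if σ.reg 12 = 1 then σ.reg 7 else σ.reg 10) ∧
      τ.reg 16 = (if labelOf (σ.mem 32) (σ.mem 34) (σ.reg 6) = σ.reg 12 then σ.reg 6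
        else σ.reg 9) := by
  refine Meets.seq_of (t := 12) (t' := 18) (Q := fun τ =>
    τ.reg 17 = (if σ.reg 12 = 1 then 2 else 1) ∧
    τ.reg 15 = (if σ.reg 12 = 1 then σ.reg 7 else σ.reg 10) ∧
    (∀ r, r ≠ 17 → r ≠ 15 → τ.reg r = σ.reg r) ∧ τ.mem = σ.mem)
    ((Meets.of_pre ?_).mono (by simp [block, cost]) fun _ => id)
    (fun σ₁ ⟨e17, e15, er, em⟩ _ => ?_) le_rfl
  · by_cases h : σ.reg 12 = 1
    · simp [block, Program.pre, Test.Holds, State.setReg_reg, State.setReg_mem, h, h3, hB]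
      exact fun r h₁ h₂ => by simp [h₁, h₂]
    · simp [block, Program.pre, Test.Holds, State.setReg_reg, State.setReg_mem, h, h3]
      exact fun r h₁ h₂ => by simp [h₁, h₂]
  refine Meets.seq_of (t := 1) (t' := 17) (Q := fun τ =>
    τ.reg 20 = σ.reg 6 ∧ (∀ r, r ≠ 20 → τ.reg r = σ₁.reg r) ∧ τ.mem = σ.mem)
    (Meets.of_pre (c := copy 20 6) ?_) (fun σ₂ ⟨e20, er₂, em₂⟩ _ => ?_) le_rfl
  · simp [Program.pre, State.setReg_reg, State.setReg_mem, em, er 6]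
    exact fun r h => by simp [h]
  refine (label_spec (by rw [er₂ 2 (by decide), er 2 (by decide) (by decide), h2]) hB).seq_of
    (t' := 7) (fun σ₃ ⟨e25, er₃, em₃⟩ _ => ?_) le_rfl
  rw [em₂, e20] at e25
  refine (Meets.of_pre (c := block [ite (.eq 25 12) (copy 16 6) (copy 16 9)]) ?_).mono
    (by simp [block, cost]) fun _ => id
  have k : ∀ r, r ≠ 17 → r ≠ 15 → r ≠ 20 → r ≠ 25 → σ₃.reg r = σ.reg r := fun r h₁ h₂ h₃ h₄ => by
    rw [er₃ r h₄, er₂ r h₃, er r h₁ h₂]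
  have k17 : σ₃.reg 17 = σ₁.reg 17 := by rw [er₃ 17 (by decide), er₂ 17 (by decide)]
  have k15 : σ₃.reg 15 = σ₁.reg 15 := by rw [er₃ 15 (by decide), er₂ 15 (by decide)]
  by_cases h : labelOf (σ.mem 32) (σ.mem 34) (σ.reg 6) = σ.reg 12
  · simp [block, Program.pre, Test.Holds, State.setReg_reg, e25, k, h, k17, k15, e17, e15]
  · simp [block, Program.pre, Test.Holds, State.setReg_reg, e25, k, h, k17, k15, e17, e15]

/-- Testing the tail is enough: in the application the labelled component is closed under unmarked
edges, so both darts of an edge are treated alike. -/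
theorem markComponent_spec {lab : ℕ → ℕ} (hL : Loaded G σ) (hB : 2 * m + 2 < B)
    (hlab : ∀ u, lab u = labelOf (σ.mem 32) (σ.mem 34) u) (h22 : σ.mem 22 = fun _ => 0)
    (h23 : σ.mem 23 = fun _ => 0) :
    Meets B (forDarts markComponent) σ (60 * m + 2) fun τ => ∀ d : Dart m,
      τ.mem 22 (code d) =
        (if σ.mem 21 (code d) = 0 ∧ lab (G.tail d) = σ.reg 17 then 1 else 0) ∧
      τ.mem 23 (code d) =
        (if σ.mem 21 (code d) = 0 ∧ lab (G.tail d) = σ.reg 17 then 1 else 0) := by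
  refine (forDarts_spec (B := B) (t := 28) hL (by omega) (by decide) (by decide)
    (fun k mem => ∀ d : Dart m,
      mem 22 (code d) =
        (if code d ≤ k ∧ σ.mem 21 (code d) = 0 ∧ lab (G.tail d) = σ.reg 17 then 1 else 0) ∧
      mem 23 (code d) =
        (if code d ≤ k ∧ σ.mem 21 (code d) = 0 ∧ lab (G.tail d) = σ.reg 17 then 1 else 0))
    (fun d => ?_) (fun d ρ hLρ hf hJ h27 => ?_)).mono (by omega) (fun τ h d => ?_)
  · simp [h22, h23, code_ne_zero]
  · have h17 : ρ.reg 17 = σ.reg 17 := hf.reg 17 (by decide)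
    have h21 : ρ.mem 21 = σ.mem 21 := hf.mem 21 (by decide)
    have hstay : ∀ mem : ℕ → ℕ → ℕ, mem = ρ.mem →
        ¬ (σ.mem 21 (code d) = 0 ∧ lab (G.tail d) = σ.reg 17) → ∀ d' : Dart m,
        mem 22 (code d') = (if code d' ≤ code d ∧ σ.mem 21 (code d') = 0 ∧
          lab (G.tail d') = σ.reg 17 then 1 else 0) ∧
        mem 23 (code d') = (if code d' ≤ code d ∧ σ.mem 21 (code d') = 0 ∧
          lab (G.tail d') = σ.reg 17 then 1 else 0) := by
      intro mem hmem hno d'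
      rw [hmem, (hJ d').1, (hJ d').2]
      by_cases hdd : d' = d
      · subst hdd; simp [hno]
      · have : code d' ≠ code d := fun h => hdd (code_injective h)
        have : code d' ≤ code d - 1 ↔ code d' ≤ code d := by omega
        simp only [this, and_self]
    refine Meets.seq_of (t := 1) (t' := 27) (Q := fun τ => τ.reg 22 = σ.mem 21 (code d) ∧
      (∀ r, r ≠ 22 → τ.reg r = ρ.reg r) ∧ τ.mem = ρ.mem) (Meets.of_pre (c := load 22 21 27) ?_)
      (fun σ₁ ⟨e22, er, em⟩ _ => ?_) le_rfl
    · simp [Program.pre, State.setReg_reg, State.setReg_mem, h27, h21]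
      exact fun r h => by simp [h]
    refine Meets.seq_of (t := 26) (t' := 1) (Meets.ite (t := 25)
      (Q := fun τ : State => ∀ d' : Dart m,
        τ.mem 22 (code d') = (if code d' ≤ code d ∧ σ.mem 21 (code d') = 0 ∧
          lab (G.tail d') = σ.reg 17 then 1 else 0) ∧
        τ.mem 23 (code d') = (if code d' ≤ code d ∧ σ.mem 21 (code d') = 0 ∧
          lab (G.tail d') = σ.reg 17 then 1 else 0)) (fun h => ?_) (fun h => ?_))
      (fun τ hτ _ => ⟨1, τ, .skip _, le_rfl, hτ⟩) le_rfl
    · have h0 : σ.mem 21 (code d) = 0 := by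
        rw [← e22]
        exact h.trans ((er 2 (by decide)).trans hLρ.reg2)
      refine Meets.seq_of (t := 1) (t' := 24) (Q := fun τ => τ.reg 20 = G.tail d ∧
        (∀ r, r ≠ 20 → τ.reg r = σ₁.reg r) ∧ τ.mem = ρ.mem) (Meets.of_pre (c := load 20 8 27) ?_)
        (fun σ₂ ⟨e20, er₂, em₂⟩ _ => ?_) le_rfl
      · simp [Program.pre, State.setReg_reg, State.setReg_mem, em, er 27, h27, hLρ.tail]
        exact fun r h => by simp [h]
      refine (label_spec (by rw [er₂ 2 (by decide), er 2 (by decide), hLρ.reg2])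
        (by have := d.1.2; omega)).seq_of
        (t' := 14) (fun σ₃ ⟨e25, er₃, em₃⟩ _ => ?_) le_rfl
      rw [em₂, e20, hf.mem 32 (by decide), hf.mem 34 (by decide), ← hlab] at e25
      have k : ∀ r, r ≠ 22 → r ≠ 20 → r ≠ 25 → σ₃.reg r = ρ.reg r := fun r h₁ h₂ h₃ => by
        rw [er₃ r h₃, er₂ r h₂, er r h₁]
      by_cases hl : lab (G.tail d) = σ.reg 17
      · refine (Meets.of_pre (c := block [ite (.eq 25 17)
          (block [store 22 27 3, store 23 27 3]) skip]) (Q := fun τ =>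
            τ.mem 22 = Function.update (ρ.mem 22) (code d) 1 ∧
            τ.mem 23 = Function.update (ρ.mem 23) (code d) 1) ?_).mono
          (by simp [block, cost]) fun τ ⟨e₁, e₂⟩ d' => ?_
        · simp [block, Program.pre, Test.Holds, State.setMem_mem, State.setMem_reg, e25, k,
            h17, hl, em₃, em₂, h27, hLρ.reg3]
        · rw [e₁, e₂]
          by_cases hdd : d' = d
          · subst hdd; simp [h0, hl]
          · have hne : code d' ≠ code d := fun h => hdd (code_injective h)
            rw [Function.update_of_ne hne, Function.update_of_ne hne, (hJ d').1, (hJ d').2]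
            have : code d' ≤ code d - 1 ↔ code d' ≤ code d := by omega
            simp only [this, and_self]
      · refine (Meets.of_pre (c := block [ite (.eq 25 17)
          (block [store 22 27 3, store 23 27 3]) skip]) (Q := fun τ => τ.mem = ρ.mem) ?_).mono
          (by simp [block, cost]) fun τ e => hstay _ e fun h => hl h.2
        simp [block, Program.pre, Test.Holds, e25, k, h17, hl, em₃, em₂]
    · refine ⟨1, σ₁, .skip _, by omega, hstay _ em fun h' => h ?_⟩
      exact (e22.trans h'.1).trans ((er 2 (by decide)).trans hLρ.reg2).symm
  · have := h d
    simp only [code_le, true_and] at this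
    exact this

/-- Only `d` is forbidden in array `22`, not its reverse: this yields the residual graph. In array
`23` both darts are inverted, so two walks produce a symmetric difference. -/
theorem toggle_spec {d : Dart m} (hL : Loaded G σ) (hd : σ.reg 21 = code d) :
    Meets B toggle σ 9 fun τ =>
      τ.mem 22 = Function.update (σ.mem 22) (code d) 1 ∧
      τ.mem 23 = Function.update (Function.update (σ.mem 23) (code d) (1 - σ.mem 23 (code d)))
        (code (rev d)) (1 - σ.mem 23 (code (rev d))) := by
  refine Meets.of_pre (c := toggle) ?_
  have hne : code (rev d) ≠ code d := fun h => rev_ne d (code_injective h)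
  simp [toggle, block, Program.pre, State.setReg_reg, State.setReg_mem, State.setMem_reg,
    State.setMem_mem, hL.reg3, hd, hL.rev, hne]

/-- Toggle the edges of a path of the search tree, if there is one. -/
theorem trace_toggle_spec {p s : ℕ} {r v : Fin n} {S : Set (Dart m)} (hL : Loaded G σ)
    (hS : Searched G S r (σ.mem p)) (hv : σ.reg s = v) (hp : 25 ≤ p) :
    Meets B (trace p s toggle) σ (12 * n + 4) fun τ => G.Reach S r v → ∃ l, G.SimplePath r v l ∧
      (∀ d ∈ l, d ∈ S) ∧ ∀ d : Dart m,
        τ.mem 22 (code d) = (if d ∈ l then 1 else σ.mem 22 (code d)) ∧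
        τ.mem 23 (code d) = (if d.1 ∈ edges l then 1 - σ.mem 23 (code d)
          else σ.mem 23 (code d)) := by
  by_cases hreach : G.Reach S r v
  · obtain ⟨l, hl, hlS⟩ := hS.path v hreach
    have hlen := hl.length_le
    have hharm : Harmless p toggle := by
      refine ⟨by decide, fun a ha => ?_⟩
      simp [toggle, block, arrays] at ha
      omega
    refine (trace_of_reach (B := B) (t := 9) (s := s) (body := toggle) hL hl.1
      (fun d hd => (hlS d hd).2) hS.root hv hharm
      (fun done ρ => ∀ d : Dart m,
        ρ.mem 22 (code d) = (if d ∈ done then 1 else σ.mem 22 (code d)) ∧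
        ρ.mem 23 (code d) = (if d.1 ∈ edges done then 1 - σ.mem 23 (code d)
          else σ.mem 23 (code d)))
      (fun τ _ hτ' => by rw [hτ']; intro d; simp [edges])
      (fun pre d post ρ hpre hLρ hfρ hJ _ h21 => by
        refine (toggle_spec hLρ h21).mono le_rfl ?_
        rintro τ ⟨e₁, e₂⟩ τ' _ hm' d'
        -- A simple path has each edge once, so no mark is inverted twice during one walk.
        have hnew : d.1 ∉ edges pre := by
          have := hl.nodup_edges
          rw [hpre, List.map_append, List.map_cons, List.nodup_append] at this
          intro h
          obtain ⟨d₀, hd₀, he⟩ := mem_edges.1 h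
          exact this.2.2 _ (List.mem_map_of_mem hd₀) _ (List.mem_cons_self) he
        rw [hm', e₁, e₂]
        constructor
        · by_cases hdd : d' = d
          · subst hdd; simp
          · rw [Function.update_of_ne fun h => hdd (code_injective h), (hJ d').1]
            simp [hdd]
        · rw [edges_append_singleton]
          by_cases hdd : d'.1 = d.1
          · rw [if_pos (by simp [hdd])]
            have hold : ∀ d₁ : Dart m, d₁.1 = d.1 → ρ.mem 23 (code d₁) = σ.mem 23 (code d₁) := by
              intro d₁ h₁
              rw [(hJ d₁).2, if_neg (h₁ ▸ hnew)]
            rcases eq_or_eq_rev hdd with rfl | rfl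
            · rw [Function.update_of_ne fun h => rev_ne _ (code_injective h.symm),
                Function.update_self, hold _ rfl]
            · rw [Function.update_self, hold _ hdd]
          · rw [Function.update_of_ne, Function.update_of_ne, (hJ d').2]
            · simp [hdd]
            · exact fun h => hdd (congrArg Prod.fst (code_injective h))
            · intro h
              rw [code_injective h] at hdd
              exact hdd rfl)).mono (by omega) ?_
    rintro τ ⟨h, -⟩ -
    exact ⟨l, hl, fun d hd => (hlS d hd).1, h⟩
  · have h0 : σ.mem p v = 0 := by
      by_contra h
      exact hreach ((hS.reach v).1 h)
    exact (trace_of_not_reach (t := 12 * n + 4) hL.reg2 (by rw [hv, h0]) (by omega)).mono le_rfl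
      fun τ _ h => absurd h hreach

end

/-! ### From contacts to a blocked situation -/

section

open scoped Classical
open Program Multigraph

variable {n m : ℕ} {G : Multigraph n m} {H : Multigraph n 3} {B : ℕ} {σ : State}

theorem Multigraph.BackPath.map_head {r v : Fin n} {l : List (Dart m)} (h : G.BackPath r v l) :
    l.map G.head ++ [r] = v :: l.map G.tail := by
  induction l generalizing v with
  | nil => cases h; rfl
  | cons d l ih =>
    obtain ⟨rfl, h⟩ := h
    simp [ih h]

theorem Multigraph.BackPath.split {r v u : Fin n} {l : List (Dart m)} {N₁ N₂ : List (Fin n)}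
    (h : G.BackPath r v l) (hN : l.map G.head ++ [r] = N₁ ++ u :: N₂) :
    ∃ l₁ l₂, l = l₁ ++ l₂ ∧ l₁.map G.head = N₁ ∧ G.BackPath u v l₁ ∧ G.BackPath r u l₂ := by
  induction N₁ generalizing l v with
  | nil =>
    obtain rfl : v = u := by
      rw [h.map_head] at hN
      exact (List.cons.inj hN).1
    exact ⟨[], l, rfl, rfl, rfl, h⟩
  | cons w N₁ ih =>
    cases l with
    | nil => simp at hN
    | cons d l =>
      obtain ⟨rfl, h⟩ := h
      simp only [List.map_cons, List.cons_append, List.cons.injEq] at hN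
      obtain ⟨l₁, l₂, rfl, rfl, h₁, h₂⟩ := ih h hN.2
      exact ⟨d :: l₁, l₂, rfl, by simp [hN.1], ⟨rfl, h₁⟩, h₂⟩

/-- A path meets every component of the rest of the graph from which it separates a node. -/
theorem Multigraph.BackPath.exists_contact {r v x y : Fin n} {l : List (Dart m)}
    (h : G.BackPath r v l) (hxy : G.Reach Set.univ x y)
    (hn : ¬ G.Reach (along (edges l)ᶜ) x y) :
    ∃ u ∈ l.map G.head ++ [r], G.Reach (along (edges l)ᶜ) x u := by
  by_contra! hno
  -- If the path missed the component of `x`, that component would be closed under all darts and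
  -- contain `y`.
  refine hn (hxy.closed (K := {u | G.Reach (along (edges l)ᶜ) x u}) (fun d _ hd => ?_) .refl)
  by_cases he : d.1 ∈ edges l
  · obtain ⟨d', hd', he'⟩ := mem_edges.1 he
    have hm := h.mem_nodes hd'
    rw [← h.map_head] at hm
    rcases eq_or_eq_rev he' with rfl | rfl
    · exact absurd hd (hno _ hm.2)
    · rw [head_rev] at hm
      exact absurd hd (hno _ hm.1)
  · exact Reach.step hd (by simpa [along] using he)

/-- Exactly one end of the first pair lies in the component of an end of the second pair. -/
theorem Multigraph.Eulerian.ends_in_component (hE : G.Eulerian H) {l : List (Dart m)}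
    (hl : G.SimplePath (H.snd 2) (H.fst 2) l) {y z : Fin n}
    (hyz : (y = H.fst 1 ∧ z = H.snd 1) ∨ (y = H.snd 1 ∧ z = H.fst 1))
    (hn : ¬ G.Reach (along (edges l)ᶜ) y z) :
    G.Reach (along (edges l)ᶜ) y (H.fst 0) ↔ ¬ G.Reach (along (edges l)ᶜ) y (H.snd 0) := by
  set K : Set (Fin n) := {w | G.Reach (along (edges l)ᶜ) y w} with hK
  -- Off the path the odd nodes are the ends of the first two pairs. The component contains `y` but
  -- not `z`, hence exactly one further end.
  have hbd : ∀ w, G.bd (ind (edges l)ᶜ) w =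
      pt (H.fst 0) w + pt (H.snd 0) w + (pt y w + pt z w) := by
    intro w
    rw [Finset.compl_eq_univ_sdiff, bd_ind_sdiff (Finset.subset_univ _), hE.bd_univ, hl.bd_ind,
      Fin.sum_univ_three]
    have : pt y w + pt z w = (pt (H.fst 1) w + pt (H.snd 1) w : ZMod 2) := by
      rcases hyz with ⟨rfl, rfl⟩ | ⟨rfl, rfl⟩
      · rfl
      · exact add_comm _ _
    rw [this]
    linear_combination (pt (H.fst 2) w + pt (H.snd 2) w) * CharTwo.two_eq_zero (R := ZMod 2)
  have h0 : ∑ w with w ∈ K, G.bd (ind (edges l)ᶜ) w = 0 := by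
    refine G.sum_bd_eq_zero fun e he =>
      iff_of_closed (F := (edges l)ᶜ) (fun d hd h => Reach.step h hd) ?_
    by_contra hF
    simp only [ind, hF, if_false, ne_eq, not_true_eq_false] at he
  have hyK : y ∈ K := Relation.ReflTransGen.refl
  have hzK : z ∉ K := hn
  simp only [hbd, Finset.sum_add_distrib, sum_pt, if_pos hyK, if_neg hzK, add_zero] at h0
  change H.fst 0 ∈ K ↔ ¬ H.snd 0 ∈ K
  by_cases h₁ : H.fst 0 ∈ K <;> by_cases h₂ : H.snd 0 ∈ K <;> simp only [h₁, h₂, if_true,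
    if_false] at h0 ⊢
  · exact absurd h0 (by decide)
  · simp
  · simp
  · exact absurd h0 (by decide)

/-- The two components are disjoint and each contains exactly one end of the first pair; so the end
that is not with `y₁` is with `z₁`. -/
theorem blocked_of_split (hE : G.Eulerian H) {l l' : List (Dart m)} {y₁ z₁ j : Fin n}
    (hl : G.SimplePath (H.snd 2) (H.fst 2) (l ++ l'))
    (hyz : (y₁ = H.fst 1 ∧ z₁ = H.snd 1) ∨ (y₁ = H.snd 1 ∧ z₁ = H.fst 1))
    (hn : ¬ G.Reach (along (edges (l ++ l'))ᶜ) y₁ z₁)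
    (h₁ : G.BackPath j (H.fst 2) l) (h₂ : G.BackPath (H.snd 2) j l')
    (hj : G.Reach (along (edges (l ++ l'))ᶜ) z₁ j)
    (htouch : ∃ d ∈ l, G.Reach (along (edges (l ++ l'))ᶜ) y₁ (G.head d))
    (hfront : ∀ d ∈ l, ¬ G.Reach (along (edges (l ++ l'))ᶜ) z₁ (G.head d)) :
    ∃ z₂, Blocked G H {v | G.Reach (along (edges (l ++ l'))ᶜ) y₁ v}
      {v | G.Reach (along (edges (l ++ l'))ᶜ) z₁ v} y₁
      (if G.Reach (along (edges (l ++ l'))ᶜ) y₁ (H.fst 0) then H.fst 0 else H.snd 0) z₁ z₂ j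
      l l' := by
  have hn' : ¬ G.Reach (along (edges (l ++ l'))ᶜ) z₁ y₁ := fun h => hn h.symm_along
  have hy := hE.ends_in_component hl hyz hn
  have hz := hE.ends_in_component hl (y := z₁) (z := y₁) (by tauto) hn'
  have hdisj : ∀ v, G.Reach (along (edges (l ++ l'))ᶜ) y₁ v →
      ¬ G.Reach (along (edges (l ++ l'))ᶜ) z₁ v := fun v h h' => hn (h.trans h'.symm_along)
  have hclosed : ∀ (x : Fin n) (d : Dart m), d.1 ∉ edges (l ++ l') →
      G.Reach (along (edges (l ++ l'))ᶜ) x (G.tail d) →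
      G.Reach (along (edges (l ++ l'))ᶜ) x (G.head d) := fun x d hd h =>
    h.step (by simpa [along] using hd)
  have hd0 := hdisj (H.fst 0)
  have hd1 := hdisj (H.snd 0)
  by_cases h : G.Reach (along (edges (l ++ l'))ᶜ) y₁ (H.fst 0)
  · rw [if_pos h]
    exact ⟨H.snd 0, hl, h₁, h₂, hclosed y₁, hclosed z₁, hdisj, fun _ => id, fun _ => id, .refl, h,
      .refl, by by_contra hc; exact hd0 h (hz.2 hc), hj, hyz, Or.inl ⟨rfl, rfl⟩, htouch, hfront⟩
  · rw [if_neg h]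
    have h' : G.Reach (along (edges (l ++ l'))ᶜ) y₁ (H.snd 0) := by tauto
    exact ⟨H.fst 0, hl, h₁, h₂, hclosed y₁, hclosed z₁, hdisj, fun _ => id, fun _ => id, .refl, h',
      .refl, hz.2 (hd1 h'), hj, hyz, Or.inr ⟨rfl, rfl⟩, htouch, hfront⟩

/-- The two components, labelled `1` and `2`, and the contacts of the path with them give a
blocked situation. -/
theorem blocked_of_contacts (hE : G.Eulerian H) (hF : G.Feasible H) {l : List (Dart m)}
    (hl : G.SimplePath (H.snd 2) (H.fst 2) l)
    (hn : ¬ G.Reach (along (edges l)ᶜ) (H.fst 1) (H.snd 1)) {lab : ℕ → ℕ}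
    (hlab₁ : ∀ v : Fin n, lab v = 1 ↔ G.Reach (along (edges l)ᶜ) (H.fst 1) v)
    (hlab₂ : ∀ v : Fin n, lab v = 2 ↔ G.Reach (along (edges l)ᶜ) (H.snd 1) v)
    (hlab : ∀ v, lab v ≤ 2) {a f : ℕ} {j : Fin n}
    (hc : Contacts lab (l.map G.head ++ [H.snd 2]) a j f) :
    ∃ (A K : Set (Fin n)) (z₁ z₂ : Fin n) (l₁ l₂ : List (Dart m)), l = l₁ ++ l₂ ∧
      (∀ v : Fin n, lab v = (if a = 1 then 2 else 1) ↔ v ∈ K) ∧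
      Blocked G H A K (if a = 1 then H.fst 1 else H.snd 1)
        (if lab (H.fst 0) = a then H.fst 0 else H.snd 0) z₁ z₂ j l₁ l₂ := by
  have hn' : ¬ G.Reach (along (edges l)ᶜ) (H.snd 1) (H.fst 1) := fun h => hn h.symm_along
  -- The second pair is connected in `G`, so the path meets both components; this excludes the cases
  -- `none` and `one`.
  obtain ⟨u₁, hu₁, hr₁⟩ := hl.1.exists_contact (hF.reach 1) hn
  obtain ⟨u₂, hu₂, hr₂⟩ := hl.1.exists_contact ((hF.reach 1).symm fun _ _ => Set.mem_univ _) hn'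
  rw [← hlab₁] at hr₁
  rw [← hlab₂] at hr₂
  generalize hj : (j : ℕ) = j' at hc
  cases hc with
  | none _ h => have := h u₁ hu₁; omega
  | one _ h₁ _ h =>
    have h₁ := h u₁ hu₁
    have h₂ := h u₂ hu₂
    omega
  | two N₁ N₂ j' ha hN hj₁ hj₂ hex hall =>
    obtain rfl : j = j' := Fin.ext hj
    obtain ⟨l₁, l₂, rfl, rfl, hb₁, hb₂⟩ := hl.1.split hN
    obtain ⟨u, hu, hua⟩ := hex
    obtain ⟨d, hd, rfl⟩ := List.mem_map.1 hu
    have hall' : ∀ d ∈ l₁, lab (G.head d) = 0 ∨ lab (G.head d) = a := fun d hd =>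
      hall _ (List.mem_map_of_mem hd)
    have hle := hlab (G.head d)
    have hlej := hlab j
    by_cases ha1 : a = 1
    · subst ha1
      obtain ⟨z₂, hB⟩ := blocked_of_split hE hl (Or.inl ⟨rfl, rfl⟩) hn hb₁ hb₂
        ((hlab₂ j).1 (by omega)) ⟨d, hd, (hlab₁ _).1 hua⟩ (fun d hd h => by
          have h₁ := hall' d hd
          have h₂ := (hlab₂ _).2 h
          omega)
      refine ⟨{v | G.Reach (along (edges (l₁ ++ l₂))ᶜ) (H.fst 1) v},
        {v | G.Reach (along (edges (l₁ ++ l₂))ᶜ) (H.snd 1) v}, H.snd 1, z₂, l₁, l₂, rfl, ?_, ?_⟩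
      · simpa using hlab₂
      · simpa [hlab₁] using hB
    · have ha2 : a = 2 := by omega
      subst ha2
      obtain ⟨z₂, hB⟩ := blocked_of_split hE hl (Or.inr ⟨rfl, rfl⟩) hn' hb₁ hb₂
        ((hlab₁ j).1 (by omega)) ⟨d, hd, (hlab₂ _).1 hua⟩ (fun d hd h => by
          have h₁ := hall' d hd
          have h₂ := (hlab₁ _).2 h
          omega)
      refine ⟨{v | G.Reach (along (edges (l₁ ++ l₂))ᶜ) (H.snd 1) v},
        {v | G.Reach (along (edges (l₁ ++ l₂))ᶜ) (H.fst 1) v}, H.fst 1, z₂, l₁, l₂, rfl, ?_, ?_⟩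
      · simpa using hlab₁
      · simpa [hlab₂] using hB

end

/-! ### Correctness of the preparation -/

section

open scoped Classical
open Program Multigraph

variable {n m : ℕ} {G : Multigraph n m} {H : Multigraph n 3} {B : ℕ} {σ : State}

theorem Loaded.of_frame {c : Program} {τ : State} (h : Loaded G σ) (hf : Frame c σ τ)
    (hr : ∀ r ∈ c.regs, 5 < r) (ha : ∀ a ∈ c.arrays, a < 8 ∨ 13 < a) : Loaded G τ :=
  h.congr (fun r _ h₂ => hf.reg r fun h' => by have := hr r h'; omega)
    (fun a h₁ h₂ => hf.mem a fun h' => by have := ha a h'; omega)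

theorem Terminals.of_frame {c : Program} {τ : State} (h : Terminals H σ) (hf : Frame c σ τ)
    (hr : ∀ r ∈ c.regs, 11 < r) : Terminals H τ :=
  h.congr fun r _ h₂ => hf.reg r fun h' => by have := hr r h'; omega

/-- The edges not marked in the array `23` connect the third pair, those marked connect the second
pair. -/
def Prepared (G : Multigraph n m) (H : Multigraph n 3) (τ : State) : Prop :=
  ∃ E : Finset (Fin m), {d : Dart m | τ.mem 23 (code d) = 0} = along E ∧
    G.Reach (along E) (H.snd 2) (H.fst 2) ∧ G.Reach (along Eᶜ) (H.snd 1) (H.fst 1)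

/-- Halting in time is unconditional; the Eulerian condition and feasibility only enter the
postcondition. -/
theorem detour_spec {F : Finset (Fin m)} (hL : Loaded G σ) (hT : Terminals H σ)
    (hB : 2 * m + n + 3 ≤ B) (hM : Marks (σ.mem 21) F)
    (h30 : Searched G Set.univ (H.snd 2) (σ.mem 30))
    (hX : Searched G (along Fᶜ) (H.fst 1) (σ.mem 32))
    (hY : Searched G (along Fᶜ) (H.snd 1) (σ.mem 34))
    (hn : ¬ G.Reach (along Fᶜ) (H.fst 1) (H.snd 1))
    (hpath : G.Reach Set.univ (H.snd 2) (H.fst 2) → ∃ l, F = edges l ∧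
      G.SimplePath (H.snd 2) (H.fst 2) l ∧ ∀ d ∈ l, σ.mem 30 (G.head d) = code d)
    (h22 : σ.mem 22 = fun _ => 0) (h23 : σ.mem 23 = fun _ => 0) (h36 : σ.mem 36 = fun _ => 0)
    (h38 : σ.mem 38 = fun _ => 0) :
    Meets B detour σ (180 * m + 120 * n + 120) fun τ =>
      G.Eulerian H → G.Feasible H → Prepared G H τ := by
  have hn0 : 0 < n := (H.fst 0).pos
  set lab : ℕ → ℕ := labelOf (σ.mem 32) (σ.mem 34) with hlabdef
  have hlab₁ : ∀ v : Fin n, lab v = 1 ↔ G.Reach (along Fᶜ) (H.fst 1) v := by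
    intro v
    rw [← hX.reach v, hlabdef, labelOf]
    split_ifs <;> simp [*]
  have hlab₂ : ∀ v : Fin n, lab v = 2 ↔ G.Reach (along Fᶜ) (H.snd 1) v := by
    intro v
    -- The label `1` takes precedence, so label `2` describes the second tree correctly only because
    -- the trees are disjoint.
    have hXY : σ.mem 32 v ≠ 0 → σ.mem 34 v ≠ 0 → False := fun h₁ h₂ =>
      hn (((hX.reach v).1 h₁).trans ((hY.reach v).1 h₂).symm_along)
    rw [← hY.reach v, hlabdef, labelOf]
    split_ifs with h₁ h₂
    · simp [h₂]
    · simp [h₂]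
    · simpa using hXY h₁
  have hlable : ∀ v, lab v ≤ 2 := by
    intro v
    rw [hlabdef, labelOf]
    split_ifs <;> omega
  refine Meets.seq_of (t := 4) (t' := 180 * m + 120 * n + 116)
    (Q := fun τ => τ.reg 12 = 0 ∧ τ.reg 13 = 0 ∧ τ.reg 14 = 0 ∧ τ.mem = σ.mem)
    (Meets.of_pre (c := block [copy 12 2, copy 13 2, copy 14 2]) ?_)
    (fun σ₁ ⟨e12, e13, e14, em₁⟩ f₁ => ?_) (by omega)
  · simp [block, Program.pre, State.setReg_reg, State.setReg_mem, hL.reg2]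
  have hL₁ := hL.of_frame f₁ (by decide) (by decide)
  have hT₁ := hT.of_frame f₁ (by decide)
  -- The node `v` and the list `N` exist in any case, but only a path that exists ties them to its
  -- nodes.
  have hwalk : Meets B (trace 30 8 contact) σ₁ (27 * n + 4) fun τ =>
      ∃ (v : Fin n) (N : List (Fin n)), τ.reg 20 = v ∧
        Contacts lab N (τ.reg 12) (τ.reg 13) (τ.reg 14) ∧
        (G.Reach Set.univ (H.snd 2) (H.fst 2) → ∃ l, F = edges l ∧
          G.SimplePath (H.snd 2) (H.fst 2) l ∧ v = H.snd 2 ∧ N = l.map G.head) := by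
    by_cases hr : G.Reach Set.univ (H.snd 2) (H.fst 2)
    · obtain ⟨l, hFl, hl, hpar⟩ := hpath hr
      refine (trace_contact_spec (lab := lab) hL₁ (by omega) (fun u => by rw [em₁]) hT₁.s₃ e12
        ⟨⟨0, hn0⟩, e13⟩ e14 hl (by rw [em₁]; exact hpar) (by rw [em₁]; exact h30.root)).mono
        le_rfl ?_
      rintro τ ⟨h20, hc⟩
      exact ⟨_, _, h20, hc, fun _ => ⟨l, hFl, hl, rfl, rfl⟩⟩
    · have h0 : σ.mem 30 (H.fst 2) = 0 := by
        by_contra h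
        exact hr ((h30.reach _).1 h)
      refine (trace_of_not_reach (t := 27 * n + 4) hL₁.reg2
        (by rw [em₁, hT₁.s₃, h0]) (by omega)).mono le_rfl ?_
      rintro τ ⟨er, -, e20⟩
      refine ⟨H.fst 2, [], by rw [e20, hT₁.s₃], ?_, fun h => absurd h hr⟩
      rw [er 12 (by decide) (by decide), er 13 (by decide) (by decide),
        er 14 (by decide) (by decide), e12, e13, e14]
      exact .none ⟨0, hn0⟩ (by simp)
  refine hwalk.seq_of (t' := 180 * m + 90 * n + 110) (fun σ₂ ⟨v, N, h20, hc, hN⟩ f₂ => ?_)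
    (by omega)
  have hL₂ := hL₁.of_frame f₂ (by decide) (by decide)
  have hT₂ := hT₁.of_frame f₂ (by decide)
  have hlabσ₂ : ∀ u, lab u = labelOf (σ₂.mem 32) (σ₂.mem 34) u := fun u => by
    rw [f₂.mem 32 (by decide), f₂.mem 34 (by decide), em₁]
  refine (contact_spec hL₂.reg2 hL₂.reg3 (by omega) hlabσ₂ h20 hc).seq_of
    (t' := 180 * m + 90 * n + 86) (fun σ₃ ⟨hc₃, em₃⟩ f₃ => ?_) (by omega)
  have hL₃ := hL₂.of_frame f₃ (by decide) (by decide)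
  have hT₃ := hT₂.of_frame f₃ (by decide)
  obtain ⟨j, hj⟩ := hc₃.isNode
  generalize ha : σ₃.reg 12 = a at hc₃
  generalize hf : σ₃.reg 14 = f at hc₃
  rw [hj] at hc₃
  refine (chooseEnds_spec hL₃.reg2 hL₃.reg3 (by omega)).seq_of (t' := 180 * m + 90 * n + 56)
    (fun σ₄ ⟨e17, e15, e16⟩ f₄ => ?_) (by omega)
  have hL₄ := hL₃.of_frame f₄ (by decide) (by decide)
  have hlabσ₃ : labelOf (σ₃.mem 32) (σ₃.mem 34) = lab := by
    funext u; rw [em₃, ← hlabσ₂]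
  set y₁ : Fin n := if a = 1 then H.fst 1 else H.snd 1 with hy₁
  set y₂ : Fin n := if lab (H.fst 0) = a then H.fst 0 else H.snd 0 with hy₂
  rw [ha] at e17
  replace e15 : σ₄.reg 15 = y₁ := by
    rw [e15, ha, hT₃.s₂, hT₃.t₂, hy₁]; split_ifs <;> rfl
  replace e16 : σ₄.reg 16 = y₂ := by
    rw [e16, ha, hT₃.s₁, hT₃.t₁, hlabσ₃, hy₂]; split_ifs <;> rfl
  have hσ₄ : ∀ x, x ≠ 4 → σ₄.mem x = σ.mem x := by
    intro x _
    rw [f₄.mem x (by simp [chooseEnds, label, block, arrays]), em₃,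
      f₂.mem x (by simp [trace, traceStep, contact, label, block, arrays]), em₁]
  refine (markComponent_spec (lab := lab) hL₄ (by omega)
    (fun u => by rw [hσ₄ 32 (by decide), hσ₄ 34 (by decide)])
    (by rw [hσ₄ 22 (by decide), h22]) (by rw [hσ₄ 23 (by decide), h23])).seq_of
    (t' := 120 * m + 90 * n + 54) (fun σ₅ hc₅ f₅ => ?_) (by omega)
  have hL₅ := hL₄.of_frame f₅ (by decide) (by decide)
  have hj₅ : σ₅.reg 13 = j := by rw [f₅.reg 13 (by decide), f₄.reg 13 (by decide), hj]
  rw [hσ₄ 21 (by decide), e17] at hc₅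
  refine (search_spec (b := 22) (p := 36) (q := 37) (rr := 13) hL₅ hB hj₅
    (by rw [f₅.mem 36 (by decide), hσ₄ 36 (by decide), h36]) (by decide) (by decide) (by decide)
    (by decide) (by decide) (by decide)).seq_of (t' := 60 * m + 60 * n + 44)
    (fun σ₆ hS₆ f₆ => ?_) (by omega)
  have hL₆ := hL₅.of_frame f₆ (by decide) (by decide)
  have e15₆ : σ₆.reg 15 = y₁ := by rw [f₆.reg 15 (by decide), f₅.reg 15 (by decide), e15]
  refine (trace_toggle_spec hL₆ hS₆ e15₆ (by decide)).seq_of (t' := 60 * m + 48 * n + 40)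
    (fun σ₇ h₇ f₇ => ?_) (by omega)
  have hL₇ := hL₆.of_frame f₇ (by decide) (by decide)
  have hj₇ : σ₇.reg 13 = j := by rw [f₇.reg 13 (by decide), f₆.reg 13 (by decide), hj₅]
  refine (search_spec (b := 22) (p := 38) (q := 39) (rr := 13) hL₇ hB hj₇
    (by rw [f₇.mem 38 (by decide), f₆.mem 38 (by decide), f₅.mem 38 (by decide),
      hσ₄ 38 (by decide), h38]) (by decide) (by decide) (by decide)
    (by decide) (by decide) (by decide)).seq_of (t' := 18 * n + 30)
    (fun σ₈ hS₈ f₈ => ?_) (by omega)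
  have hL₈ := hL₇.of_frame f₈ (by decide) (by decide)
  have e16₈ : σ₈.reg 16 = y₂ := by
    rw [f₈.reg 16 (by decide), f₇.reg 16 (by decide), f₆.reg 16 (by decide),
      f₅.reg 16 (by decide), e16]
  refine (trace_toggle_spec hL₈ hS₈ e16₈ (by decide)).seq_of (t' := 1)
    (fun τ hτ _ => ⟨1, τ, .skip _, le_rfl, fun hE hF => ?_⟩) (by omega)
  obtain ⟨l, rfl, hl, rfl, rfl⟩ := hN ((hF.reach 2).symm fun _ _ => Set.mem_univ _)
  obtain ⟨A, K, z₁, z₂, l₁, l₂, rfl, hK, hBl⟩ :=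
    blocked_of_contacts hE hF hl hn hlab₁ hlab₂ hlable hc₃
  -- The marks made so far are the complement of `outside`.
  have hbase : ∀ d : Dart m, (if σ.mem 21 (code d) = 0 ∧
      lab (G.tail d) = (if a = 1 then 2 else 1) then 1 else 0) =
      if d.1 ∈ G.outside K (l₁ ++ l₂) then 0 else 1 := by
    intro d
    have hKd := hK (G.tail d)
    have hout := hBl.mem_outside d
    rw [hM d]
    generalize (if a = 1 then 2 else 1) = x at hKd ⊢
    by_cases h₁ : d.1 ∈ edges (l₁ ++ l₂) <;> by_cases h₂ : G.tail d ∈ K <;>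
      simp [h₁, h₂, hKd, hout]
  have hS₅ : {d : Dart m | σ₅.mem 22 (code d) = 0} = along (G.outside K (l₁ ++ l₂)) := by
    ext d
    have : σ₅.mem 22 (code d) = 0 ↔ d.1 ∈ G.outside K (l₁ ++ l₂) := by
      rw [(hc₅ d).1, hbase d]
      by_cases h : d.1 ∈ G.outside K (l₁ ++ l₂) <;> simp [h]
    exact this
  rw [hS₅] at h₇
  obtain ⟨p, hp, hpS, hp'⟩ := h₇ hBl.reach_first
  -- The second search runs in the residual graph of `p`.
  have hS₇ : {d : Dart m | σ₇.mem 22 (code d) = 0} =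
      {d | d ∈ along (G.outside K (l₁ ++ l₂)) ∧ d ∉ p} := by
    ext d
    have : σ₇.mem 22 (code d) = 0 ↔ d.1 ∈ G.outside K (l₁ ++ l₂) ∧ d ∉ p := by
      rw [(hp' d).1, f₆.mem 22 (by decide), (hc₅ d).1, hbase d]
      by_cases h : d.1 ∈ G.outside K (l₁ ++ l₂) <;> by_cases h' : d ∈ p <;> simp [h, h']
    exact this
  rw [hS₇] at hτ
  obtain ⟨q, hq, hqS, hq'⟩ := hτ (hBl.reach_second hE hF hp hpS)
  have hqS' : ∀ d ∈ q, d ∈ along (G.outside K (l₁ ++ l₂)) := fun d hd => (hqS d hd).1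
  -- Inverting along `p` and then along `q` marks the edges of exactly one of them; an edge of both
  -- is inverted back.
  refine ⟨G.outside K (l₁ ++ l₂) \ Blocked.xorEdges p q, ?_, hBl.reach_third hE hp hq hpS hqS',
    hBl.reach_rest hp hq fun d hd => (hqS d hd).2⟩
  ext d
  have h₁ : d.1 ∈ edges p → d.1 ∈ G.outside K (l₁ ++ l₂) := by
    intro h
    obtain ⟨d', hd', he⟩ := mem_edges.1 h
    exact he ▸ hpS d' hd'
  have h₂ : d.1 ∈ edges q → d.1 ∈ G.outside K (l₁ ++ l₂) := by
    intro h
    obtain ⟨d', hd', he⟩ := mem_edges.1 h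
    exact he ▸ hqS' d' hd'
  have : τ.mem 23 (code d) = 0 ↔ d.1 ∈ G.outside K (l₁ ++ l₂) \ Blocked.xorEdges p q := by
    rw [(hq' d).2, f₈.mem 23 (by decide), (hp' d).2, f₆.mem 23 (by decide), (hc₅ d).2, hbase d,
      Finset.mem_sdiff, Blocked.xorEdges, Finset.mem_symmDiff]
    by_cases h₃ : d.1 ∈ G.outside K (l₁ ++ l₂)
    · by_cases h₄ : d.1 ∈ edges p <;> by_cases h₅ : d.1 ∈ edges q <;> simp [h₃, h₄, h₅]
    · simp [h₃, mt h₁ h₃, mt h₂ h₃]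
  exact this

theorem prepare_spec (hL : Loaded G σ) (hT : Terminals H σ) (hB : 2 * m + n + 3 ≤ B)
    (h0 : ∀ a, 20 ≤ a → σ.mem a = fun _ => 0) :
    Meets B prepare σ (360 * m + 240 * n + 200) fun τ =>
      G.Eulerian H → G.Feasible H → Prepared G H τ := by
  refine (search_spec (b := 20) (p := 30) (q := 31) (rr := 11) hL hB hT.t₃ (h0 30 (by decide))
    (by decide) (by decide) (by decide) (by decide) (by decide) (by decide)).seq_of
    (t' := 300 * m + 210 * n + 190) (fun σ₁ hS₁ f₁ => ?_) (by omega)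
  have hL₁ := hL.of_frame f₁ (by decide) (by decide)
  have hT₁ := hT.of_frame f₁ (by decide)
  -- Array `20` is never written, so the first search may use every dart.
  rw [h0 20 (by decide), show {d : Dart m | (0 : ℕ) = 0} = Set.univ from
    Set.eq_univ_of_forall fun _ => rfl] at hS₁
  refine (trace_mark_spec hL₁ hS₁ hT₁.s₃
    (by rw [f₁.mem 21 (by decide), h0 21 (by decide)])).seq_of
    (t' := 300 * m + 200 * n + 180) (fun σ₂ ⟨F, hM, hpath⟩ f₂ => ?_) (by omega)
  have hL₂ := hL₁.of_frame f₂ (by decide) (by decide)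
  have hT₂ := hT₁.of_frame f₂ (by decide)
  refine (search_spec (b := 21) (p := 32) (q := 33) (rr := 7) hL₂ hB hT₂.s₂
    (by rw [f₂.mem 32 (by decide), f₁.mem 32 (by decide), h0 32 (by decide)])
    (by decide) (by decide) (by decide) (by decide) (by decide) (by decide)).seq_of
    (t' := 240 * m + 170 * n + 170) (fun σ₃ hS₃ f₃ => ?_) (by omega)
  have hL₃ := hL₂.of_frame f₃ (by decide) (by decide)
  have hT₃ := hT₂.of_frame f₃ (by decide)
  refine (search_spec (b := 21) (p := 34) (q := 35) (rr := 10) hL₃ hB hT₃.t₂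
    (by rw [f₃.mem 34 (by decide), f₂.mem 34 (by decide), f₁.mem 34 (by decide),
      h0 34 (by decide)])
    (by decide) (by decide) (by decide) (by decide) (by decide) (by decide)).seq_of
    (t' := 180 * m + 120 * n + 130) (fun σ₄ hS₄ f₄ => ?_) (by omega)
  have hL₄ := hL₃.of_frame f₄ (by decide) (by decide)
  have hT₄ := hT₃.of_frame f₄ (by decide)
  have hM₄ : Marks (σ₄.mem 21) F := by
    rw [f₄.mem 21 (by decide), f₃.mem 21 (by decide)]; exact hM
  rw [f₃.mem 21 (by decide), hM.setOf] at hS₄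
  rw [hM.setOf] at hS₃
  refine Meets.seq_of (t := 1) (t' := 180 * m + 120 * n + 125)
    (Q := fun τ => τ.reg 22 = σ₄.mem 32 (H.snd 1) ∧ τ.mem = σ₄.mem)
    (Meets.of_pre (c := load 22 32 10) ?_) (fun σ₅ ⟨e22, em⟩ f₅ => ?_) (by omega)
  · simp [Program.pre, State.setReg_reg, State.setReg_mem, hT₄.t₂]
  have hL₅ := hL₄.of_frame f₅ (by decide) (by decide)
  have hT₅ := hT₄.of_frame f₅ (by decide)
  have hX : Searched G (along Fᶜ) (H.fst 1) (σ₅.mem 32) := by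
    rw [em, f₄.mem 32 (by decide)]; exact hS₃
  have hY : Searched G (along Fᶜ) (H.snd 1) (σ₅.mem 34) := by
    rw [em]; exact hS₄
  have h30 : σ₅.mem 30 = σ₂.mem 30 := by
    rw [em, f₄.mem 30 (by decide), f₃.mem 30 (by decide)]
  have h22 : σ₅.reg 22 = 0 ↔ ¬ G.Reach (along Fᶜ) (H.fst 1) (H.snd 1) := by
    rw [e22, ← em, ← hX.reach, not_not]
  have hz : ∀ a, a ∈ [22, 23, 36, 38] → σ₅.mem a = fun _ => 0 := by
    intro a ha
    have hlist : ∀ a ∈ [22, 23, 36, 38], a ∉ (search 20 30 31 11).arrays ∧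
        a ∉ (trace 30 8 (mark 21)).arrays ∧ a ∉ (search 21 32 33 7).arrays ∧
        a ∉ (search 21 34 35 10).arrays ∧ 20 ≤ a := by decide
    obtain ⟨h₁, h₂, h₃, h₄, h₅⟩ := hlist a ha
    rw [em, f₄.mem a h₄, f₃.mem a h₃, f₂.mem a h₂, f₁.mem a h₁, h0 a h₅]
  have hchoice : Meets B (ite (.eq 22 2) detour (forDarts complement)) σ₅
      (180 * m + 120 * n + 121) fun τ => G.Eulerian H → G.Feasible H → Prepared G H τ := by
    refine (Meets.ite (t := 180 * m + 120 * n + 120) (fun h => ?_) fun h => ?_).mono (by omega)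
      fun _ => id
    · refine detour_spec hL₅ hT₅ hB (by rw [em]; exact hM₄)
        (by rw [h30, f₂.mem 30 (by decide)]; exact hS₁) hX hY
        (h22.1 (Eq.trans h hL₅.reg2)) (by rw [h30]; exact hpath) (hz _ (by simp))
        (hz _ (by simp)) (hz _ (by simp)) (hz _ (by simp))
    · have hr : G.Reach (along Fᶜ) (H.fst 1) (H.snd 1) := by
        by_contra h'
        exact h (Eq.trans (h22.2 h') hL₅.reg2.symm)
      refine (complement_spec hL₅ (by omega) (F := F) (by rw [em]; exact hM₄)).mono (by omega) ?_
      rintro τ hτ - hF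
      obtain ⟨l, rfl, hl, -⟩ := hpath ((hF.reach 2).symm fun _ _ => Set.mem_univ _)
      -- No detour is needed: `E` is the path itself.
      refine ⟨edges l, by rw [hτ.setOf, compl_compl], ?_, hr.symm_along⟩
      exact hl.1.reach fun d hd => mem_edges.2 ⟨d, hd, rfl⟩
  exact hchoice.seq_of (t' := 1) (fun τ h _ => ⟨1, τ, .skip _, le_rfl, h⟩) (by omega)

end

/-! ### The whole program -/

section

open Program Multigraph

variable {n m : ℕ} {G : Multigraph n m} {H : Multigraph n 3} {B : ℕ}

namespace Program

/-- Decide feasibility, and construct the paths. -/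
def solve : Program := block [loadGraph, prepare, finish]

end Program

set_option maxRecDepth 2000 in
theorem solve_spec (hE : G.Eulerian H) (hB : 2 * m + n + 3 ≤ B) :
    Meets B solve (initState G H) (600 * m + 360 * n + 330) fun τ =>
      (G.Feasible H → τ.reg 0 = 1 ∧ ∃ P : Fin 3 → List (Fin m), G.IsSolution H P ∧ Displays τ P) ∧
      (¬ G.Feasible H → τ.reg 0 = 0) := by
  refine (loadGraph_spec G H (by omega)).seq_of (t' := 540 * m + 360 * n + 300)
    (fun σ₁ ⟨hL₁, hT₁⟩ f₁ => ?_) (by omega)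
  have h0 : ∀ a, 20 ≤ a → σ₁.mem a = fun _ => 0 := by
    intro a ha
    have hload : ∀ a ∈ loadGraph.arrays, a < 20 := by decide
    rw [f₁.mem a fun h => by have := hload a h; omega]
    -- In the form `b + 4` the index reduces to the default case of `initState`.
    obtain ⟨b, rfl⟩ := Nat.exists_eq_add_of_le' (show 4 ≤ a by omega)
    rfl
  refine (prepare_spec hL₁ hT₁ hB h0).seq_of (t' := 180 * m + 120 * n + 100)
    (fun σ₂ hP f₂ => ?_) (by omega)
  have hz : ∀ a ∈ [24, 40, 42, 44], σ₂.mem a = fun _ => 0 := by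
    intro a ha
    have hlist : ∀ a ∈ [24, 40, 42, 44], a ∉ prepare.arrays ∧ 20 ≤ a := by decide
    rw [f₂.mem a (hlist a ha).1, h0 a (hlist a ha).2]
  refine (finish_spec (hL₁.of_frame f₂ (by decide) (by decide)) (hT₁.of_frame f₂ (by decide)) hB
    (hz _ (by simp)) (hz _ (by simp)) (hz _ (by simp)) (hz _ (by simp))).seq_of (t' := 1)
    (fun τ h _ => ⟨1, τ, .skip _, le_rfl, ?_⟩) (by omega)
  -- A positive answer comes with a solution; a negative one contradicts `Prepared`, which a
  -- feasible instance guarantees.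
  rcases h with ⟨h₁, P, hP₁, hP₂⟩ | ⟨h₁, h₂⟩
  · exact ⟨fun _ => ⟨h₁, P, hP₁, hP₂⟩, fun h => absurd ⟨P, hP₁⟩ h⟩
  · refine ⟨fun hF => ?_, fun _ => h₁⟩
    obtain ⟨E, hE₁, hE₂, hE₃⟩ := hP hE hF
    exact (h₂ E hE₁ hE hE₂ hE₃).elim

end

end ThreePaths

/-- One fixed program takes every Eulerian instance `(G, H)` with three terminal pairs
`s_i = H.fst i`, `t_i = H.snd i`, decides feasibility (the answer is in register `0`) and, if the
instance is feasible, constructs the three paths, all within `O(m)` steps and with numbers of size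
`O(m)`. As usual `n = O(m)` is assumed: the constant `C` of the time bound may depend on the constant
`K` with `n ≤ K * m`, the program may not. -/
theorem theorem2 :
    ∃ A : ThreePaths.Program, ∀ K : ℕ, ∃ C : ℕ,
      ∀ (n m : ℕ) (G : ThreePaths.Multigraph n m) (H : ThreePaths.Multigraph n 3),
        G.Loopless → G.Eulerian H → n ≤ K * m →
          ∃ (T : ℕ) (τ : ThreePaths.State),
            ThreePaths.Runs (C * m) A (ThreePaths.initState G H) T τ ∧ T ≤ C * m ∧
            (G.Feasible H →
              τ.reg 0 = 1 ∧
                ∃ P : Fin 3 → List (Fin m), G.IsSolution H P ∧ ThreePaths.Displays τ P) ∧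
            (¬ G.Feasible H → τ.reg 0 = 0) := by
  -- Here `930 = 600 + 330`: since `m ≥ 1`, the additive constant is absorbed, and `360 * n ≤ 360 *
  -- (K * m)`.
  refine ⟨ThreePaths.Program.solve, fun K => ⟨930 + 360 * K, fun n m G H _ hE hn => ?_⟩⟩
  -- Without edges `n ≤ K * m` would leave no node, but the terminals are nodes.
  have hm : 1 ≤ m := by
    by_contra h
    obtain rfl : m = 0 := by omega
    have := (H.fst 0).pos
    omega
  have hC : (930 + 360 * K) * m = 930 * m + 360 * (K * m) := by ring
  obtain ⟨T, τ, hrun, hT, hτ⟩ :=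
    ThreePaths.solve_spec (B := (930 + 360 * K) * m) hE (by rw [hC]; omega)
  exact ⟨T, τ, hrun, hT.trans (by rw [hC]; omega), hτ⟩
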